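/- For a finite field $\mathbb F$ with $q$ elements, a generator $\gamma$ of $\mathbb F^*$, and integers $m\ge 1$, $k\ge 0$, let $n$ be the largest multiple of $m$ with $n\le q-1$, and suppose $k<n$. The $m$-folded Reed-Solomon code $\mathsf{FRS}_{\mathbb F,\gamma,m,k}$ is the code of block length $N=n/m$ over the alphabet $\mathbb F^m$ whose codewords are the encodings of the polynomials $f\in\mathbb F[X]$ of degree at most $k$; the $j$-th symbol of the encoding of $f$, $0\le j<N$, is $\bigl(f(\gamma^{jm}),f(\gamma^{jm+1}),\dots,f(\gamma^{jm+m-1})\bigr)$. The rate of a code $C\subseteq\Sigma^N$ is $\log_{|\Sigma|}|C|/N$. Theorem. There are a constant $A$, a polynomial $P$ and an algorithm (a program for a random access machine that does addition, truncated subtraction, division with remainder, comparison with $0$ and indirect addressing at unit cost) such that the following holds for every $\varepsilon>0$ and every $0<R<1$. There are an integer $m\le A\max\{1,1/\varepsilon\}$ and an infinite family of $m$-folded Reed-Solomon codes with unbounded block lengths, all of rate at least $R$, which the algorithm list decodes up to a fraction $1-(1+\varepsilon)R^{2/3}$ of errors in time polynomial in the block length and $1/\varepsilon$. That is, for every code in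 the family, of block length $N$, every integer $e\ge 0$ with $e\le\bigl(1-(1+\varepsilon)R^{2/3}\bigr)N$ and every received word $z\in(\mathbb F^m)^N$, the algorithm, given $q,\gamma,m,k$, the addition and multiplication tables of $\mathbb F$ (with respect to an arbitrary numbering of its elements), $e$ and $z$, outputs within $P(N,1/\varepsilon)$ steps a list, without repetitions, of precisely the codewords that differ from $z$ in at most $e$ positions. -/

import Mathlib

open Polynomial Filter

/-! ## A random access machine with a step count -/

namespace RAM

/-- A memory state: registers `reg i`, and memory banks, `mem a x` being the cell of bank `a` at
address `x`. A program mentions only finitely many registers and banks. -/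
structure State where
  reg : ℕ → ℕ
  mem : ℕ → ℕ → ℕ

/-- Elementary instructions. There is no unit-cost multiplication: the largest number in the state
at most doubles with each instruction (up to the constants in the program), so that running times
of this machine and of multi-tape Turing machines are polynomially related. -/
inductive Instr where
  | const (i c : ℕ)
  | copy (i j : ℕ)
  | add (i j l : ℕ)
  | sub (i j l : ℕ)
  | div (i j l : ℕ)
  | mod (i j l : ℕ)
  | load (i a j : ℕ)
  | store (a i j : ℕ)

/-- `s.set i v` is `s` with register `i` overwritten by `v`. -/
def State.set (s : State) (i v : ℕ) : State :=
  { s with reg := Function.update s.reg i v }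

/-- The effect of an elementary instruction; `load` and `store` use indirect addressing. -/
def Instr.apply : Instr → State → State
  | .const i c, s => s.set i c
  | .copy i j, s => s.set i (s.reg j)
  | .add i j l, s => s.set i (s.reg j + s.reg l)
  | .sub i j l, s => s.set i (s.reg j - s.reg l)
  | .div i j l, s => s.set i (s.reg j / s.reg l)
  | .mod i j l, s => s.set i (s.reg j % s.reg l)
  | .load i a j, s => s.set i (s.mem a (s.reg j))
  | .store a i j, s =>
      { s with mem := Function.update s.mem a (Function.update (s.mem a) (s.reg i) (s.reg j)) }

/-- Programs: instructions, sequencing, and branches and loops that test whether a register is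
nonzero. -/
inductive Prog where
  | skip
  | instr (c : Instr)
  | seq (p q : Prog)
  | ite (i : ℕ) (p q : Prog)
  | while (i : ℕ) (p : Prog)

/-- `Exec p s t s'`: the program `p`, started in state `s`, halts in state `s'` after exactly `t`
steps. Every instruction and every test costs one step. -/
inductive Exec : Prog → State → ℕ → State → Prop where
  | skip (s : State) : Exec .skip s 1 s
  | instr (c : Instr) (s : State) : Exec (.instr c) s 1 (c.apply s)
  | seq {p q : Prog} {s₁ s₂ s₃ : State} {t₁ t₂ : ℕ} (h₁ : Exec p s₁ t₁ s₂) (h₂ : Exec q s₂ t₂ s₃) :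
      Exec (.seq p q) s₁ (t₁ + t₂) s₃
  | ite_true {i : ℕ} {p q : Prog} {s s' : State} {t : ℕ} (hi : s.reg i ≠ 0) (h : Exec p s t s') :
      Exec (.ite i p q) s (t + 1) s'
  | ite_false {i : ℕ} {p q : Prog} {s s' : State} {t : ℕ} (hi : s.reg i = 0) (h : Exec q s t s') :
      Exec (.ite i p q) s (t + 1) s'
  | while_false {i : ℕ} {p : Prog} {s : State} (hi : s.reg i = 0) : Exec (.while i p) s 1 s
  | while_true {i : ℕ} {p : Prog} {s₁ s₂ s₃ : State} {t₁ t₂ : ℕ} (hi : s₁.reg i ≠ 0)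
      (h₁ : Exec p s₁ t₁ s₂) (h₂ : Exec (.while i p) s₂ t₂ s₃) :
      Exec (.while i p) s₁ (t₁ + t₂ + 1) s₃

/-- The initial state: the input list in bank `0`, its length in register `0`, and zeros
everywhere else. -/
def State.init (x : List ℕ) : State where
  reg i := if i = 0 then x.length else 0
  mem a j := if a = 0 then x.getD j 0 else 0

/-- The output of a final state: bank `0` holds the output list, register `0` its length. -/
def State.output (s : State) : List ℕ :=
  (List.range (s.reg 0)).map (s.mem 0)

/-- On input `x`, the program `p` halts with output `y` after at most `T` steps. -/
def Prog.OutputsWithin (p : Prog) (x y : List ℕ) (T : ℝ) : Prop :=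
  ∃ (t : ℕ) (s : State), Exec p (State.init x) t s ∧ (t : ℝ) ≤ T ∧ s.output = y

end RAM

/-! ## Folded Reed-Solomon codes -/

/-- The rate `log_{|S|} |C| / N` of a block code `C ⊆ S ^ N` over the alphabet `S`. -/
noncomputable def codeRate {S : Type*} [Fintype S] {N : ℕ} (C : Set (Fin N → S)) : ℝ :=
  Real.logb (Fintype.card S) C.ncard / N

/-- The parameters of a folded Reed-Solomon code: a finite field `F`, a generator `γ` of its
multiplicative group, a folding parameter `m ≥ 1`, and a degree bound `k` for the messages. The
length `n` of the unfolded code is the largest multiple of `m` that is at most `|F| - 1`, and the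
number `k + 1` of message symbols must not exceed it. -/
structure FoldedRS where
  F : Type
  [field : Field F]
  [fintype : Fintype F]
  γ : Fˣ
  γ_generates : ∀ x : Fˣ, x ∈ Subgroup.zpowers γ
  m : ℕ
  one_le_m : 1 ≤ m
  k : ℕ
  k_lt : k < m * ((Fintype.card F - 1) / m)

namespace FoldedRS

attribute [instance] FoldedRS.field FoldedRS.fintype

/-- The size `q` of the field. -/
def q (C : FoldedRS) : ℕ := Fintype.card C.F

/-- The block length `N = n / m`. -/
def blockLength (C : FoldedRS) : ℕ := (C.q - 1) / C.m

/-- Words of length `N` over the alphabet `F ^ m`. -/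
abbrev Word (C : FoldedRS) : Type := Fin C.blockLength → Fin C.m → C.F

/-- The encoding of `f`: its `j`-th symbol is `(f(γ^(jm)), f(γ^(jm+1)), …, f(γ^(jm+m-1)))`. -/
def encode (C : FoldedRS) (f : C.F[X]) : C.Word :=
  fun j l => f.eval ((C.γ : C.F) ^ ((j : ℕ) * C.m + (l : ℕ)))

/-- The set of all codewords, the encodings of the polynomials of degree at most `k`. -/
def code (C : FoldedRS) : Set C.Word :=
  C.encode '' {f : C.F[X] | f.natDegree ≤ C.k}

/-- The rate of the code over the alphabet `F ^ m`. -/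
noncomputable def rate (C : FoldedRS) : ℝ := codeRate C.code

open Classical in
/-- The number of positions `j < N` at which two words over `F ^ m` differ. -/
noncomputable def dist (C : FoldedRS) (x y : C.Word) : ℕ := hammingDist x y

/-- `L` is a list, without repetitions, of precisely the codewords that differ from the received
word `z` in at most `e` positions. -/
def IsDecodedList (C : FoldedRS) (z : C.Word) (e : ℕ) (L : List C.Word) : Prop :=
  L.Nodup ∧ ∀ c : C.Word, c ∈ L ↔ c ∈ C.code ∧ C.dist c z ≤ e

/-- A word as the list of its `n = N m` field elements, in the order of the unfolded code. Field
elements are written as numbers below `q`, by means of a numbering `num` of the field. -/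
def wordToNat (C : FoldedRS) (num : C.F ≃ Fin C.q) (z : C.Word) : List ℕ :=
  (List.finRange C.blockLength).flatMap fun j =>
    (List.finRange C.m).map fun l => (num (z j l) : ℕ)

/-- The table of a binary operation on the field, row by row. -/
def table (C : FoldedRS) (num : C.F ≃ Fin C.q) (op : C.F → C.F → C.F) : List ℕ :=
  (List.finRange C.q).flatMap fun a =>
    (List.finRange C.q).map fun b => (num (op (num.symm a) (num.symm b)) : ℕ)

/-- The input of a decoder: the code (that is `q`, `γ`, `m`, `k`, and the addition and
multiplication tables of the field), the error bound `e` and the received word `z`. -/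
def decoderInput (C : FoldedRS) (num : C.F ≃ Fin C.q) (e : ℕ) (z : C.Word) : List ℕ :=
  [C.q, (num (C.γ : C.F) : ℕ), C.m, C.k, e] ++ C.table num (· + ·) ++ C.table num (· * ·) ++
    C.wordToNat num z

/-- The program `p` list decodes `C` from `e` errors within `T` steps: for every numbering of the
field and every received word, it outputs the concatenation of a list of all codewords that differ
from the received word in at most `e` positions. -/
def ListDecodesWithin (C : FoldedRS) (p : RAM.Prog) (e : ℕ) (T : ℝ) : Prop :=
  ∀ (num : C.F ≃ Fin C.q) (z : C.Word), ∃ L : List C.Word, C.IsDecodedList z e L ∧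
    p.OutputsWithin (C.decoderInput num e z) (L.flatMap (C.wordToNat num)) T

end FoldedRS

namespace RAM

/-! ## Running time bounds for programs -/

/-! The decoder interpolates in three variables. Let `t = N - e` be the number of agreements that a
codeword must have. One looks for a nonzero Q(X, Y, Z) of (1, k, k)-weighted degree below D = m t (m
- 1) that vanishes to order m at every point (γ^P, z_P, z_(P+1)) with P and P + 1 in the same block;
a block contains m - 1 such points. Each point costs binom(m + 2, 3) linear conditions
(`card_active`), and at least D^3 / (6 k^2) monomials are available (`card_monomials`). So Q exists
by linear algebra when the inequality `counting_condition` holds. With m - 1 = ⌈3/ε⌉ it does, for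
every radius up to 1 - (1 + ε) R^(2/3). If f agrees with z on t blocks, then Q(X, f(X), f(γX)) has
degree below D but at least D zeros counted with multiplicity, so it is zero
(`Encodes.interp_spec`).

The polynomial E = X^(q-1) - γ is irreducible over F, and f(γX) ≡ f(X)^q modulo E
(`irreducible_X_pow_sub_C`, `pow_card_pow_of_pow_eq`). Hence, in K = F[X]/(E), the residue of f is a
root of the one-variable polynomial Q(X, Y, Y^q). If this polynomial is zero in K[Y], one divides by
a power of E, that is, one takes the first nonzero digit of the expansion in powers of E
(`Encodes.poly_spec`). The result is nonzero of degree below q^2. Since deg f ≤ k < q - 1, the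
coordinates of the residue are the coefficients of f.

The field K has q^(q-1) elements, yet the roots have to be found deterministically in time
polynomial in q. They are found by a search through the coordinate prefixes. The elements with a
prescribed j-th coordinate are the zeros in K of an explicit polynomial `coordPoly`, a sum of terms
in Y^(q^u) plus a constant, and for j = 0 this polynomial splits over K
(`IsKummer.splits_coordPoly_zero`). So T has a root with a given nonempty prefix exactly if T and
the coordinate polynomials have a common factor of positive degree, that is, if some nonzero residue
modulo T is annihilated by all of them (`IsKummer.exists_root_of_dvd`, `exists_dvd_of_root`). This
is a system of linear equations over F (`Encodes.viable_iff`). At most deg T < q^2 prefixes of each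
length survive. A final comparison with z discards the roots that are not close.

For the running time, `PT` is a predicate on total functions, closed under composition, branching
and loops whose states are bounded in advance. The decoder is written as a function on lists of
numbers, and `Decoder.pt_decode` holds for arbitrary inputs, independently of correctness. Sizes are
unary, which is enough because the input has size polynomial in q, and q ≤ m (N + 1) with m = O(1 +
1/ε). -/

@[simp] theorem State.set_reg (s : State) (i v j : ℕ) :
    (s.set i v).reg j = if j = i then v else s.reg j := by
  simp [State.set, Function.update_apply]

@[simp] theorem State.set_mem (s : State) (i v : ℕ) : (s.set i v).mem = s.mem := rfl

/-- Started in `s`, the program `p` halts after at most `T` steps in a state satisfying `Q`. -/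
def Runs (p : Prog) (s : State) (T : ℕ) (Q : State → Prop) : Prop :=
  ∃ t s', Exec p s t s' ∧ t ≤ T ∧ Q s'

theorem Runs.mono {p : Prog} {s : State} {T T' : ℕ} {Q Q' : State → Prop} (h : Runs p s T Q)
    (hT : T ≤ T') (hQ : ∀ s', Q s' → Q' s') : Runs p s T' Q' := by
  obtain ⟨t, s', h1, h2, h3⟩ := h
  exact ⟨t, s', h1, h2.trans hT, hQ _ h3⟩

theorem Runs.seq {p q : Prog} {s : State} {T₁ T₂ : ℕ} {Q Q' : State → Prop}
    (h₁ : Runs p s T₁ Q) (h₂ : ∀ s', Q s' → Runs q s' T₂ Q') :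
    Runs (.seq p q) s (T₁ + T₂) Q' := by
  obtain ⟨t, s', h1, h2, h3⟩ := h₁
  obtain ⟨t', s'', h1', h2', h3'⟩ := h₂ _ h3
  exact ⟨t + t', s'', .seq h1 h1', by omega, h3'⟩

theorem Runs.instr {c : Instr} {s : State} {Q : State → Prop} (h : Q (c.apply s)) :
    Runs (.instr c) s 1 Q :=
  ⟨1, _, .instr c s, le_rfl, h⟩

theorem Runs.instr_seq {c : Instr} {p : Prog} {s : State} {T : ℕ} {Q : State → Prop}
    (h : Runs p (c.apply s) T Q) : Runs (.seq (.instr c) p) s (1 + T) Q :=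
  Runs.seq (Q := fun s' => s' = c.apply s) (Runs.instr rfl) (by rintro _ rfl; exact h)

theorem Runs.ite {i : ℕ} {p q : Prog} {s : State} {T : ℕ} {Q : State → Prop}
    (h₁ : s.reg i ≠ 0 → Runs p s T Q) (h₂ : s.reg i = 0 → Runs q s T Q) :
    Runs (.ite i p q) s (T + 1) Q := by
  by_cases h : s.reg i = 0
  · obtain ⟨t, s', h1, h2, h3⟩ := h₂ h
    exact ⟨t + 1, s', .ite_false h h1, by omega, h3⟩
  · obtain ⟨t, s', h1, h2, h3⟩ := h₁ h
    exact ⟨t + 1, s', .ite_true h h1, by omega, h3⟩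

/-- The invariant is indexed by the number of remaining rounds, which is also the content of the
tested register, so termination and cost come out of the same induction. -/
theorem Runs.countdown {i n T : ℕ} {p : Prog} {I : ℕ → State → Prop}
    (hI : ∀ c s, I c s → s.reg i = c)
    (hp : ∀ c s, c < n → I (c + 1) s → Runs p s T (I c)) :
    ∀ c ≤ n, ∀ s, I c s → Runs (.while i p) s (c * (T + 1) + 1) (I 0) := by
  intro c
  induction c with
  | zero => exact fun _ s h => ⟨1, s, .while_false (hI _ _ h), by omega, h⟩
  | succ c ih =>
    intro hc s h
    obtain ⟨t, s', h1, h2, h3⟩ := hp c s hc h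
    obtain ⟨t', s'', h1', h2', h3'⟩ := ih (by omega) s' h3
    refine ⟨t + t' + 1, s'', .while_true (by rw [hI _ _ h]; omega) h1 h1', ?_, h3'⟩
    rw [Nat.succ_mul]; omega

/-- Two states have the same register and the same memory bank with number `i`. -/
def Same (s s' : State) (i : ℕ) : Prop := s'.reg i = s.reg i ∧ s'.mem i = s.mem i

theorem Same.trans {s s' s'' : State} {i : ℕ} (h : Same s s' i) (h' : Same s' s'' i) :
    Same s s'' i := ⟨h'.1.trans h.1, h'.2.trans h.2⟩

/-! ## Data types and polynomial time -/

/-- A type whose elements are stored in `width` consecutive registers and memory banks. -/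
class Data (α : Type) where
  width : ℕ
  size : α → ℕ
  Holds : α → ℕ → State → Prop
  holds_of_same : ∀ {a ℓ s s'}, (∀ i, ℓ ≤ i → i < ℓ + width → Same s s' i) →
    Holds a ℓ s → Holds a ℓ s'
  moveCost : ℕ
  -- The program is chosen before the element, and everything from `S` on is scratch space.
  move : ∀ ℓ ℓ' S, ℓ + width ≤ S → ℓ' + width ≤ S → (ℓ + width ≤ ℓ' ∨ ℓ' + width ≤ ℓ) →
    ∃ p, ∀ a s, Holds a ℓ s → Runs p s (moveCost * (size a + 1)) fun s' =>
      Holds a ℓ' s' ∧ ∀ i < S, (i < ℓ' ∨ ℓ' + width ≤ i) → Same s s' i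
  const : ∀ a, ∃ c, ∀ ℓ, ∃ p, ∀ s, Runs p s c fun s' => Holds a ℓ s' ∧ ∀ i < ℓ, Same s s' i

open Data

/-- Size is the value itself, not the number of digits. Polynomial time thus means polynomial in the
numbers, which suffices because the entries of a decoder input are at most `q` when `e` is at most
the block length. -/
instance : Data ℕ where
  width := 1
  size n := n
  Holds n ℓ s := s.reg ℓ = n
  holds_of_same {a ℓ s s'} h h' := by rw [(h ℓ le_rfl (by omega)).1, h']
  moveCost := 1
  move ℓ ℓ' S _ _ _ := by
    refine ⟨.instr (.copy ℓ' ℓ), fun a s h => (Runs.instr ?_).mono (by omega) (fun _ h => h)⟩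
    refine ⟨by simp [Instr.apply, h], fun i _ hi => ?_⟩
    have : i ≠ ℓ' := by omega
    simp [Same, Instr.apply, this]
  const a := ⟨1, fun ℓ => ⟨.instr (.const ℓ a), fun s => Runs.instr
    ⟨by simp [Instr.apply], fun i hi => by
      have : i ≠ ℓ := by omega
      simp [Same, Instr.apply, this]⟩⟩⟩

/-- Copying a list from bank `ℓ` to bank `ℓ'`, with scratch registers `S`, `S + 1` and `S + 2`. -/
def copyList (ℓ ℓ' S : ℕ) : Prog :=
  .seq (.instr (.copy S ℓ)) (.seq (.instr (.const (S + 1) 1))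
    (.seq (.while S (.seq (.instr (.sub S S (S + 1)))
      (.seq (.instr (.load (S + 2) ℓ S)) (.instr (.store ℓ' S (S + 2))))))
      (.instr (.copy ℓ' ℓ))))

theorem runs_copyList {ℓ ℓ' S : ℕ} (h₁ : ℓ < S) (h : ℓ ≠ ℓ') (s : State) :
    Runs (copyList ℓ ℓ' S) s (s.reg ℓ * 4 + 4) fun s' =>
      s'.reg ℓ' = s.reg ℓ ∧ (∀ j < s.reg ℓ, s'.mem ℓ' j = s.mem ℓ j) ∧
      ∀ i < S, i ≠ ℓ' → Same s s' i := by
  refine (Runs.instr_seq (Runs.instr_seq (Runs.seq (Q := fun s' =>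
    (s'.reg S = 0 ∧ s'.reg (S + 1) = 1 ∧ (∀ i < S, i ≠ ℓ' → Same s s' i) ∧
      ∀ j, 0 ≤ j → j < s.reg ℓ → s'.mem ℓ' j = s.mem ℓ j)) ?_ ?_ (T₂ := 1)))).mono
        (T := 1 + (1 + (s.reg ℓ * 4 + 1 + 1))) (by omega) (fun _ h => h)
  · refine Runs.countdown (n := s.reg ℓ) (T := 3) (I := fun c s' =>
      s'.reg S = c ∧ s'.reg (S + 1) = 1 ∧ (∀ i < S, i ≠ ℓ' → Same s s' i) ∧
      ∀ j, c ≤ j → j < s.reg ℓ → s'.mem ℓ' j = s.mem ℓ j) (fun c s h => h.1) ?_ _ le_rfl _ ?_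
    · rintro c s' hc ⟨e1, e2, e3, e4⟩
      refine (Runs.instr_seq (Runs.instr_seq (Runs.instr ?_))).mono (T := 3) le_rfl (fun _ h => h)
      have h3 := (e3 ℓ h₁ h).2
      refine ⟨by simp [Instr.apply, e1, e2], by simp [Instr.apply, e2], fun i hi hi' => ?_,
        fun j hj hj' => ?_⟩
      · have := e3 i hi hi'
        have n1 : i ≠ S := by omega
        have n2 : i ≠ S + 2 := by omega
        simpa [Same, Instr.apply, Function.update_apply, hi', n1, n2] using this
      · rcases eq_or_lt_of_le hj with rfl | hj
        · simp [Instr.apply, e1, e2, h3]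
        · have : j ≠ c := by omega
          simpa [Instr.apply, e1, e2, this] using e4 j (by omega) hj'
    · have n1 : ℓ ≠ S := by omega
      refine ⟨by simp [Instr.apply], by simp [Instr.apply], fun i hi hi' => ?_,
        fun j hj hj' => by omega⟩
      have n1 : i ≠ S := by omega
      have n2 : i ≠ S + 1 := by omega
      simp [Same, Instr.apply, n1, n2]
  · rintro s' ⟨e1, e2, e3, e4⟩
    refine Runs.instr ⟨by simp [Instr.apply, (e3 ℓ h₁ h).1], fun j hj => e4 j (by omega) hj,
      fun i hi hi' => ?_⟩
    simpa [Same, Instr.apply, hi'] using e3 i hi hi'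

/-- Cells beyond the length are unconstrained, so a bank need not be cleared before it is reused. -/
instance : Data (List ℕ) where
  width := 1
  size l := l.length + l.sum
  Holds l ℓ s := s.reg ℓ = l.length ∧ ∀ i < l.length, s.mem ℓ i = l.getD i 0
  holds_of_same {a ℓ s s'} h h' := by
    rwa [(h ℓ le_rfl (by omega)).1, (h ℓ le_rfl (by omega)).2]
  moveCost := 4
  move ℓ ℓ' S _ _ _ := by
    refine ⟨copyList ℓ ℓ' S, fun a s h => (runs_copyList (by omega) (by omega) s).mono
      (by rw [h.1]; omega) ?_⟩
    rintro s' ⟨e1, e2, e3⟩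
    refine ⟨⟨by rw [e1, h.1], fun i hi => ?_⟩, fun i hi hi' => e3 i hi (by omega)⟩
    rw [e2 i (by rw [h.1]; exact hi), h.2 i hi]
  const a := by
    induction a using List.reverseRecOn with
    | nil => exact ⟨1, fun ℓ => ⟨.instr (.const ℓ 0), fun s => Runs.instr
        ⟨⟨by simp [Instr.apply], by simp⟩, fun i hi => by
          have : i ≠ ℓ := by omega
          simp [Same, Instr.apply, this]⟩⟩⟩
    | append_singleton l a ih =>
      obtain ⟨c, hc⟩ := ih
      refine ⟨c + 4, fun ℓ => ?_⟩
      obtain ⟨p, hp⟩ := hc ℓ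
      refine ⟨.seq p (.seq (.instr (.const (ℓ + 1) l.length)) (.seq (.instr (.const (ℓ + 2) a))
        (.seq (.instr (.store ℓ (ℓ + 1) (ℓ + 2))) (.instr (.const ℓ (l.length + 1)))))),
        fun s => (hp s).seq ?_⟩
      rintro s' ⟨⟨h1, h2⟩, h3⟩
      refine (Runs.instr_seq (Runs.instr_seq (Runs.instr_seq (Runs.instr ?_)))).mono
        (T := 4) (by omega) (fun _ h => h)
      refine ⟨⟨by simp [Instr.apply], fun i hi => ?_⟩, fun i hi => ?_⟩
      · rcases Nat.lt_or_ge i l.length with hi' | hi'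
        · have : i ≠ l.length := by omega
          rw [List.getD_append _ _ _ _ hi', ← h2 i hi']
          simp [Instr.apply, this]
        · have : i = l.length := by simp at hi; omega
          simp [Instr.apply, this]
      · have n1 : i ≠ ℓ := by omega
        have n2 : i ≠ ℓ + 1 := by omega
        have n3 : i ≠ ℓ + 2 := by omega
        simpa [Same, Instr.apply, n1, n2, n3] using h3 i hi

instance {α β : Type} [Data α] [Data β] : Data (α × β) where
  width := width α + width β
  size x := size x.1 + size x.2
  Holds x ℓ s := Holds x.1 ℓ s ∧ Holds x.2 (ℓ + width α) s
  holds_of_same h h' := ⟨holds_of_same (fun i h1 h2 => h i h1 (by omega)) h'.1,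
    holds_of_same (fun i h1 h2 => h i (by omega) (by omega)) h'.2⟩
  moveCost := moveCost α + moveCost β
  move ℓ ℓ' S _ _ _ := by
    obtain ⟨p, hp⟩ := move (α := α) ℓ ℓ' S (by omega) (by omega) (by omega)
    obtain ⟨q, hq⟩ := move (α := β) (ℓ + width α) (ℓ' + width α) S (by omega) (by omega) (by omega)
    refine ⟨.seq p q, fun a s h => ((hp a.1 s h.1).seq
      (T₂ := moveCost β * (size a.2 + 1)) ?_).mono (by nlinarith) (fun _ h => h)⟩
    rintro s' ⟨e1, e2⟩
    refine (hq a.2 s' (holds_of_same (fun i h1 h2 => ?_) h.2)).mono le_rfl ?_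
    · exact e2 i (by omega) (by omega)
    · rintro s'' ⟨e3, e4⟩
      refine ⟨⟨holds_of_same (fun i h1 h2 => e4 i (by omega) (by omega)) e1, e3⟩, fun i hi hi' => ?_⟩
      exact (e2 i hi (by omega)).trans (e4 i hi (by omega))
  const a := by
    obtain ⟨c, hc⟩ := const a.1
    obtain ⟨c', hc'⟩ := const a.2
    refine ⟨c + c', fun ℓ => ?_⟩
    obtain ⟨p, hp⟩ := hc ℓ
    obtain ⟨q, hq⟩ := hc' (ℓ + width α)
    refine ⟨.seq p q, fun s => (hp s).seq fun s' h => (hq s').mono le_rfl fun s'' h' => ?_⟩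
    exact ⟨⟨holds_of_same (fun i h1 h2 => h'.2 i (by omega)) h.1, h'.1⟩,
      fun i hi => (h.2 i hi).trans (h'.2 i (by omega))⟩

@[simp] theorem size_nat (n : ℕ) : size n = n := rfl
@[simp] theorem size_list (l : List ℕ) : size l = l.length + l.sum := rfl
@[simp] theorem size_prod {α β : Type} [Data α] [Data β] (x : α × β) :
    size x = size x.1 + size x.2 := rfl
@[simp] theorem width_nat : width ℕ = 1 := rfl
@[simp] theorem width_list : width (List ℕ) = 1 := rfl
@[simp] theorem width_prod {α β : Type} [Data α] [Data β] :
    width (α × β) = width α + width β := rfl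

/-- `g` is bounded by a polynomial. -/
def PolyBdd (g : ℕ → ℕ) : Prop := ∃ c, ∀ n, g n ≤ (n + 2) ^ c

theorem PolyBdd.mono {f g : ℕ → ℕ} (hg : PolyBdd g) (h : ∀ n, f n ≤ g n) : PolyBdd f := by
  obtain ⟨c, hc⟩ := hg
  exact ⟨c, fun n => (h n).trans (hc n)⟩

theorem PolyBdd.const (a : ℕ) : PolyBdd fun _ => a :=
  ⟨a, fun n => (Nat.lt_two_pow_self (n := a)).le.trans (Nat.pow_le_pow_left (by omega) a)⟩

theorem PolyBdd.id : PolyBdd fun n => n := ⟨1, fun n => by simp⟩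

theorem PolyBdd.mul {f g : ℕ → ℕ} (hf : PolyBdd f) (hg : PolyBdd g) :
    PolyBdd fun n => f n * g n := by
  obtain ⟨c, hc⟩ := hf
  obtain ⟨d, hd⟩ := hg
  exact ⟨c + d, fun n => by rw [pow_add]; exact Nat.mul_le_mul (hc n) (hd n)⟩

theorem PolyBdd.add {f g : ℕ → ℕ} (hf : PolyBdd f) (hg : PolyBdd g) :
    PolyBdd fun n => f n + g n := by
  obtain ⟨c, hc⟩ := hf
  obtain ⟨d, hd⟩ := hg
  refine ⟨c + d + 1, fun n => ?_⟩
  have h1 : (n + 2) ^ c ≤ (n + 2) ^ (c + d) := Nat.pow_le_pow_right (by omega) (by omega)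
  have h2 : (n + 2) ^ d ≤ (n + 2) ^ (c + d) := Nat.pow_le_pow_right (by omega) (by omega)
  have := hc n; have := hd n
  rw [pow_succ]; nlinarith

theorem PolyBdd.pow {f : ℕ → ℕ} (hf : PolyBdd f) (a : ℕ) : PolyBdd fun n => f n ^ a := by
  obtain ⟨c, hc⟩ := hf
  exact ⟨c * a, fun n => by rw [pow_mul]; exact Nat.pow_le_pow_left (hc n) a⟩

/-- `f` is computed by a program in time polynomial in the size of the argument. The program finds
its argument at `ℓ`, leaves the result at `ℓ'`, and changes nothing below `ℓ'`. -/
@[fun_prop]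
def PT {α β : Type} [Data α] [Data β] (f : α → β) : Prop :=
  ∃ g, PolyBdd g ∧ Monotone g ∧ (∀ x, size (f x) ≤ g (size x)) ∧
    ∀ ℓ ℓ', ℓ + width α ≤ ℓ' → ∃ p, ∀ x s, Holds x ℓ s →
      Runs p s (g (size x)) fun s' => Holds (f x) ℓ' s' ∧ ∀ i < ℓ', Same s s' i

/-- Monotonicity costs nothing: any polynomially bounded `g` lies below some `(n + 2) ^ c`, which is
monotone. -/
theorem PT.of_bound {α β : Type} [Data α] [Data β] {f : α → β} {g : ℕ → ℕ} (hg : PolyBdd g)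
    (hs : ∀ x, size (f x) ≤ g (size x))
    (hp : ∀ ℓ ℓ', ℓ + width α ≤ ℓ' → ∃ p, ∀ x s, Holds x ℓ s →
      Runs p s (g (size x)) fun s' => Holds (f x) ℓ' s' ∧ ∀ i < ℓ', Same s s' i) : PT f := by
  obtain ⟨c, hc⟩ := hg
  refine ⟨fun n => (n + 2) ^ c, ⟨c, fun n => le_rfl⟩,
    fun a b h => Nat.pow_le_pow_left (by omega) c, fun x => (hs x).trans (hc _),
    fun ℓ ℓ' h => ?_⟩
  obtain ⟨p, hp⟩ := hp ℓ ℓ' h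
  exact ⟨p, fun x s hx => (hp x s hx).mono (hc _) fun _ h => h⟩

/-! ### Elementary polynomial time functions, composition, branching and iteration -/

section Primitives

variable {α β γ : Type} [Data α] [Data β] [Data γ]

@[fun_prop]
theorem PT.id : PT fun x : α => x := by
  refine PT.of_bound (g := fun n => moveCost α * (n + 1) + n)
    (((PolyBdd.const _).mul (PolyBdd.id.add (.const _))).add .id)
    (fun x => by omega) fun ℓ ℓ' h => ?_
  obtain ⟨p, hp⟩ := move (α := α) ℓ ℓ' (ℓ' + width α) (by omega) (by omega) (by omega)
  exact ⟨p, fun x s hx => (hp x s hx).mono (by omega) fun s' h => ⟨h.1, fun i hi =>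
    h.2 i (by omega) (by omega)⟩⟩

@[fun_prop]
theorem PT.const (y : β) : PT fun _ : α => y := by
  obtain ⟨c, hc⟩ := Data.const y
  refine PT.of_bound (g := fun _ => size y + c) (.const _) (fun x => by omega) fun ℓ ℓ' h => ?_
  obtain ⟨p, hp⟩ := hc ℓ'
  exact ⟨p, fun x s hx => (hp s).mono (by omega) fun _ h => h⟩

-- A program may change only what lies at or above its target. So the intermediate and the final
-- value are computed above the slot reserved at `ℓ'`, and the result is then moved down into it.
@[fun_prop]
theorem PT.comp {g : β → γ} {f : α → β} (hg : PT g) (hf : PT f) : PT fun x => g (f x) := by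
  obtain ⟨a, ha, ham, has, hap⟩ := hf
  obtain ⟨b, hb, hbm, hbs, hbp⟩ := hg
  have hba : PolyBdd fun n => b (a n) := by
    obtain ⟨c, hc⟩ := hb
    exact (((ha.add (.const 2)).pow c)).mono fun n => hc _
  refine PT.of_bound (g := fun n => a n + (b (a n) + moveCost γ * (b (a n) + 1)))
    (ha.add (hba.add ((PolyBdd.const _).mul (hba.add (.const _)))))
    (fun x => ((hbs _).trans (hbm (has x))).trans (by omega)) fun ℓ ℓ' h => ?_
  obtain ⟨p, hp⟩ := hap ℓ (ℓ' + width γ) (by omega)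
  obtain ⟨q, hq⟩ := hbp (ℓ' + width γ) (ℓ' + width γ + width β) (by omega)
  obtain ⟨r, hr⟩ := move (α := γ) (ℓ' + width γ + width β) ℓ'
    (ℓ' + width γ + width β + width γ) (by omega) (by omega) (by omega)
  refine ⟨.seq p (.seq q r), fun x s hx => (hp x s hx).seq fun s' h' =>
    ((hq _ _ h'.1).seq (T₂ := moveCost γ * (b (a (size x)) + 1)) fun s'' h'' =>
      (hr _ _ h''.1).mono ?_ fun s''' h''' => ?_).mono ?_ fun _ h => h⟩
  · have : size (g (f x)) ≤ b (a (size x)) := (hbs _).trans (hbm (has x))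
    gcongr
  · refine ⟨h'''.1, fun i hi => ?_⟩
    exact ((h'.2 i (by omega)).trans (h''.2 i (by omega))).trans (h'''.2 i (by omega) (by omega))
  · have : b (size (f x)) ≤ b (a (size x)) := hbm (has x)
    omega

@[fun_prop]
theorem PT.prodMk {f : α → β} {g : α → γ} (hf : PT f) (hg : PT g) : PT fun x => (f x, g x) := by
  obtain ⟨a, ha, ham, has, hap⟩ := hf
  obtain ⟨b, hb, hbm, hbs, hbp⟩ := hg
  refine PT.of_bound (g := fun n => a n + b n) (ha.add hb)
    (fun x => Nat.add_le_add (has x) (hbs x)) fun ℓ ℓ' h => ?_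
  obtain ⟨p, hp⟩ := hap ℓ ℓ' h
  obtain ⟨q, hq⟩ := hbp ℓ (ℓ' + width β) (by omega)
  refine ⟨.seq p q, fun x s hx => (hp x s hx).seq fun s' h' =>
    (hq x s' (holds_of_same (fun i h1 h2 => h'.2 i (by omega)) hx)).mono le_rfl fun s'' h'' => ?_⟩
  exact ⟨⟨holds_of_same (fun i h1 h2 => h''.2 i (by omega)) h'.1, h''.1⟩,
    fun i hi => (h'.2 i hi).trans (h''.2 i (by omega))⟩

@[fun_prop]
theorem PT.fst : PT fun x : α × β => x.1 := by
  refine PT.of_bound (g := fun n => moveCost α * (n + 1) + n)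
    (((PolyBdd.const _).mul (PolyBdd.id.add (.const _))).add .id)
    (fun x => by simp only [size_prod]; omega) fun ℓ ℓ' h => ?_
  simp only [width_prod] at h
  obtain ⟨p, hp⟩ := move (α := α) ℓ ℓ' (ℓ' + width α) (by omega) (by omega) (by omega)
  refine ⟨p, fun x s hx => (hp x.1 s hx.1).mono ?_ fun s' h => ⟨h.1, fun i hi =>
    h.2 i (by omega) (by omega)⟩⟩
  simp only [size_prod]; nlinarith [Nat.zero_le (moveCost α * size x.2)]

@[fun_prop]
theorem PT.snd : PT fun x : α × β => x.2 := by
  refine PT.of_bound (g := fun n => moveCost β * (n + 1) + n)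
    (((PolyBdd.const _).mul (PolyBdd.id.add (.const _))).add .id)
    (fun x => by simp only [size_prod]; omega) fun ℓ ℓ' h => ?_
  simp only [width_prod] at h
  obtain ⟨p, hp⟩ := move (α := β) (ℓ + width α) ℓ' (ℓ' + width β) (by omega) (by omega) (by omega)
  refine ⟨p, fun x s hx => (hp x.2 s hx.2).mono ?_ fun s' h => ⟨h.1, fun i hi =>
    h.2 i (by omega) (by omega)⟩⟩
  simp only [size_prod]; nlinarith [Nat.zero_le (moveCost β * size x.1)]

theorem PT.of_instr {f : ℕ → ℕ → ℕ} (c : ℕ → ℕ → ℕ → Instr)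
    (hc : ∀ i j l s, (c i j l).apply s = s.set i (f (s.reg j) (s.reg l)))
    (hf : ∀ a b, f a b ≤ a + b) : PT fun x : ℕ × ℕ => f x.1 x.2 := by
  refine PT.of_bound (g := fun n => n + 1) (PolyBdd.id.add (.const _))
    (fun x => (hf _ _).trans (Nat.le_succ _)) fun ℓ ℓ' h => ?_
  refine ⟨.instr (c ℓ' ℓ (ℓ + 1)), fun x s hx =>
    (Runs.instr ?_).mono (by omega) fun _ h => h⟩
  obtain ⟨h1, h2⟩ := hx
  replace h1 : s.reg ℓ = x.1 := h1
  replace h2 : s.reg (ℓ + 1) = x.2 := h2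
  rw [hc, h1, h2]
  refine ⟨by simp [Holds], fun i hi => ?_⟩
  have : i ≠ ℓ' := by omega
  simp [Same, this]

@[fun_prop]
theorem PT.add {f g : α → ℕ} (hf : PT f) (hg : PT g) : PT fun x => f x + g x :=
  PT.comp (PT.of_instr (f := (· + ·)) .add (fun _ _ _ _ => rfl) (fun _ _ => le_rfl)) (hf.prodMk hg)

@[fun_prop]
theorem PT.sub {f g : α → ℕ} (hf : PT f) (hg : PT g) : PT fun x => f x - g x :=
  PT.comp (PT.of_instr (f := (· - ·)) .sub (fun _ _ _ _ => rfl) (fun _ _ => by omega))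
    (hf.prodMk hg)

@[fun_prop]
theorem PT.div {f g : α → ℕ} (hf : PT f) (hg : PT g) : PT fun x => f x / g x :=
  PT.comp (PT.of_instr (f := (· / ·)) .div (fun _ _ _ _ => rfl)
    (fun a b => (Nat.div_le_self a b).trans (Nat.le_add_right _ _))) (hf.prodMk hg)

@[fun_prop]
theorem PT.mod {f g : α → ℕ} (hf : PT f) (hg : PT g) : PT fun x => f x % g x :=
  PT.comp (PT.of_instr (f := (· % ·)) .mod (fun _ _ _ _ => rfl)
    (fun a b => (Nat.mod_le a b).trans (Nat.le_add_right _ _))) (hf.prodMk hg)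

theorem PT.of_cond {c : α → ℕ} {f g h : α → β} (hc : PT c) (hf : PT f) (hg : PT g)
    (h₁ : ∀ x, c x ≠ 0 → h x = f x) (h₂ : ∀ x, c x = 0 → h x = g x) : PT h := by
  obtain ⟨d, hd, hdm, hds, hdp⟩ := hc
  obtain ⟨a, ha, ham, has, hap⟩ := hf
  obtain ⟨b, hb, hbm, hbs, hbp⟩ := hg
  refine PT.of_bound (g := fun n => d n + (a n + b n + 1)) (hd.add ((ha.add hb).add (.const _)))
    (fun x => ?_) fun ℓ ℓ' h => ?_
  · have := has x; have := hbs x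
    by_cases hx : c x = 0
    · rw [h₂ x hx]; omega
    · rw [h₁ x hx]; omega
  · obtain ⟨p, hp⟩ := hdp ℓ ℓ' h
    obtain ⟨q, hq⟩ := hap ℓ ℓ' h
    obtain ⟨r, hr⟩ := hbp ℓ ℓ' h
    refine ⟨.seq p (.ite ℓ' q r), fun x s hx => (hp x s hx).seq fun s' h' => Runs.ite ?_ ?_⟩
    all_goals
      intro hi
      have hx' := holds_of_same (fun i h1 h2 => h'.2 i (by omega)) hx
      have e : s'.reg ℓ' = c x := h'.1
      rw [e] at hi
    · rw [h₁ x hi]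
      exact (hq x s' hx').mono (by omega) fun s'' h'' =>
        ⟨h''.1, fun i hi => (h'.2 i hi).trans (h''.2 i hi)⟩
    · rw [h₂ x hi]
      exact (hr x s' hx').mono (by omega) fun s'' h'' =>
        ⟨h''.1, fun i hi => (h'.2 i hi).trans (h''.2 i hi)⟩

@[fun_prop]
theorem PT.length {f : α → List ℕ} (hf : PT f) : PT fun x => (f x).length := by
  refine PT.comp (g := fun l : List ℕ => l.length) ?_ hf
  refine PT.of_bound (g := fun n => n + 1) (PolyBdd.id.add (.const _))
    (fun x => by simp; omega) fun ℓ ℓ' h => ?_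
  refine ⟨.instr (.copy ℓ' ℓ), fun x s hx => (Runs.instr ?_).mono (by omega) fun _ h => h⟩
  refine ⟨by simp [Instr.apply, Holds, hx.1], fun i hi => ?_⟩
  have : i ≠ ℓ' := by omega
  simp [Same, Instr.apply, this]

theorem getD_le_sum (l : List ℕ) (i : ℕ) : l.getD i 0 ≤ l.sum := by
  rcases Nat.lt_or_ge i l.length with h | h
  · rw [List.getD_eq_getElem _ _ h]
    exact List.le_sum_of_mem (List.getElem_mem h)
  · rw [List.getD_eq_default _ _ h]; exact Nat.zero_le _

@[fun_prop]
theorem PT.getD {f : α → List ℕ} {g : α → ℕ} (hf : PT f) (hg : PT g) :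
    PT fun x => (f x).getD (g x) 0 := by
  refine PT.comp (g := fun y : List ℕ × ℕ => y.1.getD y.2 0) ?_ (hf.prodMk hg)
  refine PT.of_bound (g := fun n => n + 3) (PolyBdd.id.add (.const _))
    (fun x => ?_) fun ℓ ℓ' h => ?_
  · have := getD_le_sum x.1 x.2
    simp only [size_prod, size_list, size_nat]; omega
  · simp only [width_prod, width_list, width_nat] at h
    -- The truncated difference of length and index decides whether the index is in range; beyond
    -- the list the bank may hold garbage, so the default `0` has to be written explicitly.
    refine ⟨.seq (.instr (.sub ℓ' ℓ (ℓ + 1))) (.ite ℓ' (.instr (.load ℓ' ℓ (ℓ + 1)))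
      (.instr (.const ℓ' 0))), fun x s hx => (Runs.instr_seq (Runs.ite (T := 1) ?_ ?_)).mono
        (by omega) fun _ h => h⟩
    all_goals
      obtain ⟨⟨h1, h2⟩, h3⟩ := hx
      replace h3 : s.reg (ℓ + 1) = x.2 := h3
      intro hi
      simp only [Instr.apply, State.set_reg, if_true, h1, h3] at hi
      refine Runs.instr ⟨?_, fun i hi => ?_⟩
    · have n2 : ℓ + 1 ≠ ℓ' := by omega
      simp only [Holds, Instr.apply, State.set_reg, State.set_mem, if_true, if_neg n2, h3]
      exact h2 _ (by omega)
    · have n2 : i ≠ ℓ' := by omega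
      simp [Same, Instr.apply, n2]
    · simp only [Holds, Instr.apply, State.set_reg, if_true]
      rw [List.getD_eq_default _ _ (by omega)]
    · have n2 : i ≠ ℓ' := by omega
      simp [Same, Instr.apply, n2]

theorem PT.snoc {f : α → List ℕ} {g : α → ℕ} (hf : PT f) (hg : PT g) :
    PT fun x => f x ++ [g x] := by
  refine PT.comp (g := fun y : List ℕ × ℕ => y.1 ++ [y.2]) ?_ (hf.prodMk hg)
  refine PT.of_bound (g := fun n => n * 4 + 4 + 3)
    (((PolyBdd.id.mul (.const _)).add (.const _)).add (.const _)) (fun x => ?_) fun ℓ ℓ' h => ?_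
  · simp; omega
  · simp only [width_prod, width_list, width_nat] at h
    refine ⟨.seq (copyList ℓ ℓ' (ℓ' + 1)) (.seq (.instr (.store ℓ' ℓ (ℓ + 1)))
      (.seq (.instr (.const (ℓ' + 1) 1)) (.instr (.add ℓ' ℓ (ℓ' + 1))))), fun x s hx => ?_⟩
    obtain ⟨⟨h1, h2⟩, h3⟩ := hx
    replace h3 : s.reg (ℓ + 1) = x.2 := h3
    refine ((runs_copyList (by omega) (by omega) s).mono (T' := size x * 4 + 4) ?_
      fun _ h => h).seq fun s' h' => ?_
    · rw [h1]; simp only [size_prod, size_list]; omega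
    · obtain ⟨e1, e2, e3⟩ := h'
      refine (Runs.instr_seq (Runs.instr_seq (Runs.instr ?_))).mono (T := 3) le_rfl fun _ h => h
      have n1 : ℓ ≠ ℓ' + 1 := by omega
      have f1 := (e3 ℓ (by omega) (by omega)).1
      have f2 := (e3 (ℓ + 1) (by omega) (by omega)).1
      refine ⟨⟨by simp [Instr.apply, n1, f1, h1], fun i hi => ?_⟩, fun i hi => ?_⟩
      · rcases Nat.lt_or_ge i x.1.length with hi' | hi'
        · have n3 : i ≠ x.1.length := by omega
          rw [List.getD_append _ _ _ _ hi', ← h2 i hi', ← e2 i (by omega)]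
          simp [Instr.apply, f1, h1, n3]
        · have : i = x.1.length := by simp at hi; omega
          simp [Instr.apply, f1, f2, h1, h3, this]
      · have n2 : i ≠ ℓ' := by omega
        have n3 : i ≠ ℓ' + 1 := by omega
        simpa [Same, Instr.apply, n2, n3] using e3 i (by omega) n2

/-- The bound on the iterates is a genuine hypothesis: repeated doubling is an iteration of a
polynomial time step with exponential growth. -/
theorem PT.iterate {n : α → ℕ} {init : α → β} {step : α × β → β} {b : ℕ → ℕ} (hn : PT n)
    (hi : PT init) (hs : PT step) (hb : PolyBdd b)
    (hbd : ∀ x, ∀ i ≤ n x, size ((fun y => step (x, y))^[i] (init x)) ≤ b (size x)) :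
    PT fun x => (fun y => step (x, y))^[n x] (init x) := by
  obtain ⟨N, hN, hNm, hNs, hNp⟩ := hn
  obtain ⟨I, hI, hIm, hIs, hIp⟩ := hi
  obtain ⟨S, hS, hSm, hSs, hSp⟩ := hs
  have hSb : PolyBdd fun n => S (n + b n) := by
    obtain ⟨c, hc⟩ := hS
    exact (((PolyBdd.id.add hb).add (.const 2)).pow c).mono fun n => hc _
  let T : ℕ → ℕ := fun n => 1 + (S (n + b n) + moveCost β * (b n + 1))
  have hT : PolyBdd T := (PolyBdd.const 1).add
    (hSb.add ((PolyBdd.const _).mul (hb.add (.const _))))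
  refine PT.of_bound (g := fun n => N n + (1 + (moveCost α * (n + 1) + (I n +
    ((N n * (T n + 1) + 1) + moveCost β * (b n + 1))))) + b n) ?_ (fun x => ?_) fun ℓ ℓ' h => ?_
  · exact (hN.add ((PolyBdd.const 1).add (((PolyBdd.const _).mul (PolyBdd.id.add (.const 1))).add
      (hI.add (((hN.mul (hT.add (.const 1))).add (.const 1)).add
        ((PolyBdd.const _).mul (hb.add (.const 1)))))))).add hb
  · exact (hbd x _ le_rfl).trans (Nat.le_add_left _ _)
  -- Memory layout above the result: the counter at `c`, the constant one at `c + 1`, a copy of the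
  -- argument at `A`, directly followed by the current value at `B` so that the two form a pair, and
  -- the output of the step at `O`.
  · set c := ℓ' + width β with hc
    set A := c + 2 with hA
    set B := A + width α with hB
    set O := B + width β with hO
    obtain ⟨pn, hpn⟩ := hNp ℓ c (by omega)
    obtain ⟨px, hpx⟩ := move (α := α) ℓ A B (by omega) (by omega) (by omega)
    obtain ⟨pi, hpi⟩ := hIp ℓ B (by omega)
    obtain ⟨ps, hps⟩ := hSp A O (by simp only [width_prod]; omega)
    obtain ⟨pm, hpm⟩ := move (α := β) O B (O + width β) (by omega) (by omega) (by omega)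
    obtain ⟨pf, hpf⟩ := move (α := β) B ℓ' O (by omega) (by omega) (by omega)
    refine ⟨.seq pn (.seq (.instr (.const (c + 1) 1)) (.seq px (.seq pi (.seq
      (.while c (.seq (.instr (.sub c c (c + 1))) (.seq ps pm))) pf)))), fun x s hx => ?_⟩
    refine Runs.mono (Q := fun s' => Holds ((fun y => step (x, y))^[n x] (init x)) ℓ' s' ∧
      ∀ i < ℓ', Same s s' i) ?_ (Nat.le_add_right _ _) fun _ h => h
    refine (hpn x s hx).seq fun s₁ h₁ => Runs.instr_seq ?_
    set s₂ := (Instr.const (c + 1) 1).apply s₁ with hs₂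
    have g₂ : ∀ i < c, Same s s₂ i := fun i hi => by
      have := h₁.2 i hi
      have n1 : i ≠ c + 1 := by omega
      simpa [hs₂, Same, Instr.apply, n1] using this
    have hc₂ : s₂.reg c = n x := by
      have : s₁.reg c = n x := h₁.1
      simpa [hs₂, Instr.apply] using this
    have ho₂ : s₂.reg (c + 1) = 1 := by simp [hs₂, Instr.apply]
    refine (hpx x s₂ (holds_of_same (fun i h1 h2 => g₂ i (by omega)) hx)).seq fun s₃ h₃ => ?_
    have g₃ : ∀ i < A, Same s₂ s₃ i := fun i hi => h₃.2 i (by omega) (by omega)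
    refine (hpi x s₃ (holds_of_same (fun i h1 h2 =>
      (g₂ i (by omega)).trans (g₃ i (by omega))) hx)).seq fun s₄ h₄ => ?_
    have g₄ : ∀ i < B, Same s₃ s₄ i := h₄.2
    let Inv : ℕ → State → Prop := fun r s' => s'.reg c = r ∧ s'.reg (c + 1) = 1 ∧
      (∀ i < ℓ', Same s s' i) ∧ Holds x A s' ∧
      r ≤ n x ∧ Holds ((fun y => step (x, y))^[n x - r] (init x)) B s'
    refine Runs.seq (Q := Inv 0) (T₁ := N (size x) * (T (size x) + 1) + 1) ?_ ?_
    · have hnN : n x ≤ N (size x) := hNs x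
      refine (Runs.countdown (n := n x) (T := T (size x)) (I := Inv) (fun _ _ h => h.1) ?_ (n x)
        le_rfl s₄ ?_).mono (by gcongr) fun _ h => h
      · rintro r s' hr ⟨i1, i2, i3, i4, i5, i6⟩
        refine Runs.instr_seq ?_
        set t₁ := (Instr.sub c c (c + 1)).apply s' with ht₁
        have k₁ : ∀ i, i ≠ c → Same s' t₁ i := fun i hi => by
          simp [ht₁, Same, Instr.apply, hi]
        have hsz := hbd x (n x - (r + 1)) (by omega)
        set y := (fun y => step (x, y))^[n x - (r + 1)] (init x) with hy
        have hx₁ : Holds (x, y) A t₁ := ⟨holds_of_same (fun i h1 h2 => k₁ i (by omega)) i4,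
          holds_of_same (fun i h1 h2 => k₁ i (by omega)) i6⟩
        have hy' : step (x, y) = (fun y => step (x, y))^[n x - r] (init x) := by
          rw [hy, show n x - r = (n x - (r + 1)) + 1 by omega, Function.iterate_succ_apply']
        refine ((hps _ _ hx₁).mono (T' := S (size x + b (size x)))
          (hSm (by simpa using hsz)) fun _ h => h).seq fun t₂ k₂ => ?_
        have hsz' := hbd x (n x - r) (by omega)
        rw [← hy'] at hsz'
        refine (hpm _ _ k₂.1).mono (by gcongr) fun t₃ k₃ => ?_
        have k : ∀ i < B, i ≠ c → Same s' t₃ i := fun i h1 h2 =>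
          ((k₁ i h2).trans (k₂.2 i (by omega))).trans (k₃.2 i (by omega) (by omega))
        refine ⟨?_, ?_, fun i hi => (i3 i hi).trans (k i (by omega) (by omega)),
          holds_of_same (fun i h1 h2 => k i (by omega) (by omega)) i4, by omega, ?_⟩
        · rw [(k₃.2 c (by omega) (by omega)).1, (k₂.2 c (by omega)).1, ht₁]
          simp [Instr.apply, i1, i2]
        · rw [(k (c + 1) (by omega) (by omega)).1, i2]
        · rw [← hy']; exact k₃.1
      · refine ⟨?_, ?_, fun i hi => ?_, holds_of_same (fun i h1 h2 => g₄ i (by omega)) h₃.1,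
          le_rfl, ?_⟩
        · rw [(g₄ c (by omega)).1, (g₃ c (by omega)).1, hc₂]
        · rw [(g₄ (c + 1) (by omega)).1, (g₃ (c + 1) (by omega)).1, ho₂]
        · exact ((g₂ i (by omega)).trans (g₃ i (by omega))).trans (g₄ i (by omega))
        · simpa using h₄.1
    · rintro s₅ ⟨-, -, h3, -, -, h6⟩
      have hsz := hbd x _ le_rfl
      refine (hpf _ _ h6).mono (by simpa using Nat.mul_le_mul_left _ (by omega)) fun s₆ h₆ => ?_
      exact ⟨by simpa using h₆.1, fun i hi => (h3 i hi).trans (h₆.2 i (by omega) (by omega))⟩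

end Primitives

/-- A polynomial time function on lists is computed by a program within polynomial time. -/
theorem PT.exists_prog {f : List ℕ → List ℕ} (hf : PT f) :
    ∃ (p : Prog) (c : ℕ), ∀ x, p.OutputsWithin x (f x) ((size x + 2 : ℕ) ^ c : ℕ) := by
  obtain ⟨g, hg, -, hgs, hgp⟩ := hf
  obtain ⟨p, hp⟩ := hgp 0 1 (by simp)
  have hT : PolyBdd fun n => g n + (g n * 4 + 4) := hg.add ((hg.mul (.const 4)).add (.const 4))
  obtain ⟨c, hc⟩ := hT
  refine ⟨.seq p (copyList 1 0 2), c, fun x => ?_⟩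
  have h0 : Holds x 0 (State.init x) := ⟨by simp [State.init], fun i hi => by simp [State.init]⟩
  have : Runs (.seq p (copyList 1 0 2)) (State.init x) (g (size x) + (g (size x) * 4 + 4))
      fun s' => s'.output = f x := by
    refine (hp x _ h0).seq fun s' h' => ?_
    have hl : s'.reg 1 = (f x).length := h'.1.1
    refine (runs_copyList (by omega) (by omega) s').mono ?_ fun s'' h'' => ?_
    · have := hgs x
      simp only [size_list] at this ⊢
      omega
    · refine List.ext_getElem (by simp [State.output, h''.1, hl]) fun i h1 h2 => ?_
      have := h''.2.1 i (by omega)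
      have h3 := h'.1.2 i h2
      rw [List.getD_eq_getElem _ _ h2] at h3
      simp [State.output, this, h3]
  obtain ⟨t, s', h1, h2, h3⟩ := this
  exact ⟨t, s', h1, by exact_mod_cast h2.trans (hc _), h3⟩

end RAM

namespace RAM

open Data

/-! ### Loops, arithmetic, tables, search and sums in polynomial time -/

section Library

variable {α β : Type} [Data α] [Data β]

/-- `n`-fold iteration of a step that depends on a counter. -/
def loop {β : Type} (n : ℕ) (init : β) (step : ℕ → β → β) : β :=
  Nat.rec init step n

@[simp] theorem loop_zero {β : Type} (init : β) (step : ℕ → β → β) : loop 0 init step = init := rfl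

@[simp] theorem loop_succ {β : Type} (n : ℕ) (init : β) (step : ℕ → β → β) :
    loop (n + 1) init step = step n (loop n init step) := rfl

theorem PT.bound {f : α → β} (hf : PT f) : ∃ g, PolyBdd g ∧ Monotone g ∧
    ∀ x, size (f x) ≤ g (size x) := by
  obtain ⟨g, hg, hm, hs, -⟩ := hf
  exact ⟨g, hg, hm, hs⟩

theorem PolyBdd.comp {f g : ℕ → ℕ} (hg : PolyBdd g) (hf : PolyBdd f) :
    PolyBdd fun n => g (f n) := by
  obtain ⟨c, hc⟩ := hg
  exact ((hf.add (.const 2)).pow c).mono fun n => hc _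

theorem PT.loop_of_polyBdd {n : α → ℕ} {init : α → β} {step : α → ℕ → β → β} {b : ℕ → ℕ}
    (hn : PT n) (hi : PT init) (hs : PT fun y : α × ℕ × β => step y.1 y.2.1 y.2.2)
    (hb : PolyBdd b) (hbd : ∀ x, ∀ i ≤ n x, size (RAM.loop i (init x) (step x)) ≤ b (size x)) :
    PT fun x => RAM.loop (n x) (init x) (step x) := by
  obtain ⟨N, hN, -, hN'⟩ := hn.bound
  have key : ∀ x i, (fun y : ℕ × β => (y.1 + 1, step x y.1 y.2))^[i] (0, init x) =
      (i, RAM.loop i (init x) (step x)) := by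
    intro x i
    induction i with
    | zero => rfl
    | succ i ih => rw [Function.iterate_succ_apply', ih]; rfl
  have := PT.iterate (β := ℕ × β) (n := n) (init := fun x => (0, init x))
    (step := fun y : α × ℕ × β => (y.2.1 + 1, step y.1 y.2.1 y.2.2))
    (b := fun n => N n + b n) hn ((PT.const 0).prodMk hi)
    ((PT.add (PT.comp PT.fst PT.snd) (.const 1)).prodMk hs) (hN.add hb) fun x i hix => by
      have h1 := hN' x
      have h2 := hbd x i hix
      simp only [key, size_prod, size_nat] at *
      omega
  simpa only [key] using PT.comp PT.snd this

/-- Here the bound on the result of a step does not depend on the state, so no growth can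
accumulate. The field sums and powers, the linear algebra and the root search of the decoder all
have this form. -/
theorem PT.loop_of_bound {n : α → ℕ} {init : α → β} {step : α → ℕ → β → β} {b : α → ℕ} (hn : PT n)
    (hi : PT init) (hs : PT fun y : α × ℕ × β => step y.1 y.2.1 y.2.2) (hb : PT b)
    (hbd : ∀ x i s, size (step x i s) ≤ b x) : PT fun x => RAM.loop (n x) (init x) (step x) := by
  obtain ⟨B, hB, -, hB'⟩ := hb.bound
  obtain ⟨I, hI, -, hI'⟩ := hi.bound
  refine PT.loop_of_polyBdd hn hi hs (hB.add hI) fun x i _ => ?_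
  cases i with
  | zero => exact (hI' x).trans (Nat.le_add_left _ _)
  | succ i => exact ((hbd x _ _).trans (hB' x)).trans (Nat.le_add_right _ _)

/-- The case distinction whether a number is nonzero. -/
def sel {β : Type} (c : ℕ) (a b : β) : β := if c = 0 then b else a

@[fun_prop]
theorem PT.sel {c : α → ℕ} {f g : α → β} (hc : PT c) (hf : PT f) (hg : PT g) :
    PT fun x => sel (c x) (f x) (g x) :=
  PT.of_cond hc hf hg (fun _ h => if_neg h) (fun _ h => if_pos h)

/-- `1` or `0`, according to whether `a = b`. -/
def eqn (a b : ℕ) : ℕ := if a = b then 1 else 0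

/-- `1` or `0`, according to whether `a < b`. -/
def ltn (a b : ℕ) : ℕ := if a < b then 1 else 0

@[simp] theorem sel_zero {β : Type} (a b : β) : RAM.sel 0 a b = b := rfl
theorem sel_eqn {β : Type} (a b : ℕ) (u v : β) : RAM.sel (eqn a b) u v = if a = b then u else v := by
  unfold eqn RAM.sel; split_ifs <;> simp_all
theorem sel_ltn {β : Type} (a b : ℕ) (x y : β) : RAM.sel (ltn a b) x y = if a < b then x else y := by
  unfold ltn RAM.sel; split_ifs <;> simp_all

@[fun_prop]
theorem PT.eqn {f g : α → ℕ} (hf : PT f) (hg : PT g) : PT fun x => eqn (f x) (g x) := by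
  have : PT fun x => RAM.sel ((f x - g x) + (g x - f x)) 0 1 := by fun_prop
  convert this using 2 with x
  unfold RAM.eqn RAM.sel
  split_ifs <;> omega

@[fun_prop]
theorem PT.ltn {f g : α → ℕ} (hf : PT f) (hg : PT g) : PT fun x => ltn (f x) (g x) := by
  have : PT fun x => RAM.sel (g x - f x) 1 0 := by fun_prop
  convert this using 2 with x
  unfold RAM.ltn RAM.sel
  split_ifs <;> omega

-- Multiplication is iterated addition; the number of rounds is polynomial because sizes are unary.
@[fun_prop]
theorem PT.mul {f g : α → ℕ} (hf : PT f) (hg : PT g) : PT fun x => f x * g x := by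
  obtain ⟨F, hF, -, hF'⟩ := hf.bound
  obtain ⟨G, hG, -, hG'⟩ := hg.bound
  have h := PT.iterate (α := α) (β := ℕ) (n := f) (init := fun _ => 0)
    (step := fun y : α × ℕ => y.2 + g y.1) (b := fun n => F n * G n) hf (by fun_prop)
    (by fun_prop) (hF.mul hG)
  have key : ∀ (x : α) i, (fun s => s + g x)^[i] 0 = i * g x := by
    intro x i
    induction i with
    | zero => simp
    | succ i ih => rw [Function.iterate_succ_apply', ih, Nat.succ_mul]
  simp only [key] at h
  exact h fun x i hi => Nat.mul_le_mul (hi.trans (hF' x)) (hG' x)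

/-- The list `f 0, …, f (n - 1)`. -/
def tab (n : ℕ) (f : ℕ → ℕ) : List ℕ := (List.range n).map f

@[simp] theorem length_tab (n : ℕ) (f : ℕ → ℕ) : (tab n f).length = n := by simp [tab]

theorem getD_tab (n : ℕ) (f : ℕ → ℕ) (i : ℕ) :
    (tab n f).getD i 0 = if i < n then f i else 0 := by
  split_ifs with h
  · rw [List.getD_eq_getElem _ _ (by simpa)]; simp [tab]
  · rw [List.getD_eq_default _ _ (by simpa using h)]

theorem tab_getD (l : List ℕ) : tab l.length (fun i => l.getD i 0) = l :=
  List.ext_getElem (by simp) fun i h1 h2 => by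
    rw [← List.getD_eq_getElem _ 0, ← List.getD_eq_getElem _ 0, getD_tab, if_pos h2]

theorem tab_succ (n : ℕ) (f : ℕ → ℕ) : tab (n + 1) f = tab n f ++ [f n] := by
  simp [tab, List.range_succ]

theorem tab_congr {n : ℕ} {f g : ℕ → ℕ} (h : ∀ i < n, f i = g i) : tab n f = tab n g :=
  List.map_congr_left fun i hi => h i (List.mem_range.1 hi)

theorem sum_map_range_le {n b : ℕ} {f : ℕ → ℕ} (h : ∀ i < n, f i ≤ b) :
    ((List.range n).map f).sum ≤ n * b := by
  have := List.sum_le_card_nsmul ((List.range n).map f) b (by simpa using h)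
  simpa using this

/-- A bound for the values of a family of functions computed in polynomial time. -/
theorem PT.exists_bound {n : α → ℕ} {f : α → ℕ → β} (hn : PT n)
    (hf : PT fun y : α × ℕ => f y.1 y.2) :
    ∃ B, PolyBdd B ∧ ∀ x, n x ≤ B (size x) ∧ ∀ i ≤ n x, size (f x i) ≤ B (size x) := by
  obtain ⟨N, hN, hNm, hN'⟩ := hn.bound
  obtain ⟨F, hF, hFm, hF'⟩ := hf.bound
  refine ⟨fun s => N s + F (s + N s), hN.add (hF.comp (PolyBdd.id.add hN)), fun x => ?_⟩
  have h0 : n x ≤ N (size x) := hN' x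
  refine ⟨by dsimp only; omega, fun i hi => ((hF' (x, i)).trans (hFm ?_)).trans (Nat.le_add_left _ _)⟩
  simp; omega

@[fun_prop]
theorem PT.tab {n : α → ℕ} {f : α → ℕ → ℕ} (hn : PT n) (hf : PT fun y : α × ℕ => f y.1 y.2) :
    PT fun x => tab (n x) (f x) := by
  obtain ⟨B, hB, hB'⟩ := PT.exists_bound hn hf
  have key : ∀ (x : α) i, RAM.loop i [] (fun i l => l ++ [f x i]) = RAM.tab i (f x) := by
    intro x i
    induction i with
    | zero => rfl
    | succ i ih => rw [loop_succ, ih, tab_succ]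
  simp only [← key]
  refine PT.loop_of_polyBdd (b := fun s => B s + B s * B s) hn (.const []) ?_
    (hB.add (hB.mul hB)) fun x i hi => ?_
  · exact PT.snoc (by fun_prop) (PT.comp hf (by fun_prop : PT fun y : α × ℕ × List ℕ => (y.1, y.2.1)))
  · rw [key, size_list, length_tab]
    obtain ⟨h1, h2⟩ := hB' x
    refine Nat.add_le_add (hi.trans h1) ((sum_map_range_le fun j hj => h2 j ?_).trans
      (Nat.mul_le_mul_right _ (hi.trans h1)))
    omega

@[fun_prop]
theorem PT.append {f g : α → List ℕ} (hf : PT f) (hg : PT g) : PT fun x => f x ++ g x := by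
  have : PT fun x => RAM.tab ((f x).length + (g x).length) (fun i =>
      RAM.sel (RAM.ltn i (f x).length) ((f x).getD i 0) ((g x).getD (i - (f x).length) 0)) := by
    fun_prop
  convert this using 2 with x
  refine List.ext_getElem (by simp) fun i h1 h2 => ?_
  rw [← List.getD_eq_getElem _ 0 h1, ← List.getD_eq_getElem _ 0 h2, getD_tab,
    if_pos (by simpa using h1), sel_ltn]
  split_ifs with h
  · rw [List.getD_append _ _ _ _ h]
  · rw [List.getD_append_right _ _ _ _ (by omega)]

@[fun_prop]
theorem PT.flatMap {n : α → ℕ} {f : α → ℕ → List ℕ} (hn : PT n)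
    (hf : PT fun y : α × ℕ => f y.1 y.2) : PT fun x => (List.range (n x)).flatMap (f x) := by
  obtain ⟨B, hB, hB'⟩ := PT.exists_bound hn hf
  have key : ∀ (x : α) i, RAM.loop i [] (fun i l => l ++ f x i) = (List.range i).flatMap (f x) := by
    intro x i
    induction i with
    | zero => rfl
    | succ i ih => rw [loop_succ, ih, List.range_succ]; simp
  have hsz : ∀ (x : α) i, i ≤ n x → size ((List.range i).flatMap (f x)) ≤ i * B (size x) := by
    intro x i
    induction i with
    | zero => simp
    | succ i ih =>
      intro hi
      have h1 := ih (by omega)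
      have h2 := (hB' x).2 i (by omega)
      rw [Nat.succ_mul, List.range_succ]
      simp only [size_list, List.flatMap_append, List.flatMap_singleton, List.length_append,
        List.sum_append] at *
      omega
  simp only [← key] at hsz ⊢
  refine PT.loop_of_polyBdd (b := fun s => B s * B s) hn (.const []) ?_ (hB.mul hB)
    fun x i hi => (hsz x i hi).trans (Nat.mul_le_mul_right _ (hi.trans (hB' x).1))
  exact PT.append (by fun_prop) (PT.comp hf (by fun_prop : PT fun y : α × ℕ × List ℕ => (y.1, y.2.1)))

/-- The least `i < n` with `f i ≠ 0`, or `n` if there is none. -/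
def find (n : ℕ) (f : ℕ → ℕ) : ℕ := loop n 0 fun _ r => sel (f r) r (r + 1)

theorem find_spec (n : ℕ) (f : ℕ → ℕ) :
    find n f ≤ n ∧ (∀ j < find n f, f j = 0) ∧ (find n f < n → f (find n f) ≠ 0) := by
  unfold find
  induction n with
  | zero => simp
  | succ n ih =>
    rw [loop_succ]
    set r := loop n 0 fun _ r => sel (f r) r (r + 1)
    obtain ⟨h1, h2, h3⟩ := ih
    unfold sel
    split_ifs with h
    · refine ⟨by omega, fun j hj => ?_, fun hr => absurd h (h3 (by omega))⟩
      rcases Nat.lt_succ_iff_lt_or_eq.1 hj with hj | rfl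
      exacts [h2 j hj, h]
    · exact ⟨by omega, h2, fun _ => h⟩

theorem find_lt {n : ℕ} {f : ℕ → ℕ} {i : ℕ} (hi : i < n) (h : f i ≠ 0) : find n f < n := by
  obtain ⟨-, h2, -⟩ := find_spec n f
  rcases Nat.lt_or_ge i (find n f) with hi' | hi'
  · exact absurd (h2 i hi') h
  · omega

theorem find_eq {n : ℕ} {f : ℕ → ℕ} {i : ℕ} (hi : i < n) (h : ∀ j < n, f j ≠ 0 ↔ j = i) :
    find n f = i := by
  have h1 := find_lt hi ((h i hi).2 rfl)
  exact (h _ h1).1 ((find_spec n f).2.2 h1)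

@[fun_prop]
theorem PT.find {n : α → ℕ} {f : α → ℕ → ℕ} (hn : PT n) (hf : PT fun y : α × ℕ => f y.1 y.2) :
    PT fun x => find (n x) (f x) := by
  obtain ⟨N, hN, -, hN'⟩ := hn.bound
  refine PT.loop_of_polyBdd hn (.const 0) ?_ hN fun x i hi =>
    ((find_spec i (f x)).1).trans (hi.trans (hN' x))
  exact PT.sel (PT.comp hf (by fun_prop : PT fun y : α × ℕ × ℕ => (y.1, y.2.2))) (by fun_prop)
    (by fun_prop)

/-- The sum `f 0 + … + f (n - 1)`. -/
def nsum (n : ℕ) (f : ℕ → ℕ) : ℕ := loop n 0 fun i s => s + f i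

theorem nsum_eq (n : ℕ) (f : ℕ → ℕ) : nsum n f = ∑ i ∈ Finset.range n, f i := by
  induction n with
  | zero => rfl
  | succ n ih => rw [Finset.sum_range_succ, ← ih]; rfl

@[fun_prop]
theorem PT.nsum {n : α → ℕ} {f : α → ℕ → ℕ} (hn : PT n) (hf : PT fun y : α × ℕ => f y.1 y.2) :
    PT fun x => nsum (n x) (f x) := by
  obtain ⟨B, hB, hB'⟩ := PT.exists_bound hn hf
  refine PT.loop_of_polyBdd (b := fun s => B s * B s) hn (.const 0) ?_ (hB.mul hB) fun x i hi => ?_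
  · exact PT.add (by fun_prop) (PT.comp hf (by fun_prop : PT fun y : α × ℕ × ℕ => (y.1, y.2.1)))
  · change RAM.nsum i (f x) ≤ _
    rw [nsum_eq]
    refine (Finset.sum_le_card_nsmul _ _ (B (size x)) fun j hj => (hB' x).2 j ?_).trans ?_
    · have := Finset.mem_range.1 hj; omega
    · simpa using Nat.mul_le_mul_right _ (hi.trans (hB' x).1)

@[fun_prop]
theorem PT.size {f : α → List ℕ} (hf : PT f) : PT fun x => size (f x) := by
  have : PT fun x => (f x).length + RAM.nsum (f x).length fun i => (f x).getD i 0 := by fun_prop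
  convert this using 2 with x
  rw [size_list, nsum_eq]
  conv_lhs => rw [← tab_getD (f x)]
  rw [length_tab]
  rfl

end Library

end RAM

namespace RAM

open Data

/-! ## The decoder, as a function on lists of numbers -/

namespace Decoder

variable {α : Type} [Data α] {X : α → List ℕ}

/-- The field size. -/
def q (x : List ℕ) : ℕ := x.getD 0 0
/-- The generator. -/
def g (x : List ℕ) : ℕ := x.getD 1 0
/-- The folding parameter. -/
def m (x : List ℕ) : ℕ := x.getD 2 0
/-- The degree bound. -/
def k (x : List ℕ) : ℕ := x.getD 3 0
/-- The number of errors. -/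
def e (x : List ℕ) : ℕ := x.getD 4 0
/-- The received word. -/
def rcv (x : List ℕ) (i : ℕ) : ℕ := x.getD (5 + 2 * (q x * q x) + i) 0
/-- Addition in the field. -/
def add (x : List ℕ) (a b : ℕ) : ℕ := x.getD (5 + (a * q x + b)) 0
/-- Multiplication in the field. -/
def mul (x : List ℕ) (a b : ℕ) : ℕ := x.getD (5 + q x * q x + (a * q x + b)) 0

@[fun_prop] theorem pt_q (hX : PT X) : PT fun y => q (X y) := by unfold q; fun_prop
@[fun_prop] theorem pt_g (hX : PT X) : PT fun y => g (X y) := by unfold g; fun_prop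
@[fun_prop] theorem pt_m (hX : PT X) : PT fun y => m (X y) := by unfold m; fun_prop
@[fun_prop] theorem pt_k (hX : PT X) : PT fun y => k (X y) := by unfold k; fun_prop
@[fun_prop] theorem pt_e (hX : PT X) : PT fun y => e (X y) := by unfold e; fun_prop
@[fun_prop] theorem pt_rcv {a : α → ℕ} (hX : PT X) (ha : PT a) : PT fun y => rcv (X y) (a y) := by
  unfold rcv; fun_prop
@[fun_prop] theorem pt_add {a b : α → ℕ} (hX : PT X) (ha : PT a) (hb : PT b) :
    PT fun y => add (X y) (a y) (b y) := by unfold add; fun_prop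
@[fun_prop] theorem pt_mul {a b : α → ℕ} (hX : PT X) (ha : PT a) (hb : PT b) :
    PT fun y => mul (X y) (a y) (b y) := by unfold mul; fun_prop

theorem getD_le_size (x : List ℕ) (i : ℕ) : x.getD i 0 ≤ size x :=
  (getD_le_sum x i).trans (Nat.le_add_left _ _)

/-- Field operations are lookups in the input, so their values are bounded by its size even if the
input contains no valid tables. This gives the a priori bounds for the loops on arbitrary inputs. -/
theorem add_le (x : List ℕ) (a b : ℕ) : add x a b ≤ size x := getD_le_size _ _

theorem mul_le (x : List ℕ) (a b : ℕ) : mul x a b ≤ size x := getD_le_size _ _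

theorem size_tab_le {n b : ℕ} {f : ℕ → ℕ} (h : ∀ i < n, f i ≤ b) : size (tab n f) ≤ n + n * b := by
  rw [size_list, length_tab]
  exact Nat.add_le_add_left (sum_map_range_le h) n

/-- The zero of the field. -/
def zero (x : List ℕ) : ℕ := find (q x) fun a => eqn (add x a a) a
/-- The one of the field. -/
def one (x : List ℕ) : ℕ := find (q x) fun a => eqn (mul x a (g x)) (g x)
/-- Negatives in the field. -/
def neg (x : List ℕ) (a : ℕ) : ℕ := find (q x) fun b => eqn (add x a b) (zero x)
/-- Inverses in the field. -/
def inv (x : List ℕ) (a : ℕ) : ℕ := find (q x) fun b => eqn (mul x a b) (one x)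
/-- Whether a field element is nonzero. -/
def ne (x : List ℕ) (a : ℕ) : ℕ := 1 - eqn a (zero x)
/-- Sums in the field. -/
def sum (x : List ℕ) (n : ℕ) (f : ℕ → ℕ) : ℕ := loop n (zero x) fun i s => add x s (f i)
/-- Powers in the field. -/
def pow (x : List ℕ) (a n : ℕ) : ℕ := loop n (one x) fun _ s => mul x s a

@[fun_prop] theorem pt_zero (hX : PT X) : PT fun y => zero (X y) := by unfold zero; fun_prop
@[fun_prop] theorem pt_one (hX : PT X) : PT fun y => one (X y) := by unfold one; fun_prop
@[fun_prop] theorem pt_neg {a : α → ℕ} (hX : PT X) (ha : PT a) : PT fun y => neg (X y) (a y) := by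
  unfold neg; fun_prop
@[fun_prop] theorem pt_inv {a : α → ℕ} (hX : PT X) (ha : PT a) : PT fun y => inv (X y) (a y) := by
  unfold inv; fun_prop
@[fun_prop] theorem pt_ne {a : α → ℕ} (hX : PT X) (ha : PT a) : PT fun y => ne (X y) (a y) := by
  unfold ne; fun_prop
@[fun_prop] theorem pt_sum {n : α → ℕ} {f : α → ℕ → ℕ} (hX : PT X) (hn : PT n)
    (hf : PT fun y : α × ℕ => f y.1 y.2) : PT fun y => sum (X y) (n y) (f y) :=
  PT.loop_of_bound (b := fun y => size (X y)) hn (by fun_prop)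
    (pt_add (by fun_prop) (by fun_prop)
      (PT.comp hf (by fun_prop : PT fun y : α × ℕ × ℕ => (y.1, y.2.1))))
    (by fun_prop) fun y _ _ => add_le _ _ _
@[fun_prop] theorem pt_pow {a n : α → ℕ} (hX : PT X) (ha : PT a) (hn : PT n) :
    PT fun y => pow (X y) (a y) (n y) :=
  PT.loop_of_bound (b := fun y => size (X y)) hn (by fun_prop) (by fun_prop) (by fun_prop)
    fun y _ _ => mul_le _ _ _

/-- The first `L` coefficients of `(X + a) ^ i`. -/
def binRow (x : List ℕ) (a L i : ℕ) : List ℕ :=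
  loop i (tab L fun j => sel (eqn j 0) (one x) (zero x)) fun _ r =>
    tab L fun j => add x (mul x a (r.getD j 0)) (sel (eqn j 0) (zero x) (r.getD (j - 1) 0))

@[fun_prop] theorem pt_binRow {a L i : α → ℕ} (hX : PT X) (ha : PT a) (hL : PT L) (hi : PT i) :
    PT fun y => binRow (X y) (a y) (L y) (i y) :=
  PT.loop_of_bound (b := fun y => L y + L y * size (X y)) hi (by fun_prop) (by fun_prop)
    (by fun_prop) fun y _ _ => size_tab_le fun _ _ => add_le _ _ _

/-- The coefficient of `X ^ j` in `(X + a) ^ i`. -/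
def bin (x : List ℕ) (a i j : ℕ) : ℕ := (binRow x a (j + 1) i).getD j 0

@[fun_prop] theorem pt_bin {a i j : α → ℕ} (hX : PT X) (ha : PT a) (hi : PT i) (hj : PT j) :
    PT fun y => bin (X y) (a y) (i y) (j y) := by unfold bin; fun_prop

/-- The diagonal `n × n` matrix with the ones at the nonzero entries of `w`. -/
def diag (x : List ℕ) (n : ℕ) (w : List ℕ) : List ℕ :=
  tab (n * n) fun t => sel (eqn (t / n) (t % n)) (sel (w.getD (t % n) 0) (one x) (zero x)) (zero x)

@[fun_prop] theorem pt_diag {n : α → ℕ} {w : α → List ℕ} (hX : PT X) (hn : PT n) (hw : PT w) :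
    PT fun y => diag (X y) (n y) (w y) := by unfold diag; fun_prop

/-- The value of the functional `r` at row `l` of the `n × n` matrix `V`. -/
def dot (x : List ℕ) (n : ℕ) (r V : List ℕ) (l : ℕ) : ℕ :=
  sum x n fun i => mul x (r.getD i 0) (V.getD (l * n + i) 0)

@[fun_prop] theorem pt_dot {n l : α → ℕ} {r V : α → List ℕ} (hX : PT X) (hn : PT n) (hr : PT r)
    (hV : PT V) (hl : PT l) : PT fun y => dot (X y) (n y) (r y) (V y) (l y) := by
  unfold dot; fun_prop

/-- The first row of `V` at which the functional `r` does not vanish. -/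
def pivot (x : List ℕ) (n : ℕ) (r V : List ℕ) : ℕ := find n fun l => ne x (dot x n r V l)

@[fun_prop] theorem pt_pivot {n : α → ℕ} {r V : α → List ℕ} (hX : PT X) (hn : PT n) (hr : PT r)
    (hV : PT V) : PT fun y => pivot (X y) (n y) (r y) (V y) := by unfold pivot; fun_prop

/-- From `n` vectors that span a space, make `n` vectors that span the kernel of the functional `r`
on it. -/
def cut (x : List ℕ) (n : ℕ) (r V : List ℕ) : List ℕ :=
  tab (n * n) fun t => sel (ltn (pivot x n r V) n)
    (add x (mul x (dot x n r V (pivot x n r V)) (V.getD t 0))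
      (neg x (mul x (dot x n r V (t / n)) (V.getD (pivot x n r V * n + t % n) 0))))
    -- Multiplying by one does not change a field element, but makes every entry a table lookup,
    -- hence bounded whatever `V` is (`size_cut_le`).
    (mul x (one x) (V.getD t 0))

@[fun_prop] theorem pt_cut {n : α → ℕ} {r V : α → List ℕ} (hX : PT X) (hn : PT n) (hr : PT r)
    (hV : PT V) : PT fun y => cut (X y) (n y) (r y) (V y) := by
  unfold cut; fun_prop

theorem size_cut_le (x : List ℕ) (n : ℕ) (r V : List ℕ) :
    size (cut x n r V) ≤ n * n + n * n * size x := by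
  refine size_tab_le fun i _ => ?_
  unfold sel
  split_ifs
  exacts [mul_le _ _ _, add_le _ _ _]

/-- The vectors in the span of the rows of `V` at which the functionals `row 0, …, row (R - 1)`
vanish. -/
def kern (x : List ℕ) (n : ℕ) (V : List ℕ) (R : ℕ) (row : ℕ → List ℕ) : List ℕ :=
  loop R V fun i V => cut x n (row i) V

@[fun_prop] theorem pt_kern {n R : α → ℕ} {V : α → List ℕ} {row : α → ℕ → List ℕ} (hX : PT X)
    (hn : PT n) (hV : PT V) (hR : PT R) (hrow : PT fun y : α × ℕ => row y.1 y.2) :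
    PT fun y => kern (X y) (n y) (V y) (R y) (row y) :=
  PT.loop_of_bound (b := fun y => n y * n y + n y * n y * size (X y)) hR hV
    (pt_cut (by fun_prop) (by fun_prop)
      (PT.comp hrow (by fun_prop : PT fun y : α × ℕ × List ℕ => (y.1, y.2.1))) (by fun_prop))
    (by fun_prop) fun _ _ _ => size_cut_le _ _ _ _

/-- The position of the first nonzero entry of the `n × n` matrix `V`. -/
def npos (x : List ℕ) (n : ℕ) (V : List ℕ) : ℕ := find (n * n) fun t => ne x (V.getD t 0)

@[fun_prop] theorem pt_npos {n : α → ℕ} {V : α → List ℕ} (hX : PT X) (hn : PT n) (hV : PT V) :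
    PT fun y => npos (X y) (n y) (V y) := by unfold npos; fun_prop

/-- The first nonzero row of the `n × n` matrix `V`. -/
def pick (x : List ℕ) (n : ℕ) (V : List ℕ) : List ℕ :=
  tab n fun i => V.getD (npos x n V / n * n + i) 0

@[fun_prop] theorem pt_pick {n : α → ℕ} {V : α → List ℕ} (hX : PT X) (hn : PT n) (hV : PT V) :
    PT fun y => pick (X y) (n y) (V y) := by unfold pick; fun_prop

/-- The block length. -/
def bl (x : List ℕ) : ℕ := (q x - 1) / m x
/-- The length of the unfolded code. -/
def len (x : List ℕ) : ℕ := bl x * m x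
/-- The strict degree bound for the interpolation polynomial. -/
def D (x : List ℕ) : ℕ := m x * (bl x - e x) * (m x - 1)
/-- The number of interpolation coefficients. -/
def U (x : List ℕ) : ℕ := D x * (q x * q x)

@[fun_prop] theorem pt_bl (hX : PT X) : PT fun y => bl (X y) := by unfold bl; fun_prop
@[fun_prop] theorem pt_len (hX : PT X) : PT fun y => len (X y) := by unfold len; fun_prop
@[fun_prop] theorem pt_D (hX : PT X) : PT fun y => D (X y) := by unfold D; fun_prop
@[fun_prop] theorem pt_U (hX : PT X) : PT fun y => U (X y) := by unfold U; fun_prop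

/-- The monomials of the interpolation polynomial. -/
def allowed (x : List ℕ) : List ℕ := tab (U x) fun t =>
  -- The index `t = a q² + b q + c` stands for the monomial X^a Y^b Z^c.
  ltn (t / (q x * q x) + k x * (t / q x % q x + t % q x)) (D x)

@[fun_prop] theorem pt_allowed (hX : PT X) : PT fun y => allowed (X y) := by
  unfold allowed; fun_prop

/-- The interpolation constraint number `i`. -/
def constraint (x : List ℕ) (i : ℕ) : List ℕ := tab (U x) fun t =>
  -- The index `i` has the digits P, i₁, i₂, i₃, the last three in base `m`. The row expresses that
  -- the coefficient of order (i₁, i₂, i₃) at (γ^P, z_P, z_(P+1)) vanishes. It is a zero row if P is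
  -- the last position of its block or if i₁ + i₂ + i₃ ≥ m.
  sel (ltn (i / (m x * m x * m x) % m x + 1) (m x) *
      ltn (i / (m x * m x) % m x + i / m x % m x + i % m x) (m x))
    (mul x (mul x
      (bin x (pow x (g x) (i / (m x * m x * m x))) (t / (q x * q x)) (i / (m x * m x) % m x))
      (bin x (rcv x (i / (m x * m x * m x))) (t / q x % q x) (i / m x % m x)))
      (bin x (rcv x (i / (m x * m x * m x) + 1)) (t % q x) (i % m x)))
    (zero x)

@[fun_prop] theorem pt_constraint {i : α → ℕ} (hX : PT X) (hi : PT i) :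
    PT fun y => constraint (X y) (i y) := by unfold constraint; fun_prop

/-- The interpolation polynomial. -/
def interp (x : List ℕ) : List ℕ :=
  pick x (U x) (kern x (U x) (diag x (U x) (allowed x)) (len x * (m x * m x * m x)) (constraint x))

@[fun_prop] theorem pt_interp (hX : PT X) : PT fun y => interp (X y) := by unfold interp; fun_prop

/-- The coefficient number `h` in the expansion of `Q(X, Y, Y ^ q)` in powers of
`X ^ (q - 1) - γ`. -/
def digit (x Q : List ℕ) (h : ℕ) : List ℕ := tab (q x * q x * (q x - 1)) fun t =>
  -- The index `t = J (q - 1) + i` stands for X^i Y^J. The exponents of X that are congruent to i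
  -- are i + (q - 1) j, and X^((q-1)j) is the power (E + γ)^j. The term Y^b Z^c contributes to J = b
  -- + q c, since Z becomes Y^q.
  sum x (D x) fun j => sel (ltn (t % (q x - 1) + (q x - 1) * j) (D x))
    (mul x (bin x (g x) j h) (Q.getD ((t % (q x - 1) + (q x - 1) * j) * (q x * q x) +
      (t / (q x - 1) % q x * q x + t / (q x - 1) / q x)) 0)) (zero x)

@[fun_prop] theorem pt_digit {Q : α → List ℕ} {h : α → ℕ} (hX : PT X) (hQ : PT Q) (hh : PT h) :
    PT fun y => digit (X y) (Q y) (h y) := by unfold digit; fun_prop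

/-- The first nonzero digit. -/
def poly (x Q : List ℕ) : List ℕ :=
  digit x Q (find (D x) fun h => ltn (find (q x * q x * (q x - 1)) fun t =>
    ne x ((digit x Q h).getD t 0)) (q x * q x * (q x - 1)))

@[fun_prop] theorem pt_poly {Q : α → List ℕ} (hX : PT X) (hQ : PT Q) :
    PT fun y => poly (X y) (Q y) := by unfold poly; fun_prop

/-- The degree of a polynomial over the extension field. -/
def deg (x T : List ℕ) : ℕ := q x * q x - 1 - find (q x * q x) fun u =>
  ltn (find (q x - 1) fun i => ne x (T.getD ((q x * q x - 1 - u) * (q x - 1) + i) 0)) (q x - 1)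

@[fun_prop] theorem pt_deg {T : α → List ℕ} (hX : PT X) (hT : PT T) :
    PT fun y => deg (X y) (T y) := by unfold deg; fun_prop

/-- The coefficient number `i` of the product of `X ^ j` and the element of the extension field
that is stored in `a` from `o` on. -/
def coef (x a : List ℕ) (o i j : ℕ) : ℕ :=
  mul x (a.getD (o + (i + (q x - 1) - j) % (q x - 1)) 0) (sel (ltn i j) (g x) (one x))

@[fun_prop] theorem pt_coef {a : α → List ℕ} {o i j : α → ℕ} (hX : PT X) (ha : PT a) (ho : PT o)
    (hi : PT i) (hj : PT j) : PT fun y => coef (X y) (a y) (o y) (i y) (j y) := by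
  unfold coef; fun_prop

/-- An element of the extension field whose product with the coefficient number `d` of `T` is a
nonzero element of the field. -/
def coinv (x T : List ℕ) (d : ℕ) : List ℕ :=
  pick x (q x - 1) (kern x (q x - 1) (diag x (q x - 1) (tab (q x - 1) fun _ => 1)) (q x - 2)
    fun i => tab (q x - 1) fun j => coef x T (d * (q x - 1)) (i + 1) j)

@[fun_prop] theorem pt_coinv {T : α → List ℕ} {d : α → ℕ} (hX : PT X) (hT : PT T) (hd : PT d) :
    PT fun y => coinv (X y) (T y) (d y) := by unfold coinv; fun_prop

/-- The coefficient number `i` of the product of `u` and the coefficient number `J` of `T`. -/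
def emul (x u T : List ℕ) (J i : ℕ) : ℕ :=
  sum x (q x - 1) fun j => mul x (u.getD j 0) (coef x T (J * (q x - 1)) i j)

@[fun_prop] theorem pt_emul {u T : α → List ℕ} {J i : α → ℕ} (hX : PT X) (hu : PT u) (hT : PT T)
    (hJ : PT J) (hi : PT i) : PT fun y => emul (X y) (u y) (T y) (J y) (i y) := by
  unfold emul; fun_prop

/-- The monic multiple of `T`, of degree `d`, without its leading coefficient. -/
def monic (x T : List ℕ) (d : ℕ) : List ℕ := tab (d * (q x - 1)) fun t =>
  mul x (inv x (emul x (coinv x T d) T d 0))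
    (emul x (coinv x T d) T (t / (q x - 1)) (t % (q x - 1)))

@[fun_prop] theorem pt_monic {T : α → List ℕ} {d : α → ℕ} (hX : PT X) (hT : PT T) (hd : PT d) :
    PT fun y => monic (X y) (T y) (d y) := by unfold monic; fun_prop

/-- The matrix of the multiplication by `Y` modulo the monic polynomial `T` of degree `d`. -/
def companion (x T : List ℕ) (d : ℕ) : List ℕ :=
  tab (d * (q x - 1) * (d * (q x - 1))) fun t =>
    add x (sel (eqn (t / (d * (q x - 1)) / (q x - 1)) (t % (d * (q x - 1)) / (q x - 1) + 1) *
        eqn (t / (d * (q x - 1)) % (q x - 1)) (t % (d * (q x - 1)) % (q x - 1))) (one x) (zero x))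
      (sel (eqn (t % (d * (q x - 1)) / (q x - 1) + 1) d)
        (neg x (coef x T (t / (d * (q x - 1)) / (q x - 1) * (q x - 1))
          (t / (d * (q x - 1)) % (q x - 1)) (t % (d * (q x - 1)) % (q x - 1)))) (zero x))

@[fun_prop] theorem pt_companion {T : α → List ℕ} {d : α → ℕ} (hX : PT X) (hT : PT T)
    (hd : PT d) : PT fun y => companion (X y) (T y) (d y) := by unfold companion; fun_prop

/-- The product of two `n × n` matrices. -/
def matmul (x : List ℕ) (n : ℕ) (A B : List ℕ) : List ℕ := tab (n * n) fun t =>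
  sum x n fun l => mul x (A.getD (t / n * n + l) 0) (B.getD (l * n + t % n) 0)

@[fun_prop] theorem pt_matmul {n : α → ℕ} {A B : α → List ℕ} (hX : PT X) (hn : PT n) (hA : PT A)
    (hB : PT B) : PT fun y => matmul (X y) (n y) (A y) (B y) := by unfold matmul; fun_prop

theorem find_le (n : ℕ) (f : ℕ → ℕ) : find n f ≤ n := (find_spec n f).1

theorem sum_le (x : List ℕ) (n : ℕ) (f : ℕ → ℕ) : sum x n f ≤ size x := by
  cases n with
  | zero => exact (find_le _ _).trans (getD_le_size _ _)
  | succ n => exact add_le _ _ _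

theorem size_matmul_le (x : List ℕ) (n : ℕ) (A B : List ℕ) :
    size (matmul x n A B) ≤ n * n + n * n * size x :=
  size_tab_le fun _ _ => sum_le _ _ _

/-- The powers of an `n × n` matrix. -/
def matpow (x : List ℕ) (n : ℕ) (A : List ℕ) (r : ℕ) : List ℕ :=
  loop r (diag x n (tab n fun _ => 1)) fun _ P => matmul x n P A

@[fun_prop] theorem pt_matpow {n r : α → ℕ} {A : α → List ℕ} (hX : PT X) (hn : PT n) (hA : PT A)
    (hr : PT r) : PT fun y => matpow (X y) (n y) (A y) (r y) :=
  PT.loop_of_bound (b := fun y => n y * n y + n y * n y * size (X y)) hr (by fun_prop)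
    (by fun_prop) (by fun_prop) fun _ _ _ => size_matmul_le _ _ _ _

theorem size_matpow_le (x : List ℕ) (n : ℕ) (A : List ℕ) (r : ℕ) :
    size (matpow x n A r) ≤ n * n + n * n * size x := by
  cases r with
  | succ r => exact size_matmul_le _ _ _ _
  | zero =>
    refine size_tab_le fun i _ => ?_
    have h1 : zero x ≤ size x := (find_le _ _).trans (getD_le_size _ _)
    have h2 : one x ≤ size x := (find_le _ _).trans (getD_le_size _ _)
    unfold sel
    split_ifs <;> assumption

/-- The power `A ^ (q ^ t)` of an `n × n` matrix. -/
def frob (x : List ℕ) (n : ℕ) (A : List ℕ) (t : ℕ) : List ℕ :=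
  loop t A fun _ P => matpow x n P (q x)

@[fun_prop] theorem pt_frob {n t : α → ℕ} {A : α → List ℕ} (hX : PT X) (hn : PT n) (hA : PT A)
    (ht : PT t) : PT fun y => frob (X y) (n y) (A y) (t y) :=
  PT.loop_of_bound (b := fun y => n y * n y + n y * n y * size (X y)) ht (by fun_prop)
    (by fun_prop) (by fun_prop) fun _ _ _ => size_matpow_le _ _ _ _

/-- The constraint number `i` for the prefix `c`, where `A` is an `n × n` matrix. -/
def prow (x : List ℕ) (n : ℕ) (A c : List ℕ) (i : ℕ) : List ℕ := tab n fun t =>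
  -- Row `i = j n + l` computes coordinate `l` of the product with the coordinate polynomial number
  -- `j`: the sum over `u` treats the powers Y^(q^u), the other summand the constant term c_j ξ^j.
  add x (sum x (q x - 1) fun u => mul x (pow x (g x) (i / n * (q x - 1 - u)))
      ((frob x n A u).getD (i % n * n + t) 0))
    (sel (eqn (i % n / (q x - 1)) (t / (q x - 1)) *
        eqn (t % (q x - 1)) ((i % n % (q x - 1) + (q x - 1) - i / n) % (q x - 1)))
      (mul x (c.getD (i / n) 0) (sel (ltn (i % n % (q x - 1)) (i / n)) (g x) (one x))) (zero x))

@[fun_prop] theorem pt_prow {n i : α → ℕ} {A c : α → List ℕ} (hX : PT X) (hn : PT n) (hA : PT A)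
    (hc : PT c) (hi : PT i) : PT fun y => prow (X y) (n y) (A y) (c y) (i y) := by
  unfold prow; fun_prop

/-- Whether there may be a root that starts with the first `r` entries of `c`. -/
def viable (x : List ℕ) (n : ℕ) (A c : List ℕ) (r : ℕ) : ℕ :=
  ltn (npos x n (kern x n (diag x n (tab n fun _ => 1)) (r * n) (prow x n A c))) (n * n)

@[fun_prop] theorem pt_viable {n r : α → ℕ} {A c : α → List ℕ} (hX : PT X) (hn : PT n) (hA : PT A)
    (hc : PT c) (hr : PT r) : PT fun y => viable (X y) (n y) (A y) (c y) (r y) := by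
  unfold viable; fun_prop

/-- The extension number `t` of the prefixes of length `i` in `P`. -/
def ext (x P : List ℕ) (i t : ℕ) : List ℕ := tab (k x + 1) fun j =>
  sel (eqn j i) (t % q x) (P.getD (t / q x * (k x + 1) + j) 0)

@[fun_prop] theorem pt_ext {P : α → List ℕ} {i t : α → ℕ} (hX : PT X) (hP : PT P) (hi : PT i)
    (ht : PT t) : PT fun y => ext (X y) (P y) (i y) (t y) := by unfold ext; fun_prop

/-- At most `n` entries of a list, reduced modulo `b + 1`. -/
def clip (n b : ℕ) (l : List ℕ) : List ℕ :=
  tab (sel (ltn n l.length) n l.length) fun i => l.getD i 0 % (b + 1)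

@[fun_prop] theorem pt_clip {n b : α → ℕ} {l : α → List ℕ} (hn : PT n) (hb : PT b) (hl : PT l) :
    PT fun y => clip (n y) (b y) (l y) := by unfold clip; fun_prop

theorem size_clip_le (n b : ℕ) (l : List ℕ) : size (clip n b l) ≤ n + n * b := by
  have h : sel (ltn n l.length) n l.length ≤ n := by
    rw [sel_ltn]; split_ifs <;> omega
  refine (size_tab_le fun i _ => ?_).trans (Nat.add_le_add h (Nat.mul_le_mul_right b h))
  exact Nat.lt_succ_iff.1 (Nat.mod_lt _ (by omega))

/-- The prefixes of length `i` of the roots. -/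
def level (x : List ℕ) (n : ℕ) (A : List ℕ) (i : ℕ) : List ℕ :=
  -- The clipping bounds the list for every conceivable input, as polynomial time requires; when the
  -- input is valid and the stated root bound holds, it does nothing (`clip_eq_self`).
  loop i (tab (k x + 1) fun _ => 0) fun i P => clip (q x * q x * (k x + 1)) (q x)
    ((List.range (P.length / (k x + 1) * q x)).flatMap fun t =>
      sel (viable x n A (ext x P i t) (i + 1)) (ext x P i t) [])

@[fun_prop] theorem pt_level {n i : α → ℕ} {A : α → List ℕ} (hX : PT X) (hn : PT n) (hA : PT A)
    (hi : PT i) : PT fun y => level (X y) (n y) (A y) (i y) :=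
  PT.loop_of_bound
    (b := fun y => q (X y) * q (X y) * (k (X y) + 1) + q (X y) * q (X y) * (k (X y) + 1) * q (X y))
    hi (by fun_prop) (by fun_prop) (by fun_prop) fun _ _ _ => size_clip_le _ _ _

/-- The encoding of the polynomial that is stored in `P` from `o` on. -/
def word (x P : List ℕ) (o : ℕ) : List ℕ := tab (len x) fun i =>
  sum x (k x + 1) fun j => mul x (P.getD (o + j) 0) (pow x (g x) (i * j))

@[fun_prop] theorem pt_word {P : α → List ℕ} {o : α → ℕ} (hX : PT X) (hP : PT P) (ho : PT o) :
    PT fun y => word (X y) (P y) (o y) := by unfold word; fun_prop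

/-- The number of positions in which a word differs from the received word. -/
def errors (x w : List ℕ) : ℕ := nsum (bl x) fun j =>
  ltn (find (m x) fun l => 1 - eqn (w.getD (j * m x + l) 0) (rcv x (j * m x + l))) (m x)

@[fun_prop] theorem pt_errors {w : α → List ℕ} (hX : PT X) (hw : PT w) :
    PT fun y => errors (X y) (w y) := by unfold errors; fun_prop

/-- The encodings of those polynomials in the list `P` that are close to the received word. -/
def close (x P : List ℕ) : List ℕ := (List.range (P.length / (k x + 1))).flatMap fun t =>
  sel (ltn (e x) (errors x (word x P (t * (k x + 1))))) [] (word x P (t * (k x + 1)))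

@[fun_prop] theorem pt_close {P : α → List ℕ} (hX : PT X) (hP : PT P) :
    PT fun y => close (X y) (P y) := by unfold close; fun_prop

/-- The prefixes of the roots of `T`, a polynomial of degree `d`. -/
def roots (x T : List ℕ) (d : ℕ) : List ℕ :=
  level x (d * (q x - 1)) (companion x (monic x T d) d) (k x + 1)

@[fun_prop] theorem pt_roots {T : α → List ℕ} {d : α → ℕ} (hX : PT X) (hT : PT T) (hd : PT d) :
    PT fun y => roots (X y) (T y) (d y) := by unfold roots; fun_prop

/-- The list decoder. -/
def decode (x : List ℕ) : List ℕ :=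
  close x (roots x (poly x (interp x)) (deg x (poly x (interp x))))

theorem pt_decode : PT decode := by
  change PT fun x => decode x
  unfold decode; fun_prop

end Decoder

end RAM

namespace RAM

namespace Decoder

/-! ## Correctness of the linear algebra -/

/-- The list `x` starts with the size, a generator and the tables of the field `F`, whose elements
are numbered by `enc`. -/
structure Encodes {F : Type} [Field F] (x : List ℕ) (enc : F → ℕ) (γ : F) : Prop where
  inj : Function.Injective enc
  lt : ∀ a, enc a < q x
  surj : ∀ n < q x, ∃ a, enc a = n
  g_eq : g x = enc γ
  ne_zero : γ ≠ 0
  add_eq : ∀ a b, add x (enc a) (enc b) = enc (a + b)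
  mul_eq : ∀ a b, mul x (enc a) (enc b) = enc (a * b)

variable {F : Type} [Field F] {x : List ℕ} {enc : F → ℕ} {γ : F}

/-- The first `n` entries of `l` are the numbers of the entries of `v`. -/
def Rep {F : Type} (enc : F → ℕ) (n : ℕ) (l : List ℕ) (v : ℕ → F) : Prop := ∀ t < n, l.getD t 0 = enc (v t)

theorem rep_tab {F : Type} {enc : F → ℕ} {n : ℕ} {f : ℕ → ℕ} {v : ℕ → F} (h : ∀ t < n, f t = enc (v t)) :
    Rep enc n (tab n f) v := fun t ht => by rw [getD_tab, if_pos ht, h t ht]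

theorem div_of_lt {n i : ℕ} (l : ℕ) (h : i < n) : (l * n + i) / n = l := by
  rw [mul_comm, Nat.mul_add_div (by omega), Nat.div_eq_of_lt h, add_zero]

theorem mod_of_lt {n i : ℕ} (l : ℕ) (h : i < n) : (l * n + i) % n = i := by
  rw [mul_comm, Nat.mul_add_mod, Nat.mod_eq_of_lt h]

theorem add_lt_mul {n k l i : ℕ} (hl : l < k) (h : i < n) : l * n + i < k * n := by
  have : (l + 1) * n ≤ k * n := Nat.mul_le_mul_right n hl
  rw [Nat.succ_mul] at this; omega

theorem find_enc_eq {n : ℕ} {a : F} {f : ℕ → ℕ} (h : Encodes x enc γ) (hn : n = q x)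
    (hf : ∀ b, f (enc b) ≠ 0 ↔ b = a) : find n f = enc a := by
  subst hn
  refine find_eq (h.lt a) fun j hj => ?_
  obtain ⟨b, rfl⟩ := h.surj j hj
  rw [hf, h.inj.eq_iff]

theorem eqn_ne_zero {a b : ℕ} : eqn a b ≠ 0 ↔ a = b := by unfold eqn; split_ifs <;> simp_all

theorem ltn_ne_zero {a b : ℕ} : ltn a b ≠ 0 ↔ a < b := by unfold ltn; split_ifs <;> simp_all

namespace Encodes

variable (h : Encodes x enc γ)
include h

theorem zero_eq : zero x = enc 0 :=
  find_enc_eq h rfl fun b => by rw [eqn_ne_zero, h.add_eq, h.inj.eq_iff]; simp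

theorem one_eq : one x = enc 1 :=
  find_enc_eq h rfl fun b => by
    rw [eqn_ne_zero, h.g_eq, h.mul_eq, h.inj.eq_iff, mul_eq_right₀ h.ne_zero]

theorem neg_eq (a : F) : neg x (enc a) = enc (-a) :=
  find_enc_eq h rfl fun b => by
    rw [eqn_ne_zero, h.add_eq, h.zero_eq, h.inj.eq_iff, eq_neg_iff_add_eq_zero, add_comm]

theorem inv_eq {a : F} (ha : a ≠ 0) : inv x (enc a) = enc a⁻¹ :=
  find_enc_eq h rfl fun b => by
    rw [eqn_ne_zero, h.mul_eq, h.one_eq, h.inj.eq_iff, mul_comm, mul_eq_one_iff_eq_inv₀ ha]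

theorem ne_ne_zero {a : F} : ne x (enc a) ≠ 0 ↔ a ≠ 0 := by
  rw [← h.inj.ne_iff, ← h.zero_eq, ne, eqn]
  split_ifs <;> simp_all

theorem sum_eq {n : ℕ} {f : ℕ → ℕ} {v : ℕ → F} (hf : ∀ i < n, f i = enc (v i)) :
    sum x n f = enc (∑ i ∈ Finset.range n, v i) := by
  induction n with
  | zero => simpa [sum] using h.zero_eq
  | succ n ih =>
    rw [sum, loop_succ, Finset.sum_range_succ, ← h.add_eq, ← ih fun i hi => hf i (by omega),
      hf n (by omega)]
    rfl

theorem pow_eq (a : F) (n : ℕ) : pow x (enc a) n = enc (a ^ n) := by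
  induction n with
  | zero => simpa [pow] using h.one_eq
  | succ n ih => rw [pow, loop_succ, pow_succ, ← h.mul_eq, ← ih]; rfl

theorem binRow_rep (a : F) (L i : ℕ) :
    Rep enc L (binRow x (enc a) L i) fun j => ((X + C a) ^ i).coeff j := by
  induction i with
  | zero =>
    refine rep_tab fun t _ => ?_
    rw [sel_eqn, h.one_eq, h.zero_eq, pow_zero, coeff_one]
    split_ifs <;> rfl
  | succ i ih =>
    rw [binRow, loop_succ, ← binRow]
    refine rep_tab fun t ht => ?_
    rw [pow_succ', add_mul, coeff_add, coeff_C_mul, add_comm (coeff _ _), ← h.add_eq, ← h.mul_eq,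
      sel_eqn]
    rw [ih t ht]
    cases t with
    | zero => rw [if_pos rfl, h.zero_eq, coeff_X_mul_zero]
    | succ t => rw [if_neg (by omega), Nat.add_sub_cancel, ih t (by omega), coeff_X_mul]

theorem bin_eq (a : F) (i j : ℕ) : bin x (enc a) i j = enc (((X + C a) ^ i).coeff j) :=
  h.binRow_rep a (j + 1) i j (by omega)

theorem diag_rep (n : ℕ) (w : List ℕ) : Rep enc (n * n) (diag x n w)
    fun t => if t / n = t % n ∧ w.getD (t % n) 0 ≠ 0 then 1 else 0 := by
  refine rep_tab fun t _ => ?_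
  rw [sel_eqn, h.zero_eq, h.one_eq, sel]
  split_ifs <;> simp_all

theorem dot_eq {n l : ℕ} {r V : List ℕ} {ρ v : ℕ → F} (hr : Rep enc n r ρ)
    (hV : Rep enc (n * n) V v) (hl : l < n) :
    dot x n r V l = enc (∑ i ∈ Finset.range n, ρ i * v (l * n + i)) :=
  h.sum_eq fun i hi => by rw [hr i hi, hV _ (add_lt_mul hl hi), h.mul_eq]

end Encodes

/-- `w` is in the span of the rows of the `n × n` matrix `v`. -/
def InSpan (n : ℕ) (v w : ℕ → F) : Prop :=
  ∃ c : ℕ → F, ∀ i < n, w i = ∑ l ∈ Finset.range n, c l * v (l * n + i)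

/-- Let δ_l be the value of the functional at row l, and j the first row with δ_j ≠ 0. The new rows
δ_j v_l - δ_l v_j are in the kernel. Conversely, a combination ∑ c_l v_l with ∑ c_l δ_l = 0 equals
the combination of the new rows with coefficients δ_j⁻¹ c_l. If there is no such j, the whole span
is in the kernel. -/
theorem Encodes.cut_spec (h : Encodes x enc γ) {n : ℕ} {r V : List ℕ} {ρ v : ℕ → F}
    (hr : Rep enc n r ρ) (hV : Rep enc (n * n) V v) :
    ∃ v', Rep enc (n * n) (cut x n r V) v' ∧ ∀ w,
      InSpan n v' w ↔ InSpan n v w ∧ ∑ i ∈ Finset.range n, ρ i * w i = 0 := by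
  set δ : ℕ → F := fun l => ∑ i ∈ Finset.range n, ρ i * v (l * n + i) with hδ
  have hd : ∀ l < n, dot x n r V l = enc (δ l) := fun l hl => h.dot_eq hr hV hl
  set j := pivot x n r V with hj
  have hj' : j = find n fun l => ne x (dot x n r V l) := rfl
  obtain ⟨s1, s2, s3⟩ := find_spec n fun l => ne x (dot x n r V l)
  rw [← hj'] at s1 s2 s3
  have hsum : ∀ w : ℕ → F, ∀ c : ℕ → F, (∀ i < n, w i = ∑ l ∈ Finset.range n, c l * v (l * n + i)) →
      ∑ i ∈ Finset.range n, ρ i * w i = ∑ l ∈ Finset.range n, c l * δ l := by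
    intro w c hc
    rw [Finset.sum_congr rfl fun i hi => by rw [hc i (Finset.mem_range.1 hi), Finset.mul_sum],
      Finset.sum_comm]
    refine Finset.sum_congr rfl fun l _ => ?_
    rw [hδ, Finset.mul_sum]
    exact Finset.sum_congr rfl fun i _ => by ring
  by_cases hlt : j < n
  · have hne : δ j ≠ 0 := by
      have := s3 hlt
      rwa [hd j hlt, h.ne_ne_zero] at this
    refine ⟨fun t => δ j * v t + -(δ (t / n) * v (j * n + t % n)), rep_tab fun t ht => ?_,
      fun w => ⟨?_, ?_⟩⟩
    · have hn : 0 < n := by omega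
      rw [← hj, sel_ltn, if_pos hlt, hd j hlt, hd _ (Nat.div_lt_of_lt_mul ht), hV t ht,
        hV _ (add_lt_mul hlt (Nat.mod_lt t hn)), h.mul_eq, h.mul_eq, h.neg_eq, h.add_eq]
    · rintro ⟨c, hc⟩
      have key : ∀ i < n, w i = ∑ l ∈ Finset.range n,
          (c l * δ j - if l = j then ∑ l' ∈ Finset.range n, c l' * δ l' else 0) *
            v (l * n + i) := by
        intro i hi
        rw [hc i hi]
        simp only [div_of_lt _ hi, mod_of_lt _ hi, sub_mul, ite_mul, zero_mul]
        rw [Finset.sum_sub_distrib, Finset.sum_ite_eq' (Finset.range n) j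
          (fun l => (∑ l' ∈ Finset.range n, c l' * δ l') * v (l * n + i)),
          if_pos (Finset.mem_range.2 hlt), Finset.sum_mul, ← Finset.sum_sub_distrib]
        exact Finset.sum_congr rfl fun l _ => by ring
      refine ⟨⟨_, key⟩, ?_⟩
      rw [hsum w _ key]
      simp only [sub_mul, ite_mul, zero_mul]
      rw [Finset.sum_sub_distrib, Finset.sum_ite_eq' (Finset.range n) j
        (fun l => (∑ l' ∈ Finset.range n, c l' * δ l') * δ l),
        if_pos (Finset.mem_range.2 hlt), Finset.sum_mul, ← Finset.sum_sub_distrib]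
      exact Finset.sum_eq_zero fun l _ => by ring
    · rintro ⟨⟨c, hc⟩, hw⟩
      rw [hsum w c hc] at hw
      refine ⟨fun l => (δ j)⁻¹ * c l, fun i hi => ?_⟩
      simp only [div_of_lt _ hi, mod_of_lt _ hi]
      have : ∑ l ∈ Finset.range n, (δ j)⁻¹ * c l * (δ j * v (l * n + i) + -(δ l * v (j * n + i))) =
          ∑ l ∈ Finset.range n, c l * v (l * n + i) -
            (δ j)⁻¹ * v (j * n + i) * ∑ l ∈ Finset.range n, c l * δ l := by
        rw [Finset.mul_sum, ← Finset.sum_sub_distrib]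
        refine Finset.sum_congr rfl fun l _ => ?_
        field_simp
        ring
      rw [this, hw, mul_zero, sub_zero, hc i hi]
  · have hz : ∀ l < n, δ l = 0 := fun l hl => by
      by_contra h0
      have := s2 l (by omega)
      rw [hd l hl] at this
      exact h.ne_ne_zero.2 h0 this
    refine ⟨v, rep_tab fun t ht => ?_, fun w => ⟨fun hw => ⟨hw, ?_⟩, fun hw => hw.1⟩⟩
    · rw [← hj, sel_ltn, if_neg hlt, h.one_eq, hV t ht, h.mul_eq, one_mul]
    · obtain ⟨c, hc⟩ := hw
      rw [hsum w c hc]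
      exact Finset.sum_eq_zero fun l hl => by rw [hz l (Finset.mem_range.1 hl), mul_zero]

theorem Encodes.kern_spec (h : Encodes x enc γ) {n R : ℕ} {V : List ℕ} {row : ℕ → List ℕ}
    {v : ℕ → F} {ρ : ℕ → ℕ → F} (hV : Rep enc (n * n) V v)
    (hr : ∀ i < R, Rep enc n (row i) (ρ i)) :
    ∃ v', Rep enc (n * n) (kern x n V R row) v' ∧ ∀ w, InSpan n v' w ↔
      InSpan n v w ∧ ∀ i < R, ∑ j ∈ Finset.range n, ρ i j * w j = 0 := by
  induction R with
  | zero => exact ⟨v, hV, fun w => by simp⟩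
  | succ R ih =>
    obtain ⟨v', h1, h2⟩ := ih fun i hi => hr i (by omega)
    obtain ⟨v'', h3, h4⟩ := h.cut_spec (hr R (by omega)) h1
    refine ⟨v'', h3, fun w => ?_⟩
    rw [h4, h2, and_assoc]
    simp only [Nat.lt_succ_iff_lt_or_eq, or_imp, forall_and, forall_eq]

theorem inSpan_diag {n : ℕ} {w : List ℕ} {u : ℕ → F} :
    InSpan n (fun t => if t / n = t % n ∧ w.getD (t % n) 0 ≠ 0 then 1 else 0) u ↔
      ∀ i < n, w.getD i 0 = 0 → u i = 0 := by
  have key : ∀ (c : ℕ → F) i, i < n → ∑ l ∈ Finset.range n,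
      c l * (if (l * n + i) / n = (l * n + i) % n ∧ w.getD ((l * n + i) % n) 0 ≠ 0 then 1 else 0) =
      if w.getD i 0 = 0 then 0 else c i := by
    intro c i hi
    simp only [div_of_lt _ hi, mod_of_lt _ hi]
    split_ifs with h0
    · exact Finset.sum_eq_zero fun l _ => by rw [if_neg (by simp_all), mul_zero]
    · rw [Finset.sum_eq_single i (by simp +contextual) (by simp [hi]), if_pos ⟨rfl, h0⟩, mul_one]
  constructor
  · rintro ⟨c, hc⟩ i hi h0
    rw [hc i hi, key c i hi, if_pos h0]
  · intro hu
    refine ⟨u, fun i hi => ?_⟩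
    rw [key u i hi]
    split_ifs with h0
    exacts [hu i hi h0, rfl]

/-- `u` is nonzero below `n`, supported on `w`, and annihilated by the functionals
`ρ 0, …, ρ (R - 1)`. -/
def IsSol (n : ℕ) (w : List ℕ) (R : ℕ) (ρ : ℕ → ℕ → F) (u : ℕ → F) : Prop :=
  (∃ i < n, u i ≠ 0) ∧ (∀ i < n, w.getD i 0 = 0 → u i = 0) ∧
    ∀ i < R, ∑ j ∈ Finset.range n, ρ i j * u j = 0

/-- The rows of the final matrix span the space of solutions. So a nonzero solution exists exactly
if the matrix has a nonzero entry, and the row of that entry is then one. -/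
theorem Encodes.npos_kern (h : Encodes x enc γ) {n R : ℕ} {w : List ℕ} {row : ℕ → List ℕ}
    {ρ : ℕ → ℕ → F} (hr : ∀ i < R, Rep enc n (row i) (ρ i)) :
    (npos x n (kern x n (diag x n w) R row) < n * n ↔ ∃ u, IsSol n w R ρ u) ∧
    ((∃ u, IsSol n w R ρ u) → ∃ u, IsSol n w R ρ u ∧
      Rep enc n (pick x n (kern x n (diag x n w) R row)) u) := by
  obtain ⟨v, h1, h2⟩ := h.kern_spec (h.diag_rep n w) hr
  set V := kern x n (diag x n w) R row
  have hsol : ∀ t < n * n, ne x (V.getD t 0) ≠ 0 →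
      IsSol n w R ρ (fun i => v (t / n * n + i)) := by
    intro t ht h0
    have hn : 0 < n := by
      by_contra! hn; simp [Nat.le_zero.1 hn] at ht
    rw [h1 t ht, h.ne_ne_zero] at h0
    have hs : InSpan n v (fun i => v (t / n * n + i)) := by
      refine ⟨fun l => if l = t / n then 1 else 0, fun i hi => ?_⟩
      rw [Finset.sum_eq_single (t / n) (by simp +contextual)]
      · simp
      · intro hh
        exact absurd (Finset.mem_range.2 (Nat.div_lt_of_lt_mul ht)) hh
    obtain ⟨h3, h4⟩ := (h2 _).1 hs
    refine ⟨⟨t % n, Nat.mod_lt t hn, ?_⟩, inSpan_diag.1 h3, h4⟩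
    dsimp only
    rwa [Nat.div_add_mod']
  have hex : (∃ u, IsSol n w R ρ u) → npos x n V < n * n := by
    rintro ⟨u, ⟨i, hi, hui⟩, h3, h4⟩
    obtain ⟨c, hc⟩ := (h2 u).2 ⟨inSpan_diag.2 h3, h4⟩
    rw [hc i hi] at hui
    obtain ⟨l, hl, hne⟩ := Finset.exists_ne_zero_of_sum_ne_zero hui
    have hlt := add_lt_mul (Finset.mem_range.1 hl) hi
    refine find_lt hlt ?_
    rw [h1 _ hlt, h.ne_ne_zero]
    exact right_ne_zero_of_mul hne
  have hpos : npos x n V < n * n → IsSol n w R ρ (fun i => v (npos x n V / n * n + i)) :=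
    fun hlt => hsol _ hlt ((find_spec (n * n) _).2.2 hlt)
  refine ⟨⟨fun hlt => ⟨_, hpos hlt⟩, hex⟩, fun hu => ⟨_, hpos (hex hu), ?_⟩⟩
  exact rep_tab fun t ht => h1 _ (add_lt_mul (Nat.div_lt_of_lt_mul (hex hu)) ht)

/-- The product of an `n × n` matrix and a vector. -/
def act (n : ℕ) (a v : ℕ → F) (i : ℕ) : F := ∑ j ∈ Finset.range n, a (i * n + j) * v j

/-- The `n × n` matrix `a` represents the multiplication by `b`. -/
def Mult {B : Type} [CommRing B] (n : ℕ) (ev : (ℕ → F) → B) (a : ℕ → F) (b : B) : Prop :=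
  ∀ v, ev (act n a v) = b * ev v

/-! ### Matrices that represent multiplication in a ring -/

section Matrices

variable {B : Type} [CommRing B] {n : ℕ} {ev : (ℕ → F) → B} (h : Encodes x enc γ)
  (hev : ∀ v w, (∀ i < n, v i = w i) → ev v = ev w)
include h hev

theorem Encodes.matmul_mult {P A : List ℕ} {p a : ℕ → F} {b c : B} (hP : Rep enc (n * n) P p)
    (hA : Rep enc (n * n) A a) (hp : Mult n ev p b) (ha : Mult n ev a c) :
    ∃ r, Rep enc (n * n) (matmul x n P A) r ∧ Mult n ev r (b * c) := by
  refine ⟨fun t => ∑ l ∈ Finset.range n, p (t / n * n + l) * a (l * n + t % n),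
    rep_tab fun t ht => h.sum_eq fun l hl => ?_, fun v => ?_⟩
  · rw [hP _ (add_lt_mul (Nat.div_lt_of_lt_mul ht) hl),
      hA _ (add_lt_mul hl (Nat.mod_lt _ (by omega))), h.mul_eq]
  · rw [mul_assoc, ← ha v, ← hp]
    refine hev _ _ fun i _ => ?_
    simp only [act, Finset.mul_sum]
    rw [Finset.sum_comm]
    refine Finset.sum_congr rfl fun j hj => ?_
    rw [div_of_lt _ (Finset.mem_range.1 hj), mod_of_lt _ (Finset.mem_range.1 hj), Finset.sum_mul]
    exact Finset.sum_congr rfl fun l _ => by ring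

theorem Encodes.matpow_mult {A : List ℕ} {a : ℕ → F} {b : B}
    (hA : Rep enc (n * n) A a) (ha : Mult n ev a b) (r : ℕ) :
    ∃ p, Rep enc (n * n) (matpow x n A r) p ∧ Mult n ev p (b ^ r) := by
  induction r with
  | zero =>
    refine ⟨_, h.diag_rep n _, fun v => ?_⟩
    rw [pow_zero, one_mul]
    refine hev _ _ fun i hi => ?_
    rw [act, Finset.sum_eq_single i]
    · simp [div_of_lt i hi, mod_of_lt i hi, -List.getD_eq_getElem?_getD, getD_tab, hi]
    · intro j hj hne
      simp [div_of_lt i (Finset.mem_range.1 hj), mod_of_lt i (Finset.mem_range.1 hj), hne.symm]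
    · simp [hi]
  | succ r ih =>
    obtain ⟨p, h1, h2⟩ := ih
    rw [pow_succ]
    exact h.matmul_mult hev h1 hA h2 ha

/-- Raising to the power q in each of `t` rounds takes `t q` matrix products in place of `q ^ t`. -/
theorem Encodes.frob_mult {A : List ℕ} {a : ℕ → F} {b : B}
    (hA : Rep enc (n * n) A a) (ha : Mult n ev a b) (t : ℕ) :
    ∃ p, Rep enc (n * n) (frob x n A t) p ∧ Mult n ev p (b ^ q x ^ t) := by
  induction t with
  | zero => exact ⟨a, hA, by simpa using ha⟩
  | succ t ih =>
    obtain ⟨p, h1, h2⟩ := ih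
    rw [pow_succ, pow_mul]
    exact h.matpow_mult hev h1 h2 (q x)

end Matrices

end Decoder

end RAM

/-! ## The extension field `F[X] / (X ^ (q - 1) - γ)` -/

section Extension

variable {F : Type} [Field F] [Fintype F]

/-- The Frobenius map fixes the coefficients, which are in `F`, so it only acts on the point. -/
theorem aeval_pow_card_pow {K : Type} [Field K] [Algebra F K] (y : K) (f : F[X]) (t : ℕ) :
    aeval y f ^ Fintype.card F ^ t = aeval (y ^ Fintype.card F ^ t) f := by
  induction t generalizing y with
  | zero => simp
  | succ t ih => rw [pow_succ', pow_mul, pow_mul, ← ih, ← map_pow, ← FiniteField.expand_card, expand_aeval]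

/-- Since y^q = y^(q-1) y = γ y and γ is fixed by Frobenius, each further application multiplies by
another γ. Together with `aeval_pow_card_pow` this turns f(γX) into the q-th power of f at y. -/
theorem pow_card_pow_of_pow_eq {K : Type} [Field K] [Algebra F K] {y : K} {γ : F}
    (hy : y ^ (Fintype.card F - 1) = algebraMap F K γ) (t : ℕ) :
    y ^ Fintype.card F ^ t = algebraMap F K (γ ^ t) * y := by
  have hq : 0 < Fintype.card F := Fintype.card_pos
  induction t with
  | zero => simp
  | succ t ih =>
    rw [pow_succ, pow_mul, ih, mul_pow, ← map_pow, FiniteField.pow_card,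
      show y ^ Fintype.card F = y ^ (Fintype.card F - 1) * y by rw [← pow_succ, Nat.sub_add_cancel hq],
      hy, ← mul_assoc, ← map_mul, pow_succ]

/-- Let p be an irreducible factor of degree d, and y a root of it in the field F[X]/(p) with q^d
elements. Then y = y^(q^d) = γ^d y, so γ^d = 1 and q - 1 divides d. Hence p has the full degree. -/
theorem irreducible_X_pow_sub_C {γ : F} (hγ : orderOf γ = Fintype.card F - 1) (h0 : γ ≠ 0) :
    Irreducible (X ^ (Fintype.card F - 1) - C γ : F[X]) := by
  have hq : 1 < Fintype.card F := Fintype.one_lt_card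
  set N := Fintype.card F - 1 with hN
  have hE : (X ^ N - C γ : F[X]).natDegree = N := natDegree_X_pow_sub_C
  have hE0 : (X ^ N - C γ : F[X]) ≠ 0 := X_pow_sub_C_ne_zero (by omega) γ
  obtain ⟨p, hp, hpE⟩ := exists_irreducible_of_natDegree_pos (f := X ^ N - C γ) (by omega)
  have := Fact.mk hp
  have hfin : Module.Finite F (AdjoinRoot p) := (AdjoinRoot.powerBasis hp.ne_zero).finite
  have hrank : Module.finrank F (AdjoinRoot p) = p.natDegree := by
    rw [(AdjoinRoot.powerBasis hp.ne_zero).finrank, AdjoinRoot.powerBasis_dim]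
  have : Finite (AdjoinRoot p) := Module.finite_of_finite F
  have := Fintype.ofFinite (AdjoinRoot p)
  have hcard : Fintype.card (AdjoinRoot p) = Fintype.card F ^ p.natDegree := by
    rw [Module.card_eq_pow_finrank (K := F), hrank]
  have hroot : AdjoinRoot.root p ^ N = algebraMap F _ γ := by
    have : aeval (AdjoinRoot.root p) (X ^ N - C γ) = 0 := by
      rw [AdjoinRoot.aeval_eq, AdjoinRoot.mk_eq_zero]; exact hpE
    simpa [sub_eq_zero] using this
  have hne : AdjoinRoot.root p ≠ 0 := by
    intro h
    rw [h, zero_pow (by omega)] at hroot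
    exact h0 ((map_eq_zero _).1 hroot.symm)
  have h1 := pow_card_pow_of_pow_eq hroot p.natDegree
  rw [← hcard, FiniteField.pow_card, eq_comm, mul_eq_right₀ hne] at h1
  have h2 : γ ^ p.natDegree = 1 := (algebraMap F (AdjoinRoot p)).injective (by rw [h1, map_one])
  have h3 : N ∣ p.natDegree := by rw [← hγ]; exact orderOf_dvd_of_pow_eq_one h2
  have h4 := Nat.le_of_dvd hp.natDegree_pos h3
  exact (associated_of_dvd_of_natDegree_le hpE hE0 (by omega)).irreducible hp

/-- `K` has the basis `1, x, …, x ^ (q - 2)` over `F`, and `x ^ (q - 1) = γ`. -/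
structure IsKummer (F : Type) [Field F] [Fintype F] (γ : F) {K : Type} [Field K] [Algebra F K]
    (x : K) : Prop where
  orderOf_eq : orderOf γ = Fintype.card F - 1
  pow_eq : x ^ (Fintype.card F - 1) = algebraMap F K γ
  exists_repr : ∀ φ : K, ∃ v : ℕ → F, φ = ∑ i ∈ Finset.range (Fintype.card F - 1), v i • x ^ i
  indep : ∀ v : ℕ → F, ∑ i ∈ Finset.range (Fintype.card F - 1), v i • x ^ i = 0 →
    ∀ i < Fintype.card F - 1, v i = 0

theorem exists_isKummer {γ : F} (hγ : orderOf γ = Fintype.card F - 1) (h0 : γ ≠ 0) :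
    ∃ (K : Type) (_ : Field K) (_ : Algebra F K) (x : K), IsKummer F γ x := by
  have hq : 1 < Fintype.card F := Fintype.one_lt_card
  have := Fact.mk (irreducible_X_pow_sub_C hγ h0)
  set E : F[X] := X ^ (Fintype.card F - 1) - C γ with hE
  have hmon : E.Monic := monic_X_pow_sub_C γ (by omega)
  have hdeg : E.natDegree = Fintype.card F - 1 := natDegree_X_pow_sub_C
  refine ⟨AdjoinRoot E, inferInstance, inferInstance, AdjoinRoot.root E, hγ, ?_, fun φ => ?_,
    fun v hv i hi => ?_⟩
  · have : aeval (AdjoinRoot.root E) E = 0 := by rw [AdjoinRoot.aeval_eq, AdjoinRoot.mk_self]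
    simpa [hE, sub_eq_zero] using this
  · obtain ⟨f, rfl⟩ := AdjoinRoot.mk_surjective φ
    refine ⟨fun i => (f %ₘ E).coeff i, ?_⟩
    have h1 : AdjoinRoot.mk E f = AdjoinRoot.mk E (f %ₘ E) := by
      rw [← sub_eq_zero, ← map_sub, AdjoinRoot.mk_eq_zero]
      exact ⟨f /ₘ E, by rw [sub_eq_iff_eq_add, add_comm]; exact (modByMonic_add_div f E).symm⟩
    rw [h1, ← AdjoinRoot.aeval_eq, aeval_eq_sum_range' (n := Fintype.card F - 1)]
    rw [← hdeg]
    exact natDegree_modByMonic_lt f hmon (fun h => by rw [h, natDegree_one] at hdeg; omega)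
  · have h1 : AdjoinRoot.mk E (∑ i ∈ Finset.range (Fintype.card F - 1), C (v i) * X ^ i) = 0 := by
      rw [← AdjoinRoot.aeval_eq, ← hv]
      simp [Algebra.smul_def]
    rw [AdjoinRoot.mk_eq_zero] at h1
    have h2 : (∑ i ∈ Finset.range (Fintype.card F - 1), C (v i) * X ^ i).degree < E.degree := by
      rw [degree_eq_natDegree hmon.ne_zero, hdeg]
      refine (degree_sum_le _ _).trans_lt ((Finset.sup_lt_iff (WithBot.bot_lt_coe _)).2 fun j hj => ?_)
      exact (degree_C_mul_X_pow_le _ _).trans_lt (WithBot.coe_lt_coe.2 (Finset.mem_range.1 hj))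
    have h3 := eq_zero_of_dvd_of_degree_lt h1 h2
    have h4 := congrArg (fun p => coeff p i) h3
    simpa [finsetSum_coeff, coeff_C_mul, coeff_X_pow, hi] using h4

end Extension

/-! ### Coordinates in the extension field, and polynomials that detect them -/

section Kummer

variable {F : Type} [Field F]

/-- The element of `K` with coordinates `v 0, …, v (N - 1)` in the basis `1, x, …, x ^ (N - 1)`. -/
def ofCoords {K : Type} [Field K] [Algebra F K] (x : K) (N : ℕ) (v : ℕ → F) : K :=
  ∑ i ∈ Finset.range N, v i • x ^ i

variable {K : Type} [Field K] [Algebra F K] {γ : F} {x : K}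

theorem ofCoords_congr {N : ℕ} {v w : ℕ → F} (h : ∀ i < N, v i = w i) :
    ofCoords x N v = ofCoords x N w :=
  Finset.sum_congr rfl fun i hi => by rw [h i (Finset.mem_range.1 hi)]

theorem ofCoords_sub (N : ℕ) (v w : ℕ → F) :
    ofCoords x N (fun i => v i - w i) = ofCoords x N v - ofCoords x N w := by
  simp [ofCoords, sub_smul]

theorem ofCoords_sum {ι : Type} (s : Finset ι) (N : ℕ) (v : ι → ℕ → F) :
    ofCoords x N (fun i => ∑ j ∈ s, v j i) = ∑ j ∈ s, ofCoords x N (v j) := by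
  simp only [ofCoords, Finset.sum_smul]
  exact Finset.sum_comm

theorem ofCoords_smul (N : ℕ) (a : F) (v : ℕ → F) :
    ofCoords x N (fun i => a * v i) = a • ofCoords x N v := by
  simp [ofCoords, mul_smul, Finset.smul_sum]

theorem ofCoords_eq_aeval (N : ℕ) (v : ℕ → F) :
    ofCoords x N v = aeval x (∑ i ∈ Finset.range N, C (v i) * X ^ i) := by
  simp [ofCoords, Algebra.smul_def]

variable [Fintype F]

namespace IsKummer

variable (h : IsKummer F γ x)
include h

theorem ofCoords_inj {v w : ℕ → F}
    (hvw : ofCoords x (Fintype.card F - 1) v = ofCoords x (Fintype.card F - 1) w) :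
    ∀ i < Fintype.card F - 1, v i = w i := by
  intro i hi
  have := h.indep (fun i => v i - w i) (by
    change ofCoords x _ _ = 0
    rw [ofCoords_sub, hvw, sub_self]) i hi
  exact sub_eq_zero.1 this

theorem gamma_ne_zero : γ ≠ 0 := by
  have hq : 1 < Fintype.card F := Fintype.one_lt_card
  rintro rfl
  have := h.orderOf_eq
  rw [orderOf_zero] at this
  omega

theorem x_ne_zero : x ≠ 0 := by
  have hq : 1 < Fintype.card F := Fintype.one_lt_card
  rintro rfl
  have := h.pow_eq
  rw [zero_pow (by omega)] at this
  exact h.gamma_ne_zero ((map_eq_zero _).1 this.symm)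

theorem natCard_eq : Nat.card K = Fintype.card F ^ (Fintype.card F - 1) := by
  classical
  let e : (Fin (Fintype.card F - 1) → F) → K := fun v => ∑ i, v i • x ^ (i : ℕ)
  have he : ∀ v : ℕ → F, e (fun i => v i) = ofCoords x (Fintype.card F - 1) v := fun v =>
    Fin.sum_univ_eq_sum_range (fun i => v i • x ^ i) _
  have hext : ∀ v : Fin (Fintype.card F - 1) → F, ∃ w : ℕ → F, v = fun i : Fin _ => w i := fun v =>
    ⟨fun i => if hi : i < Fintype.card F - 1 then v ⟨i, hi⟩ else 0, by ext i; simp⟩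
  have hb : Function.Bijective e := by
    constructor
    · intro v w hvw
      obtain ⟨v, rfl⟩ := hext v
      obtain ⟨w, rfl⟩ := hext w
      rw [he, he] at hvw
      exact funext fun i => h.ofCoords_inj hvw i i.2
    · intro φ
      obtain ⟨v, rfl⟩ := h.exists_repr φ
      exact ⟨_, he v⟩
  rw [← Nat.card_congr (Equiv.ofBijective e hb)]
  simp

/-- Multiplication by `x ^ j` in coordinates. -/
theorem pow_mul_ofCoords {j : ℕ} (hj : j < Fintype.card F - 1) (w : ℕ → F) :
    x ^ j * ofCoords x (Fintype.card F - 1) w = ofCoords x (Fintype.card F - 1) fun i =>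
      w ((i + (Fintype.card F - 1) - j) % (Fintype.card F - 1)) * if i < j then γ else 1 := by
  have hx := h.pow_eq
  set N := Fintype.card F - 1
  -- Split the basis after `r = N - j` powers: multiplication by `x ^ j` shifts the lower part up,
  -- while the upper `j` powers wrap around and pick up the factor `γ`.
  obtain ⟨r, hr⟩ : ∃ r, N = r + j := ⟨N - j, by omega⟩
  have h1 : ofCoords x N w = ∑ i ∈ Finset.range r, w i • x ^ i +
      ∑ i ∈ Finset.range j, w (r + i) • x ^ (r + i) := by
    rw [ofCoords, hr, Finset.sum_range_add]
  have h2 : ∀ u : ℕ → F, ofCoords x N u = ∑ i ∈ Finset.range j, u i • x ^ i +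
      ∑ i ∈ Finset.range r, u (j + i) • x ^ (j + i) := by
    intro u; rw [ofCoords, hr, add_comm r j, Finset.sum_range_add]
  rw [h1, h2, mul_add, add_comm, Finset.mul_sum, Finset.mul_sum]
  congr 1
  · refine Finset.sum_congr rfl fun i hi => ?_
    have hi := Finset.mem_range.1 hi
    rw [if_pos hi, show i + N - j = r + i by omega, Nat.mod_eq_of_lt (by omega), mul_smul_comm,
      ← pow_add, show j + (r + i) = N + i by omega, pow_add, hx, ← Algebra.smul_def, smul_smul]
  · refine Finset.sum_congr rfl fun i hi => ?_
    have hi := Finset.mem_range.1 hi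
    rw [if_neg (by omega), show j + i + N - j = N + i by omega, Nat.add_mod_left,
      Nat.mod_eq_of_lt (by omega), mul_smul_comm, ← pow_add, mul_one]

/-- Orthogonality of the powers of γ: this is a geometric sum with ratio γ^(i-j), and the number q -
1 of its terms is -1 in `F`. The exponent j (q - 1 - u) writes γ^(-ju) without negative exponents.
-/
theorem sum_pow_mul_pow {i j : ℕ} (hi : i < Fintype.card F - 1) (hj : j < Fintype.card F - 1) :
    ∑ u ∈ Finset.range (Fintype.card F - 1), γ ^ (j * (Fintype.card F - 1 - u)) * (γ ^ u) ^ i =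
      if i = j then -1 else 0 := by
  have hγ := h.gamma_ne_zero
  have ho := h.orderOf_eq
  have hcast : ((Fintype.card F - 1 : ℕ) : F) = -1 := by
    rw [Nat.cast_sub Fintype.card_pos]; simp
  set N := Fintype.card F - 1
  have hN : γ ^ N = 1 := by rw [← ho]; exact pow_orderOf_eq_one γ
  have key : ∀ u ∈ Finset.range N, γ ^ (j * (N - u)) * (γ ^ u) ^ i = (γ ^ i * (γ ^ j)⁻¹) ^ u := by
    intro u hu
    have hu := Finset.mem_range.1 hu
    have : γ ^ (j * (N - u)) * (γ ^ j) ^ u = 1 := by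
      rw [← pow_mul, ← pow_add, ← mul_add, Nat.sub_add_cancel hu.le, mul_comm, pow_mul, hN, one_pow]
    rw [mul_pow, inv_pow, eq_mul_inv_iff_mul_eq₀ (pow_ne_zero _ (pow_ne_zero _ hγ)),
      mul_right_comm, this, one_mul, ← pow_mul, ← pow_mul, mul_comm]
  rw [Finset.sum_congr rfl key]
  split_ifs with hij
  · subst hij
    rw [mul_inv_cancel₀ (pow_ne_zero _ hγ)]
    simp [hcast]
  · have hz : γ ^ i * (γ ^ j)⁻¹ ≠ 1 := by
      rw [Ne, mul_inv_eq_one₀ (pow_ne_zero _ hγ)]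
      intro he
      exact hij (pow_injOn_Iio_orderOf (by simpa [ho] using hi) (by simpa [ho] using hj) he)
    have hg := mul_geom_sum (γ ^ i * (γ ^ j)⁻¹) N
    rw [mul_pow, inv_pow, ← pow_mul, ← pow_mul, mul_comm i, mul_comm j, pow_mul, pow_mul, hN] at hg
    simpa [sub_ne_zero.2 hz] using hg

/-- The coordinates of an element of `K`, as sums of its conjugates. -/
theorem sum_conj {j : ℕ} (hj : j < Fintype.card F - 1) (v : ℕ → F) :
    ∑ u ∈ Finset.range (Fintype.card F - 1), algebraMap F K (γ ^ (j * (Fintype.card F - 1 - u))) *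
      ofCoords x (Fintype.card F - 1) v ^ Fintype.card F ^ u = -(v j • x ^ j) := by
  have h1 : ∀ u, ofCoords x (Fintype.card F - 1) v ^ Fintype.card F ^ u =
      ∑ i ∈ Finset.range (Fintype.card F - 1), (v i * (γ ^ u) ^ i) • x ^ i := by
    intro u
    rw [ofCoords_eq_aeval, aeval_pow_card_pow, pow_card_pow_of_pow_eq h.pow_eq]
    simp [Algebra.smul_def, mul_pow, mul_assoc]
  simp only [h1, Finset.mul_sum]
  rw [Finset.sum_comm]
  have h2 : ∀ i ∈ Finset.range (Fintype.card F - 1),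
      ∑ u ∈ Finset.range (Fintype.card F - 1),
        algebraMap F K (γ ^ (j * (Fintype.card F - 1 - u))) * (v i * (γ ^ u) ^ i) • x ^ i =
      (v i * if i = j then -1 else 0) • x ^ i := by
    intro i hi
    rw [← h.sum_pow_mul_pow (Finset.mem_range.1 hi) hj, Finset.mul_sum, Finset.sum_smul]
    refine Finset.sum_congr rfl fun u _ => ?_
    rw [← Algebra.smul_def, smul_smul]
    congr 1; ring
  rw [Finset.sum_congr rfl h2, Finset.sum_eq_single j]
  · simp
  · intro i _ hij; simp [hij]
  · simp [hj]

end IsKummer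

/-- The polynomial that vanishes at the elements of `K` whose `j`-th coordinate is `c`. -/
noncomputable def coordPoly (γ : F) (x : K) (j : ℕ) (c : F) : K[X] :=
  ∑ u ∈ Finset.range (Fintype.card F - 1),
    C (algebraMap F K (γ ^ (j * (Fintype.card F - 1 - u)))) * X ^ Fintype.card F ^ u + C (c • x ^ j)

/-- By `sum_conj`, the value is (c - v_j) x^j, and x is not zero. -/
theorem IsKummer.eval_coordPoly (h : IsKummer F γ x) {j : ℕ} (hj : j < Fintype.card F - 1) (c : F)
    (v : ℕ → F) :
    (coordPoly γ x j c).eval (ofCoords x (Fintype.card F - 1) v) = 0 ↔ c = v j := by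
  have : (coordPoly γ x j c).eval (ofCoords x (Fintype.card F - 1) v) = (c - v j) • x ^ j := by
    rw [coordPoly, eval_add, eval_finsetSum, eval_C, sub_smul, sub_eq_neg_add, ← h.sum_conj hj]
    simp
  rw [this, smul_eq_zero, sub_eq_zero]
  simp [h.x_ne_zero]

/-- For j = 0 the polynomial is P = ∑ Y^(q^u) + c, with coefficients in `F`. Then P^q - P telescopes
to Y^(q^(q-1)) - Y, the product of all Y - φ with φ in `K`, and P divides it. -/
theorem IsKummer.splits_coordPoly_zero (h : IsKummer F γ x) (c : F) :
    (coordPoly γ x 0 c).Splits := by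
  have hq : 1 < Fintype.card F := Fintype.one_lt_card
  set P : F[X] := ∑ u ∈ Finset.range (Fintype.card F - 1), X ^ Fintype.card F ^ u + C c with hP
  have h1 : coordPoly γ x 0 c = P.map (algebraMap F K) := by
    simp [coordPoly, hP, Polynomial.map_sum, Algebra.smul_def]
  have h2 : P ^ Fintype.card F - P = X ^ Fintype.card F ^ (Fintype.card F - 1) - X := by
    rw [← FiniteField.expand_card, hP]
    simp only [map_add, map_sum, map_pow, expand_X, expand_C, ← pow_mul, ← pow_succ']
    rw [add_sub_add_right_eq_sub, ← Finset.sum_sub_distrib,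
      Finset.sum_range_sub fun u => (X : F[X]) ^ Fintype.card F ^ u]
    simp
  have h3 : P.map (algebraMap F K) ∣ X ^ Nat.card K - X := by
    have : P ∣ X ^ Fintype.card F ^ (Fintype.card F - 1) - X := by
      rw [← h2]
      exact dvd_sub (dvd_pow_self P (by omega)) dvd_rfl
    have := Polynomial.map_dvd (algebraMap F K) this
    simpa [h.natCard_eq] using this
  have hfin : Finite K := Nat.finite_of_card_ne_zero (by rw [h.natCard_eq]; positivity)
  have := Fintype.ofFinite K
  rw [h1]
  rw [Nat.card_eq_fintype_card] at h3
  refine Splits.of_dvd ?_ (FiniteField.X_pow_card_sub_X_ne_zero K Fintype.one_lt_card) h3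
  rw [splits_iff_card_roots, FiniteField.roots_X_pow_card_sub_X,
    FiniteField.X_pow_card_sub_X_natDegree_eq _ Fintype.one_lt_card]
  rfl

/-- A nonzero residue modulo `T` that is annihilated by the coordinate polynomials for a nonempty
prefix comes from a root of `T` with that prefix. -/
theorem IsKummer.exists_root_of_dvd (h : IsKummer F γ x) {T V : K[X]} {r : ℕ} {c : ℕ → F}
    (hr : 0 < r) (hT : T ≠ 0) (hV : ¬ T ∣ V) (hTV : ∀ j < r, T ∣ coordPoly γ x j (c j) * V) :
    ∃ φ, T.eval φ = 0 ∧ ∀ j < r, (coordPoly γ x j (c j)).eval φ = 0 := by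
  classical
  have hV0 : V ≠ 0 := by rintro rfl; exact hV (dvd_zero T)
  let := EuclideanDomain.gcdMonoid K[X]
  -- The cofactor g = T / gcd(T, V) is no unit because T does not divide V, and it is coprime to V /
  -- gcd(T, V). So it divides every coordinate polynomial, splits because the one for j = 0 does,
  -- and any of its roots will do.
  set G := gcd T V with hG
  have hG0 : G ≠ 0 := fun h0 => hT ((gcd_eq_zero_iff T V).1 h0).1
  obtain ⟨g, hg⟩ := gcd_dvd_left T V
  obtain ⟨V', hV'⟩ := gcd_dvd_right T V
  rw [← hG] at hg hV'
  have hcop : IsCoprime g V' := by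
    have := isCoprime_div_gcd_div_gcd (p := T) (q := V) hV0
    rw [← hG] at this
    rwa [hg, mul_div_cancel_left₀ _ hG0, hV', mul_div_cancel_left₀ _ hG0] at this
  have hdvd : ∀ j < r, g ∣ coordPoly γ x j (c j) := by
    intro j hj
    refine hcop.dvd_of_dvd_mul_right ?_
    have := hTV j hj
    rw [hg, hV', mul_left_comm] at this
    exact (mul_dvd_mul_iff_left hG0).1 this
  have hgu : ¬ IsUnit g := fun hu => hV (by
    rw [hg, hV', IsUnit.mul_right_dvd hu]
    exact dvd_mul_right _ _)
  have hg0 : g ≠ 0 := by rintro rfl; rw [mul_zero] at hg; exact hT hg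
  have hsp : g.Splits := by
    by_cases hc0 : coordPoly γ x 0 (c 0) = 0
    · have hz := h.eval_coordPoly (j := 0) (by have := Fintype.one_lt_card (α := F); omega) (c 0)
      have h1 := (hz fun _ => c 0 + 1).1 (by rw [hc0, eval_zero])
      simp at h1
    · exact (h.splits_coordPoly_zero (c 0)).of_dvd hc0 (hdvd 0 hr)
  obtain ⟨φ, hφ⟩ := hsp.exists_eval_eq_zero
    (fun hd => hgu (isUnit_iff_degree_eq_zero.2 hd))
  refine ⟨φ, by rw [hg, eval_mul, hφ, mul_zero], fun j hj => ?_⟩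
  obtain ⟨s, hs⟩ := hdvd j hj
  rw [hs, eval_mul, hφ, zero_mul]

/-- Take V = T / (X - φ): every W that vanishes at φ supplies the missing factor. -/
theorem exists_dvd_of_root {K : Type} [Field K] {T : K[X]} {φ : K} (hT : T ≠ 0)
    (hφ : T.eval φ = 0) :
    ∃ V : K[X], V.degree < T.degree ∧ V ≠ 0 ∧ ∀ W : K[X], W.eval φ = 0 → T ∣ W * V := by
  obtain ⟨V, hV⟩ := dvd_iff_isRoot.2 hφ
  have hV0 : V ≠ 0 := by rintro rfl; rw [mul_zero] at hV; exact hT hV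
  refine ⟨V, ?_, hV0, fun W hW => ?_⟩
  · rw [hV, degree_mul, degree_X_sub_C, degree_eq_natDegree hV0]
    exact_mod_cast (by omega : V.natDegree < 1 + V.natDegree)
  · obtain ⟨S, hS⟩ := dvd_iff_isRoot.2 hW
    exact ⟨S, by rw [hS, mul_right_comm, ← hV]⟩

end Kummer

namespace RAM

namespace Decoder

/-! ## Correctness of the arithmetic in the extension field -/

section Roots

variable {F : Type} [Field F] [Fintype F] {K : Type} [Field K] [Algebra F K] {γ : F} {ξ : K}
  {x : List ℕ} {enc : F → ℕ}

/-- The coefficient number `J` of a polynomial over `K` that is stored in `τ`. -/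
def coeffK (ξ : K) (τ : ℕ → F) (J : ℕ) : K :=
  ofCoords ξ (Fintype.card F - 1) fun i => τ (J * (Fintype.card F - 1) + i)

/-- The coordinates of the product of `ξ ^ j` and an element of `K`. -/
def shift (γ : F) (w : ℕ → F) (j i : ℕ) : F :=
  w ((i + (Fintype.card F - 1) - j) % (Fintype.card F - 1)) * if i < j then γ else 1

theorem _root_.IsKummer.ofCoords_mul (hk : IsKummer F γ ξ) (u w : ℕ → F) :
    ofCoords ξ (Fintype.card F - 1) u * ofCoords ξ (Fintype.card F - 1) w =
      ofCoords ξ (Fintype.card F - 1) fun i =>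
        ∑ j ∈ Finset.range (Fintype.card F - 1), u j * shift γ w j i := by
  rw [ofCoords_sum]
  conv_lhs => rw [ofCoords, Finset.sum_mul]
  refine Finset.sum_congr rfl fun j hj => ?_
  rw [ofCoords_smul, smul_mul_assoc, hk.pow_mul_ofCoords (Finset.mem_range.1 hj)]
  rfl

theorem Encodes.coef_eq (h : Encodes x enc γ) (hq : q x = Fintype.card F) {a : List ℕ} {α : ℕ → F}
    {L o i j : ℕ} (ha : Rep enc L a α) (hi : i < Fintype.card F - 1)
    (ho : o + (Fintype.card F - 1) ≤ L) :
    coef x a o i j = enc (shift γ (fun i => α (o + i)) j i) := by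
  rw [coef, hq, ha, sel_ltn, h.g_eq, h.one_eq, shift]
  · split_ifs <;> rw [h.mul_eq]
  · have := Nat.mod_lt (i + (Fintype.card F - 1) - j) (show Fintype.card F - 1 > 0 by omega)
    omega

theorem Encodes.emul_eq (h : Encodes x enc γ) (hq : q x = Fintype.card F) {u T : List ℕ}
    {υ τ : ℕ → F} {L J i : ℕ} (hu : Rep enc (Fintype.card F - 1) u υ) (hT : Rep enc L T τ)
    (hJ : (J + 1) * (Fintype.card F - 1) ≤ L) (hi : i < Fintype.card F - 1) :
    emul x u T J i = enc (∑ j ∈ Finset.range (Fintype.card F - 1),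
      υ j * shift γ (fun i => τ (J * (Fintype.card F - 1) + i)) j i) := by
  rw [Nat.succ_mul] at hJ
  rw [emul, hq]
  refine h.sum_eq fun j hj => ?_
  rw [hu j hj, ← hq, ← h.mul_eq, h.coef_eq hq hT hi (by rwa [hq]), hq]

/-- The solutions of the linear system are the u for which all but the zeroth coordinate of the
product with the leading coefficient vanish, that is, the product is in `F`. The inverse of the
leading coefficient is one, so the search succeeds, and the product is nonzero as `K` is a field.
Inversion in `K` is thus reduced to linear algebra and an inversion in `F`. -/
theorem Encodes.coinv_spec (h : Encodes x enc γ) (hk : IsKummer F γ ξ) (hq : q x = Fintype.card F)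
    {T : List ℕ} {τ : ℕ → F} {L d : ℕ} (hT : Rep enc L T τ)
    (hd : (d + 1) * (Fintype.card F - 1) ≤ L) (h0 : coeffK ξ τ d ≠ 0) :
    ∃ υ s, Rep enc (Fintype.card F - 1) (coinv x T d) υ ∧ s ≠ 0 ∧
      ofCoords ξ (Fintype.card F - 1) υ * coeffK ξ τ d = algebraMap F K s ∧
      emul x (coinv x T d) T d 0 = enc s := by
  have hc : 1 < Fintype.card F := Fintype.one_lt_card
  have hd' := hd
  rw [Nat.succ_mul] at hd'
  set ρ : ℕ → ℕ → F := fun i j =>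
    shift γ (fun i => τ (d * (Fintype.card F - 1) + i)) j (i + 1) with hρ
  have hone : ∀ v : ℕ → F, (∀ i < Fintype.card F - 2, v (i + 1) = 0) →
      ofCoords ξ (Fintype.card F - 1) v = algebraMap F K (v 0) := by
    intro v hv
    rw [ofCoords, show Fintype.card F - 1 = (Fintype.card F - 2) + 1 by omega,
      Finset.sum_range_succ', Finset.sum_eq_zero, zero_add, pow_zero, Algebra.smul_def, mul_one]
    intro i hi
    rw [hv i (Finset.mem_range.1 hi), zero_smul]
  have key := (h.npos_kern (n := Fintype.card F - 1) (R := Fintype.card F - 2)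
    (w := tab (Fintype.card F - 1) fun _ => 1)
    (row := fun i => tab (Fintype.card F - 1) fun j => coef x T (d * (Fintype.card F - 1)) (i + 1) j)
    (ρ := ρ) fun i hi => rep_tab fun j hj => h.coef_eq hq hT (by omega) hd').2
  have hco : coinv x T d = pick x (Fintype.card F - 1) (kern x (Fintype.card F - 1)
      (diag x (Fintype.card F - 1) (tab (Fintype.card F - 1) fun _ => 1)) (Fintype.card F - 2)
      fun i => tab (Fintype.card F - 1) fun j => coef x T (d * (Fintype.card F - 1)) (i + 1) j) := by
    rw [coinv, hq]
  have hcomm : ∀ u : ℕ → F, ∀ i, ∑ j ∈ Finset.range (Fintype.card F - 1), ρ i j * u j =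
      ∑ j ∈ Finset.range (Fintype.card F - 1),
        u j * shift γ (fun i => τ (d * (Fintype.card F - 1) + i)) j (i + 1) :=
    fun u i => Finset.sum_congr rfl fun j _ => mul_comm _ _
  obtain ⟨υ, ⟨⟨i₀, hi₀, hne⟩, -, hker⟩, hrep⟩ := key (by
    obtain ⟨u, hu⟩ := hk.exists_repr (coeffK ξ τ d)⁻¹
    change _ = ofCoords ξ _ u at hu
    refine ⟨u, ?_, fun i hi h1 => by simp [-List.getD_eq_getElem?_getD, getD_tab, hi] at h1, ?_⟩
    · by_contra! hz
      refine inv_ne_zero h0 ?_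
      rw [hu, ofCoords, Finset.sum_eq_zero]
      intro i hi
      rw [hz i (Finset.mem_range.1 hi), zero_smul]
    · intro i hi
      rw [hcomm]
      have h1 : ofCoords ξ (Fintype.card F - 1) (fun i =>
          ∑ j ∈ Finset.range (Fintype.card F - 1),
            u j * shift γ (fun i => τ (d * (Fintype.card F - 1) + i)) j i) =
          ofCoords ξ (Fintype.card F - 1) (fun i => if i = 0 then (1 : F) else 0) := by
        rw [← hk.ofCoords_mul, ← hu, hone (fun i => if i = 0 then (1 : F) else 0) (by simp)]
        simp only [if_true, map_one]
        exact inv_mul_cancel₀ h0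
      simpa using hk.ofCoords_inj h1 (i + 1) (by omega))
  rw [← hco] at hrep
  have hprod := hk.ofCoords_mul υ (fun i => τ (d * (Fintype.card F - 1) + i))
  have hone' := hone (fun i => ∑ j ∈ Finset.range (Fintype.card F - 1),
    υ j * shift γ (fun i => τ (d * (Fintype.card F - 1) + i)) j i)
    fun i hi => by rw [← hcomm, hker i hi]
  refine ⟨υ, _, hrep, ?_, hprod.trans hone', h.emul_eq hq hrep hT hd (by omega)⟩
  intro hs
  rw [hone', hs, map_zero, mul_eq_zero] at hprod
  refine hprod.elim (fun h1 => hne (hk.indep υ h1 i₀ hi₀)) h0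

theorem Encodes.monic_spec (h : Encodes x enc γ) (hk : IsKummer F γ ξ) (hq : q x = Fintype.card F)
    {T : List ℕ} {τ : ℕ → F} {L d : ℕ} (hT : Rep enc L T τ)
    (hd : (d + 1) * (Fintype.card F - 1) ≤ L) (h0 : coeffK ξ τ d ≠ 0) :
    ∃ μ, Rep enc (d * (Fintype.card F - 1)) (monic x T d) μ ∧
      ∀ J < d, coeffK ξ μ J = (coeffK ξ τ d)⁻¹ * coeffK ξ τ J := by
  have hc : 1 < Fintype.card F := Fintype.one_lt_card
  obtain ⟨υ, s, h1, h2, h3, h4⟩ := h.coinv_spec hk hq hT hd h0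
  refine ⟨fun t => s⁻¹ * ∑ j ∈ Finset.range (Fintype.card F - 1), υ j *
    shift γ (fun i => τ (t / (Fintype.card F - 1) * (Fintype.card F - 1) + i)) j
      (t % (Fintype.card F - 1)), ?_, fun J hJ => ?_⟩
  · rw [monic, hq]
    refine rep_tab fun t ht => ?_
    have ht' : t / (Fintype.card F - 1) < d := Nat.div_lt_of_lt_mul (by rwa [mul_comm])
    rw [h4, h.inv_eq h2, h.emul_eq hq h1 hT _ (Nat.mod_lt _ (by omega)), h.mul_eq]
    exact (Nat.mul_le_mul_right _ (by omega)).trans hd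
  · have : ofCoords ξ (Fintype.card F - 1) υ = algebraMap F K s * (coeffK ξ τ d)⁻¹ := by
      rw [← h3, mul_inv_cancel_right₀ h0]
    change ofCoords ξ _ _ = _
    rw [ofCoords_congr (w := fun i => s⁻¹ *
      ∑ j ∈ Finset.range (Fintype.card F - 1),
        υ j * shift γ (fun i => τ (J * (Fintype.card F - 1) + i)) j i),
      ofCoords_smul, ← hk.ofCoords_mul, this, Algebra.smul_def, map_inv₀, ← coeffK]
    · have : algebraMap F K s ≠ 0 := by simpa using h2
      field_simp
    · intro i hi
      dsimp only
      rw [div_of_lt _ hi, mod_of_lt _ hi]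

/-- The polynomial over `K` whose coefficients below `n` are stored in `τ`. -/
noncomputable def polyK (ξ : K) (τ : ℕ → F) (n : ℕ) : K[X] :=
  ∑ J ∈ Finset.range n, C (coeffK ξ τ J) * X ^ J

theorem coeff_polyK (τ : ℕ → F) (n J : ℕ) :
    (polyK ξ τ n).coeff J = if J < n then coeffK ξ τ J else 0 := by
  simp [polyK, finsetSum_coeff, coeff_C_mul, coeff_X_pow]

theorem degree_polyK_lt (τ : ℕ → F) (n : ℕ) : (polyK ξ τ n).degree < n := by
  rw [degree_lt_iff_coeff_zero]
  intro J hJ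
  rw [coeff_polyK, if_neg (by omega)]

theorem _root_.IsKummer.exists_coeffK (hk : IsKummer F γ ξ) (f : ℕ → K) :
    ∃ v : ℕ → F, ∀ J, coeffK ξ v J = f J := by
  have hc : 1 < Fintype.card F := Fintype.one_lt_card
  choose w hw using fun J => hk.exists_repr (f J)
  refine ⟨fun t => w (t / (Fintype.card F - 1)) (t % (Fintype.card F - 1)), fun J => ?_⟩
  rw [hw, coeffK]
  refine ofCoords_congr fun i hi => ?_
  rw [div_of_lt _ hi, mod_of_lt _ hi]

theorem _root_.IsKummer.exists_polyK (hk : IsKummer F γ ξ) {V : K[X]} {n : ℕ} (hV : V.degree < n) :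
    ∃ v : ℕ → F, polyK ξ v n = V := by
  obtain ⟨v, hv⟩ := hk.exists_coeffK V.coeff
  refine ⟨v, Polynomial.ext fun J => ?_⟩
  rw [coeff_polyK, hv]
  split_ifs with hJ
  · rfl
  · exact ((degree_lt_iff_coeff_zero _ _).1 hV J (by omega)).symm

theorem _root_.IsKummer.eq_zero_of_polyK (hk : IsKummer F γ ξ) {v : ℕ → F} {n : ℕ}
    (hv : polyK ξ v n = 0) : ∀ t < n * (Fintype.card F - 1), v t = 0 := by
  intro t ht
  have hpos : 0 < Fintype.card F - 1 := by
    by_contra! h0; rw [Nat.le_zero.1 h0] at ht; omega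
  have h1 : t / (Fintype.card F - 1) < n := Nat.div_lt_of_lt_mul (by rwa [mul_comm])
  have h2 := congrArg (fun p => coeff p (t / (Fintype.card F - 1))) hv
  simp only [coeff_polyK, if_pos h1, coeff_zero] at h2
  have h3 := hk.indep _ h2 _ (Nat.mod_lt t hpos)
  rwa [Nat.div_add_mod'] at h3

theorem polyK_congr {v w : ℕ → F} {n : ℕ} (h : ∀ t < n * (Fintype.card F - 1), v t = w t) :
    polyK ξ v n = polyK ξ w n :=
  Finset.sum_congr rfl fun J hJ => by
    rw [coeffK, ofCoords_congr fun i hi => h _ (add_lt_mul (Finset.mem_range.1 hJ) hi)]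
    rfl

theorem sum_range_mul {M : Type} [AddCommMonoid M] (d n : ℕ) (f : ℕ → M) :
    ∑ t ∈ Finset.range (d * n), f t =
      ∑ J ∈ Finset.range d, ∑ i ∈ Finset.range n, f (J * n + i) := by
  induction d with
  | zero => simp
  | succ d ih => rw [Nat.succ_mul, Finset.sum_range_add, ih, Finset.sum_range_succ]

/-- The monic polynomial of degree `d` whose lower coefficients are stored in `μ`. -/
noncomputable def monicK (ξ : K) (μ : ℕ → F) (d : ℕ) : K[X] := X ^ d + polyK ξ μ d

theorem monicK_monic (μ : ℕ → F) (d : ℕ) : (monicK ξ μ d).Monic :=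
  monic_X_pow_add (degree_polyK_lt μ d)

theorem degree_monicK (μ : ℕ → F) (d : ℕ) : (monicK ξ μ d).degree = d :=
  by rw [monicK, degree_add_eq_left_of_degree_lt] <;> rw [degree_X_pow]; exact degree_polyK_lt μ d

/-- The residue class that is stored in `v`. -/
noncomputable def evalK (ξ : K) (μ : ℕ → F) (d : ℕ) (v : ℕ → F) : AdjoinRoot (monicK ξ μ d) :=
  AdjoinRoot.mk _ (polyK ξ v d)

theorem _root_.IsKummer.eq_zero_of_evalK (hk : IsKummer F γ ξ) {μ v : ℕ → F} {d : ℕ}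
    (hv : evalK ξ μ d v = 0) : ∀ t < d * (Fintype.card F - 1), v t = 0 := by
  rw [evalK, AdjoinRoot.mk_eq_zero] at hv
  refine hk.eq_zero_of_polyK (eq_zero_of_dvd_of_degree_lt hv ?_)
  rw [degree_monicK]
  exact degree_polyK_lt v d

/-- Multiplication by Y shifts the coefficients up by one, and the overflow at Y^d is replaced by
minus the lower coefficients of the monic modulus. Each coefficient is itself a vector of q - 1
coordinates over `F`. -/
theorem Encodes.companion_spec (h : Encodes x enc γ) (hk : IsKummer F γ ξ)
    (hq : q x = Fintype.card F) {T : List ℕ} {μ : ℕ → F} {d : ℕ}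
    (hT : Rep enc (d * (Fintype.card F - 1)) T μ) :
    ∃ a, Rep enc (d * (Fintype.card F - 1) * (d * (Fintype.card F - 1))) (companion x T d) a ∧
      Mult (d * (Fintype.card F - 1)) (evalK ξ μ d) a (AdjoinRoot.root (monicK ξ μ d)) := by
  rw [companion, hq]
  set N := Fintype.card F - 1 with hN
  let a : ℕ → ℕ → ℕ → ℕ → F := fun J i J' i' => (if J = J' + 1 ∧ i = i' then 1 else 0) +
    if J' + 1 = d then -shift γ (fun i => μ (J * N + i)) i' i else 0
  refine ⟨fun t => a (t / (d * N) / N) (t / (d * N) % N) (t % (d * N) / N) (t % (d * N) % N),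
    rep_tab fun t ht => ?_, fun v => ?_⟩
  · have hdN : 0 < d * N := by
      by_contra! h0; rw [Nat.le_zero.1 h0] at ht; omega
    have hN0 : 0 < N := Nat.pos_of_mul_pos_left hdN
    have h1 : t / (d * N) < d * N := Nat.div_lt_of_lt_mul ht
    have h2 : t / (d * N) / N < d := Nat.div_lt_of_lt_mul (by rwa [mul_comm N d])
    have h3 : t / (d * N) / N * N + N ≤ d * N := by
      rw [← Nat.succ_mul]; exact Nat.mul_le_mul_right _ h2
    rw [h.coef_eq hq hT (Nat.mod_lt _ hN0) h3, h.neg_eq, h.one_eq, h.zero_eq, sel_eqn,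
      ← h.add_eq]
    congr 1
    · unfold sel eqn
      split_ifs <;> simp_all
    · split_ifs <;> rfl
  · have hact : ∀ J < d, ∀ i < N, act (d * N) (fun t =>
        a (t / (d * N) / N) (t / (d * N) % N) (t % (d * N) / N) (t % (d * N) % N)) v (J * N + i) =
        (if J = 0 then 0 else v ((J - 1) * N + i)) -
          ∑ j ∈ Finset.range N, v ((d - 1) * N + j) * shift γ (fun i => μ (J * N + i)) j i := by
      intro J hJ i hi
      have e1 : ∀ j ∈ Finset.range (d * N), a (((J * N + i) * (d * N) + j) / (d * N) / N)
          (((J * N + i) * (d * N) + j) / (d * N) % N) (((J * N + i) * (d * N) + j) % (d * N) / N)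
          (((J * N + i) * (d * N) + j) % (d * N) % N) * v j = a J i (j / N) (j % N) * v j := by
        intro j hj
        rw [div_of_lt _ (Finset.mem_range.1 hj), mod_of_lt _ (Finset.mem_range.1 hj), div_of_lt _ hi,
          mod_of_lt _ hi]
      rw [act, Finset.sum_congr rfl e1, sum_range_mul]
      have e2 : ∀ J' ∈ Finset.range d, ∑ i' ∈ Finset.range N,
          a J i ((J' * N + i') / N) ((J' * N + i') % N) * v (J' * N + i') =
          (if J = J' + 1 then v (J' * N + i) else 0) - if J' = d - 1 then
            ∑ j ∈ Finset.range N, v ((d - 1) * N + j) * shift γ (fun i => μ (J * N + i)) j i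
            else 0 := by
        intro J' hJ'
        have hJ' := Finset.mem_range.1 hJ'
        have e3 : ∀ i' ∈ Finset.range N,
            a J i ((J' * N + i') / N) ((J' * N + i') % N) * v (J' * N + i') =
            (if i' = i then if J = J' + 1 then v (J' * N + i) else 0 else 0) -
              if J' = d - 1 then v ((d - 1) * N + i') * shift γ (fun i => μ (J * N + i)) i' i
              else 0 := by
          intro i' hi'
          rw [div_of_lt _ (Finset.mem_range.1 hi'), mod_of_lt _ (Finset.mem_range.1 hi')]
          by_cases c1 : J' = d - 1
          · have c2 : J' + 1 = d := by omega
            rw [show d - 1 = J' by omega]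
            simp only [a, if_pos c2, if_true]
            rw [if_neg (show ¬ (J = J' + 1 ∧ i = i') by omega), if_neg (show ¬ J = J' + 1 by omega)]
            simp [mul_comm]
          · have c2 : J' + 1 ≠ d := by omega
            simp only [a, if_neg c2, if_neg c1]
            by_cases c3 : i' = i
            · subst c3; simp
            · simp [c3, Ne.symm c3]
        rw [Finset.sum_congr rfl e3, Finset.sum_sub_distrib, Finset.sum_ite_eq',
          if_pos (Finset.mem_range.2 hi)]
        congr 1
        split_ifs <;> simp
      rw [Finset.sum_congr rfl e2, Finset.sum_sub_distrib, Finset.sum_ite_eq',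
        if_pos (Finset.mem_range.2 (by omega))]
      congr 1
      cases J with
      | zero => simp
      | succ J =>
        rw [Finset.sum_eq_single J]
        · simp
        · intro b _ hb; rw [if_neg (by omega)]
        · intro hJ'; exact absurd (Finset.mem_range.2 (by omega)) hJ'
    rw [evalK, evalK, ← AdjoinRoot.mk_X, ← map_mul, ← sub_eq_zero, ← map_sub,
      AdjoinRoot.mk_eq_zero]
    rcases Nat.eq_zero_or_pos d with rfl | hd
    · simp [polyK]
    -- The matrix product and Y times the polynomial differ by the multiple of the modulus that
    -- removes the term of degree `d`; `d = 0` is treated apart because of the index `d - 1`.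
    refine ⟨-C (coeffK ξ v (d - 1)), ?_⟩
    have hco : ∀ J < d, coeffK ξ (act (d * N) (fun t =>
        a (t / (d * N) / N) (t / (d * N) % N) (t % (d * N) / N) (t % (d * N) % N)) v) J =
        (if J = 0 then 0 else coeffK ξ v (J - 1)) - coeffK ξ v (d - 1) * coeffK ξ μ J := by
      intro J hJ
      rw [coeffK, ofCoords_congr fun i hi => hact J hJ i hi, ofCoords_sub, ← hk.ofCoords_mul]
      congr 1
      split_ifs
      · simp [ofCoords]
      · rfl
    refine Polynomial.ext fun J => ?_
    rw [mul_neg, coeff_neg, coeff_mul_C, monicK, coeff_add, coeff_X_pow, coeff_sub, coeff_polyK,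
      coeff_polyK]
    cases J with
    | zero =>
      rw [coeff_X_mul_zero, if_pos hd, if_pos hd, if_neg (by omega), hco 0 hd, if_pos rfl]
      ring
    | succ J =>
      rw [coeff_X_mul, coeff_polyK]
      rcases lt_trichotomy (J + 1) d with c | c | c
      · rw [if_pos c, if_pos c, if_neg c.ne, if_pos (show J < d by omega), hco _ c,
          if_neg (Nat.succ_ne_zero J), Nat.add_sub_cancel]
        ring
      · rw [if_neg c.not_lt, if_neg c.not_lt, if_pos c, if_pos (show J < d by omega), ← c,
          Nat.add_sub_cancel]
        ring
      · rw [if_neg c.not_gt, if_neg c.not_gt, if_neg c.ne', if_neg (show ¬ J < d by omega)]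
        ring

end Roots

end Decoder

end RAM

namespace RAM

namespace Decoder

theorem sel_eqn_mul_eqn {α : Type} (a b c d : ℕ) (u v : α) :
    sel (eqn a b * eqn c d) u v = if a = b ∧ c = d then u else v := by
  unfold sel eqn
  split_ifs <;> simp_all

/-! ### Testing whether a prefix extends to a root -/

section Prefixes

variable {F : Type} [Field F] [Fintype F] {K : Type} [Field K] [Algebra F K] {γ : F} {ξ : K}
  {x : List ℕ} {enc : F → ℕ}

theorem polyK_add (v w : ℕ → F) (n : ℕ) :
    polyK ξ (fun t => v t + w t) n = polyK ξ v n + polyK ξ w n := by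
  simp [polyK, coeffK, ofCoords, add_smul, Finset.sum_add_distrib, add_mul]

theorem polyK_smul (a : F) (v : ℕ → F) (n : ℕ) :
    polyK ξ (fun t => a * v t) n = C (algebraMap F K a) * polyK ξ v n := by
  simp only [polyK, Finset.mul_sum]
  refine Finset.sum_congr rfl fun J _ => ?_
  rw [coeffK, ofCoords_smul, Algebra.smul_def, C_mul, mul_assoc]
  rfl

theorem polyK_sum {ι : Type} (s : Finset ι) (v : ι → ℕ → F) (n : ℕ) :
    polyK ξ (fun t => ∑ i ∈ s, v i t) n = ∑ i ∈ s, polyK ξ (v i) n := by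
  classical
  induction s using Finset.induction_on with
  | empty => simp [polyK, coeffK, ofCoords]
  | insert i s hi ih => simp only [Finset.sum_insert hi, polyK_add, ih]

/-- Multiplication by `ξ ^ j` in coordinates. -/
def shiftAll (γ : F) (v : ℕ → F) (j t : ℕ) : F :=
  shift γ (fun i => v (t / (Fintype.card F - 1) * (Fintype.card F - 1) + i)) j
    (t % (Fintype.card F - 1))

theorem _root_.IsKummer.polyK_shiftAll (hk : IsKummer F γ ξ) {j : ℕ} (hj : j < Fintype.card F - 1)
    (v : ℕ → F) (n : ℕ) : polyK ξ (shiftAll γ v j) n = C (ξ ^ j) * polyK ξ v n := by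
  simp only [polyK, Finset.mul_sum]
  refine Finset.sum_congr rfl fun J _ => ?_
  rw [← mul_assoc, ← C_mul, coeffK, coeffK, hk.pow_mul_ofCoords hj]
  congr 2
  refine ofCoords_congr fun i hi => ?_
  rw [shiftAll, div_of_lt _ hi, mod_of_lt _ hi]
  rfl

/-- Modulo the monic polynomial, Y^(q^u) acts through the Frobenius powers of the companion matrix,
and ξ^j through a cyclic shift of coordinates. So the rows compute the coordinates of the residue
class of the product, and a class is zero exactly if its coordinates are. -/
theorem Encodes.prow_spec (h : Encodes x enc γ) (hk : IsKummer F γ ξ) (hq : q x = Fintype.card F)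
    {A c : List ℕ} {μ : ℕ → F} {d r : ℕ} {a : ℕ → F} {w : ℕ → F}
    (hA : Rep enc (d * (Fintype.card F - 1) * (d * (Fintype.card F - 1))) A a)
    (ha : Mult (d * (Fintype.card F - 1)) (evalK ξ μ d) a (AdjoinRoot.root (monicK ξ μ d)))
    (hc : ∀ j < r, c.getD j 0 = enc (w j)) (hr : r ≤ Fintype.card F - 1) :
    ∃ ρ : ℕ → ℕ → F, (∀ i < r * (d * (Fintype.card F - 1)),
      Rep enc (d * (Fintype.card F - 1)) (prow x (d * (Fintype.card F - 1)) A c i) (ρ i)) ∧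
      ∀ v : ℕ → F, (∀ i < r * (d * (Fintype.card F - 1)),
          ∑ t ∈ Finset.range (d * (Fintype.card F - 1)), ρ i t * v t = 0) ↔
        ∀ j < r, monicK ξ μ d ∣ coordPoly γ ξ j (w j) * polyK ξ v d := by
  have hev : ∀ v w : ℕ → F, (∀ t < d * (Fintype.card F - 1), v t = w t) →
      evalK ξ μ d v = evalK ξ μ d w := fun v w hvw => by rw [evalK, polyK_congr hvw]; rfl
  choose P hP hPm using h.frob_mult hev hA ha
  have hN0 : 0 < Fintype.card F - 1 := by have := Fintype.one_lt_card (α := F); omega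
  set N := Fintype.card F - 1 with hN
  set n := d * N with hn
  refine ⟨fun i t => ∑ u ∈ Finset.range N, γ ^ (i / n * (N - u)) * P u (i % n * n + t) +
    if i % n / N = t / N ∧ t % N = (i % n % N + N - i / n) % N then
      w (i / n) * (if i % n % N < i / n then γ else 1) else 0, fun i hi => ?_, fun v => ?_⟩
  · rw [prow, hq, ← hN]
    refine rep_tab fun t ht => ?_
    have hin : i / n < r := Nat.div_lt_of_lt_mul (by rwa [mul_comm])
    have him : i % n < n := Nat.mod_lt _ (by omega)
    rw [h.sum_eq (v := fun u => γ ^ (i / n * (N - u)) * P u (i % n * n + t)) fun u hu => by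
      rw [h.g_eq, h.pow_eq, hP _ _ (add_lt_mul him ht), h.mul_eq],
      hc _ hin, h.g_eq, h.one_eq, h.zero_eq, ← h.add_eq]
    congr 1
    rw [sel_ltn, sel_eqn_mul_eqn]
    by_cases h1 : i % n / N = t / N ∧ t % N = (i % n % N + N - i / n) % N
    · rw [if_pos h1, if_pos h1, ← h.mul_eq]
      congr 1
      split_ifs <;> rfl
    · rw [if_neg h1, if_neg h1]
  · have hrow : ∀ j < r, ∀ l < n, ∑ t ∈ Finset.range n,
        (∑ u ∈ Finset.range N, γ ^ ((j * n + l) / n * (N - u)) * P u ((j * n + l) % n * n + t) +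
          if (j * n + l) % n / N = t / N ∧
            t % N = ((j * n + l) % n % N + N - (j * n + l) / n) % N then
          w ((j * n + l) / n) * (if (j * n + l) % n % N < (j * n + l) / n then γ else 1) else 0) *
            v t =
        ∑ u ∈ Finset.range N, γ ^ (j * (N - u)) * act n (P u) v l + w j * shiftAll γ v j l := by
      intro j hj l hl
      rw [div_of_lt _ hl, mod_of_lt _ hl]
      simp only [add_mul, Finset.sum_add_distrib]
      congr 1
      · simp only [act, Finset.mul_sum, Finset.sum_mul]
        rw [Finset.sum_comm]
        exact Finset.sum_congr rfl fun u _ => Finset.sum_congr rfl fun t _ => by ring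
      · set s := (l % N + N - j) % N with hs
        have hsN : s < N := Nat.mod_lt _ hN0
        have hlN : l / N < d := Nat.div_lt_of_lt_mul (by rwa [mul_comm N d])
        rw [Finset.sum_eq_single (l / N * N + s)]
        · rw [div_of_lt _ hsN, mod_of_lt _ hsN, if_pos ⟨rfl, rfl⟩, shiftAll, shift]
          ring
        · intro t _ hne
          rw [if_neg, zero_mul]
          rintro ⟨h1, h2⟩
          apply hne
          rw [h1, ← h2, Nat.div_add_mod']
        · intro hnot
          exact absurd (Finset.mem_range.2 (add_lt_mul hlN hsN)) hnot
    have hpoly : ∀ j < r, evalK ξ μ d (fun l =>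
        ∑ u ∈ Finset.range N, γ ^ (j * (N - u)) * act n (P u) v l + w j * shiftAll γ v j l) =
        AdjoinRoot.mk _ (coordPoly γ ξ j (w j) * polyK ξ v d) := by
      intro j hj
      rw [evalK, polyK_add, polyK_sum, polyK_smul, hk.polyK_shiftAll (by omega), map_add, map_sum,
        coordPoly, add_mul, Finset.sum_mul, map_add, map_sum]
      congr 1
      · refine Finset.sum_congr rfl fun u _ => ?_
        rw [polyK_smul, map_mul]
        have := hPm u v
        rw [evalK, evalK, hq] at this
        rw [this, ← AdjoinRoot.mk_X, ← map_pow, ← map_mul, ← map_mul, mul_assoc]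
      · rw [← mul_assoc, ← C_mul, ← Algebra.smul_def]
    constructor
    · intro h0 j hj
      rw [← AdjoinRoot.mk_eq_zero, ← hpoly j hj, evalK, AdjoinRoot.mk_eq_zero,
        polyK_congr (w := fun _ => 0)]
      · simp [polyK, coeffK, ofCoords]
      · intro l hl
        rw [← hrow j hj l hl]
        exact h0 _ (add_lt_mul hj hl)
    · intro h0 i hi
      have hn0 : 0 < n := by
        by_contra! hz; rw [Nat.le_zero.1 hz] at hi; omega
      have hin : i / n < r := Nat.div_lt_of_lt_mul (by rwa [mul_comm])
      have him : i % n < n := Nat.mod_lt _ hn0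
      have h1 := hrow _ hin _ him
      rw [Nat.div_add_mod'] at h1
      rw [h1]
      refine hk.eq_zero_of_evalK (d := d) (μ := μ) (v := fun l => ∑ u ∈ Finset.range N,
        γ ^ (i / n * (N - u)) * act n (P u) v l + w (i / n) * shiftAll γ v (i / n) l) ?_ _ him
      rw [hpoly _ hin, AdjoinRoot.mk_eq_zero]
      exact h0 _ hin

/-- A solution of the linear system is a residue annihilated by the coordinate polynomials, which
yields a root by `exists_root_of_dvd`; `exists_dvd_of_root` is the converse. The prefix has to be
nonempty so that the coordinate polynomial for j = 0, the one known to split, takes part. -/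
theorem Encodes.viable_iff (h : Encodes x enc γ) (hk : IsKummer F γ ξ) (hq : q x = Fintype.card F)
    {A c : List ℕ} {μ : ℕ → F} {d r : ℕ} {a : ℕ → F} {w : ℕ → F}
    (hA : Rep enc (d * (Fintype.card F - 1) * (d * (Fintype.card F - 1))) A a)
    (ha : Mult (d * (Fintype.card F - 1)) (evalK ξ μ d) a (AdjoinRoot.root (monicK ξ μ d)))
    (hc : ∀ j < r, c.getD j 0 = enc (w j)) (hr : r ≤ Fintype.card F - 1) (hr0 : 0 < r) :
    viable x (d * (Fintype.card F - 1)) A c r ≠ 0 ↔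
      ∃ u : ℕ → F, (monicK ξ μ d).eval (ofCoords ξ (Fintype.card F - 1) u) = 0 ∧
        ∀ j < r, u j = w j := by
  obtain ⟨ρ, h1, h2⟩ := h.prow_spec hk hq hA ha hc hr
  rw [viable, ltn_ne_zero, (h.npos_kern h1).1]
  constructor
  · rintro ⟨v, ⟨t, ht, hvt⟩, -, h3⟩
    obtain ⟨φ, hφ, hφ'⟩ := hk.exists_root_of_dvd hr0 (monicK_monic (ξ := ξ) μ d).ne_zero
      (V := polyK ξ v d) (fun hdvd => hvt (hk.eq_zero_of_evalK (μ := μ)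
        (by rwa [evalK, AdjoinRoot.mk_eq_zero]) t ht)) ((h2 v).1 h3)
    obtain ⟨u, rfl⟩ := hk.exists_repr φ
    exact ⟨u, hφ, fun j hj => ((hk.eval_coordPoly (by omega) _ u).1 (hφ' j hj)).symm⟩
  · rintro ⟨u, hu, huw⟩
    obtain ⟨V, hV, hV0, hdvd⟩ := exists_dvd_of_root (monicK_monic (ξ := ξ) μ d).ne_zero hu
    rw [degree_monicK] at hV
    obtain ⟨v, rfl⟩ := hk.exists_polyK hV
    refine ⟨v, ?_, fun i hi h0 => ?_, (h2 v).2 fun j hj => hdvd _ ?_⟩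
    · by_contra! hz
      refine hV0 ?_
      rw [polyK_congr (w := fun _ => 0) hz]
      simp [polyK, coeffK, ofCoords]
    · simp [-List.getD_eq_getElem?_getD, getD_tab, hi] at h0
    · exact (hk.eval_coordPoly (by omega) _ u).2 (huw j hj).symm

end Prefixes

end Decoder

end RAM

namespace RAM

namespace Decoder

theorem find_lt_iff {n : ℕ} {f : ℕ → ℕ} : find n f < n ↔ ∃ i < n, f i ≠ 0 :=
  ⟨fun h => ⟨_, h, (find_spec n f).2.2 h⟩, fun ⟨_, hi, h⟩ => find_lt hi h⟩

/-! ## Correctness of the root finding -/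

theorem length_flatten_of_forall {n : ℕ} {LL : List (List ℕ)} (h : ∀ p ∈ LL, p.length = n) :
    LL.flatten.length = LL.length * n := by
  induction LL with
  | nil => simp
  | cons p LL ih =>
    rw [List.flatten_cons, List.length_append, ih fun p hp => h p (List.mem_cons_of_mem _ hp),
      h p List.mem_cons_self, List.length_cons]
    ring

theorem getD_flatten {n : ℕ} {LL : List (List ℕ)} (h : ∀ p ∈ LL, p.length = n) (t : ℕ) {j : ℕ}
    (hj : j < n) : LL.flatten.getD (t * n + j) 0 = (LL.getD t []).getD j 0 := by
  induction LL generalizing t with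
  | nil => simp
  | cons p LL ih =>
    have hp := h p List.mem_cons_self
    rw [List.flatten_cons]
    cases t with
    | zero =>
      rw [zero_mul, zero_add, List.getD_append _ _ _ _ (by omega)]
      simp
    | succ t =>
      rw [List.getD_append_right _ _ _ _ (by rw [hp]; nlinarith), hp,
        show (t + 1) * n + j - n = t * n + j by rw [Nat.succ_mul]; omega,
        ih (fun p hp => h p (List.mem_cons_of_mem _ hp))]
      simp

theorem clip_eq_self {n b : ℕ} {l : List ℕ} (hl : l.length ≤ n) (hb : ∀ a ∈ l, a ≤ b) :
    clip n b l = l := by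
  rw [clip, sel_ltn, if_neg (by omega)]
  conv_rhs => rw [← tab_getD l]
  refine tab_congr fun i hi => Nat.mod_eq_of_lt (Nat.lt_succ_of_le ?_)
  rw [List.getD_eq_getElem _ _ hi]
  exact hb _ (List.getElem_mem hi)

theorem flatMap_sel {α : Type} (l : List α) (c : α → ℕ) (f : α → List ℕ) :
    l.flatMap (fun t => sel (c t) (f t) []) = ((l.filter fun t => c t ≠ 0).map f).flatten := by
  induction l with
  | nil => rfl
  | cons a l ih =>
    rw [List.flatMap_cons, ih, List.filter_cons]
    by_cases h : c a = 0 <;> simp [h, sel]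

/-! ### The search through the tree of prefixes -/

section Level

variable {F : Type} [Field F] {γ : F} {x : List ℕ} {enc : F → ℕ}

/-- The list of the first `i` entries of `w`, filled up with zeros to length `n`. -/
def prefixList (n : ℕ) (enc : F → ℕ) (i : ℕ) (w : ℕ → F) : List ℕ :=
  tab n fun j => if j < i then enc (w j) else 0

/-- Every prefix of a solution extends a shorter prefix of the same solution, so none is lost by
keeping only viable ones. The list of length zero is not tested, whence the condition `0 < i`. By
`hZ`, at most q² distinct lists come from solutions, so the clipping is the identity. -/
theorem Encodes.level_spec (h : Encodes x enc γ) {n i : ℕ} {A : List ℕ} {Z : (ℕ → F) → Prop}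
    (hv : ∀ (c : List ℕ) (w : ℕ → F) (r : ℕ), 0 < r → r ≤ k x + 1 →
      (∀ j < r, c.getD j 0 = enc (w j)) →
      (viable x n A c r ≠ 0 ↔ ∃ u, Z u ∧ ∀ j < r, u j = w j))
    (hZ : ∀ (LL : List (List ℕ)) (f : (ℕ → F) → List ℕ), LL.Nodup →
      (∀ w w', (∀ j < k x + 1, w j = w' j) → f w = f w') →
      (∀ p ∈ LL, ∃ w, Z w ∧ p = f w) → LL.length ≤ q x * q x) (hi : i ≤ k x + 1) :
    ∃ LL : List (List ℕ), level x n A i = LL.flatten ∧ LL.Nodup ∧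
      ∀ p, p ∈ LL ↔ ∃ w, (0 < i → Z w) ∧ p = prefixList (k x + 1) enc i w := by
  induction i with
  | zero =>
    refine ⟨[tab (k x + 1) fun _ => 0], by simp [level], by simp, fun p => ?_⟩
    simp [prefixList]
  | succ i ih =>
    obtain ⟨LL, h1, h2, h3⟩ := ih (by omega)
    have hlen : ∀ p ∈ LL, p.length = k x + 1 := by
      intro p hp
      obtain ⟨w, -, rfl⟩ := (h3 p).1 hp
      exact length_tab _ _
    have hq0 : 0 < q x := (Nat.zero_le _).trans_lt (h.lt 0)
    set E : ℕ → List ℕ := ext x (level x n A i) i with hE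
    have hext : ∀ t, ∀ j < k x + 1, (E t).getD j 0 =
        if j = i then t % q x else (LL.getD (t / q x) []).getD j 0 := by
      intro t j hj
      rw [hE, ext, getD_tab, if_pos hj, sel_eqn, h1, getD_flatten hlen _ hj]
    have hpre : ∀ t s w c, t / q x = s → t % q x = enc c → LL.getD s [] =
        prefixList (k x + 1) enc i w →
        E t = prefixList (k x + 1) enc (i + 1) (Function.update w i c) := by
      intro t s w c hts htc hs
      rw [hE, ext]
      refine tab_congr fun j hj => ?_
      have := hext t j hj
      rw [hE, ext, getD_tab, if_pos hj] at this
      rw [this, hts, hs, prefixList, getD_tab, if_pos hj]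
      rcases lt_trichotomy j i with c | c | c
      · rw [if_neg c.ne, if_pos c, if_pos (by omega), Function.update_of_ne c.ne]
      · rw [if_pos c, if_pos (by omega), c, Function.update_self, htc]
      · rw [if_neg c.ne', if_neg (by omega), if_neg (by omega)]
    have hvia : ∀ t w, E t = prefixList (k x + 1) enc (i + 1) w →
        (viable x n A (E t) (i + 1) ≠ 0 ↔ ∃ u, Z u ∧ ∀ j < i + 1, u j = w j) := by
      intro t w ht
      refine hv _ w _ (by omega) hi fun j hj => ?_
      rw [ht, prefixList, getD_tab, if_pos (by omega), if_pos hj]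
    set c : ℕ → ℕ := fun t => viable x n A (E t) (i + 1) with hc
    set LL' := ((List.range (LL.length * q x)).filter fun t => c t ≠ 0).map E with hLL'
    have hmem : ∀ p, p ∈ LL' ↔ ∃ w, (0 < i + 1 → Z w) ∧ p = prefixList (k x + 1) enc (i + 1) w := by
      intro p
      simp only [hLL', List.mem_map, List.mem_filter, List.mem_range, decide_eq_true_eq]
      constructor
      · rintro ⟨t, ⟨ht, hct⟩, rfl⟩
        have ht' : t / q x < LL.length := Nat.div_lt_of_lt_mul (by rwa [mul_comm])
        obtain ⟨w, -, hw⟩ := (h3 _).1 (List.getElem_mem ht')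
        rw [← List.getD_eq_getElem _ [] ht'] at hw
        obtain ⟨a, ha⟩ := h.surj (t % q x) (Nat.mod_lt _ hq0)
        have hp := hpre t _ w a rfl ha.symm hw
        obtain ⟨u, hu, huw⟩ := (hvia t _ hp).1 hct
        refine ⟨u, fun _ => hu, ?_⟩
        rw [hp]
        refine tab_congr fun j _ => ?_
        split_ifs with hj
        · rw [huw j hj]
        · rfl
      · rintro ⟨u, hu, rfl⟩
        obtain ⟨s, hs, hs'⟩ := List.mem_iff_getElem.1 ((h3 _).2 ⟨u, fun _ => hu (by omega), rfl⟩)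
        rw [← List.getD_eq_getElem _ [] hs] at hs'
        have hp := hpre (s * q x + enc (u i)) s u (u i) (div_of_lt _ (h.lt _)) (mod_of_lt _ (h.lt _)) hs'
        rw [Function.update_eq_self] at hp
        exact ⟨s * q x + enc (u i), ⟨add_lt_mul hs (h.lt _),
          (hvia _ _ hp).2 ⟨u, hu (by omega), fun _ _ => rfl⟩⟩, hp⟩
    have hnd : LL'.Nodup := by
      rw [hLL']
      refine List.Nodup.map_on ?_ (List.nodup_range.filter _)
      intro t ht t' ht' htt
      simp only [List.mem_filter, List.mem_range] at ht ht'
      have hs : t / q x < LL.length := Nat.div_lt_of_lt_mul (by rw [mul_comm]; exact ht.1)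
      have hs' : t' / q x < LL.length := Nat.div_lt_of_lt_mul (by rw [mul_comm]; exact ht'.1)
      have e1 : t % q x = t' % q x := by
        have := congrArg (fun l : List ℕ => l.getD i 0) htt
        simpa only [hext _ i (show i < k x + 1 by omega), if_true] using this
      have e2 : LL[t / q x] = LL[t' / q x] := by
        obtain ⟨w, -, hw⟩ := (h3 _).1 (List.getElem_mem hs)
        obtain ⟨w', -, hw'⟩ := (h3 _).1 (List.getElem_mem hs')
        rw [hw, hw']
        refine tab_congr fun j hj => ?_
        rcases eq_or_ne j i with rfl | hji
        · simp
        · have := congrArg (fun l : List ℕ => l.getD j 0) htt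
          simp only [hext _ j hj, if_neg hji, List.getD_eq_getElem _ _ hs,
            List.getD_eq_getElem _ _ hs', hw, hw', prefixList, getD_tab, if_pos hj] at this
          exact this
      rw [h2.getElem_inj_iff] at e2
      rw [← Nat.div_add_mod t (q x), ← Nat.div_add_mod t' (q x), e1, e2]
    refine ⟨LL', ?_, hnd, hmem⟩
    have hlen' : ∀ p ∈ LL', p.length = k x + 1 := by
      intro p hp
      obtain ⟨w, -, rfl⟩ := (hmem p).1 hp
      exact length_tab _ _
    have hstep : level x n A (i + 1) = clip (q x * q x * (k x + 1)) (q x) LL'.flatten := by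
      rw [hLL', ← flatMap_sel, hc, hE]
      rw [level, loop_succ, ← level, h1, length_flatten_of_forall hlen,
        Nat.mul_div_cancel _ (Nat.succ_pos _)]
    rw [hstep, clip_eq_self]
    · rw [length_flatten_of_forall hlen']
      refine Nat.mul_le_mul_right _ (hZ LL' (prefixList (k x + 1) enc (i + 1)) hnd ?_ ?_)
      · intro w w' hw
        refine tab_congr fun j hj => ?_
        rw [hw j hj]
      · intro p hp
        obtain ⟨w, hw, rfl⟩ := (hmem p).1 hp
        exact ⟨w, hw (by omega), rfl⟩
    · intro a ha
      obtain ⟨p, hp, hap⟩ := List.mem_flatten.1 ha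
      obtain ⟨w, -, rfl⟩ := (hmem p).1 hp
      obtain ⟨j, -, rfl⟩ := List.mem_map.1 hap
      split_ifs
      exacts [(h.lt _).le, Nat.zero_le _]

end Level

/-! ### The roots of a polynomial over the extension field -/

section Degree

variable {F : Type} [Field F] [Fintype F] {K : Type} [Field K] [Algebra F K] {γ : F} {ξ : K}
  {x : List ℕ} {enc : F → ℕ}

theorem _root_.IsKummer.coeffK_ne_zero_iff (hk : IsKummer F γ ξ) {τ : ℕ → F} {J : ℕ} :
    coeffK ξ τ J ≠ 0 ↔ ∃ i < Fintype.card F - 1, τ (J * (Fintype.card F - 1) + i) ≠ 0 := by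
  constructor
  · intro h
    by_contra! h0
    exact h (by rw [coeffK, ofCoords_congr h0]; simp [ofCoords])
  · rintro ⟨i, hi, h⟩ h0
    exact h (hk.indep _ h0 i hi)

theorem Encodes.deg_spec (h : Encodes x enc γ) (hk : IsKummer F γ ξ) (hq : q x = Fintype.card F)
    {T : List ℕ} {τ : ℕ → F}
    (hT : Rep enc (Fintype.card F * Fintype.card F * (Fintype.card F - 1)) T τ)
    (h0 : ∃ J < Fintype.card F * Fintype.card F, coeffK ξ τ J ≠ 0) :
    deg x T < Fintype.card F * Fintype.card F ∧ coeffK ξ τ (deg x T) ≠ 0 ∧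
      ∀ J < Fintype.card F * Fintype.card F, deg x T < J → coeffK ξ τ J = 0 := by
  rw [deg, hq]
  set N := Fintype.card F - 1 with hN
  set M := Fintype.card F * Fintype.card F with hM
  set f : ℕ → ℕ := fun u => ltn (find N fun i => ne x (T.getD ((M - 1 - u) * N + i) 0)) N with hf
  have hf0 : ∀ u < M, f u ≠ 0 ↔ coeffK ξ τ (M - 1 - u) ≠ 0 := by
    intro u hu
    rw [hf, ltn_ne_zero, find_lt_iff, hk.coeffK_ne_zero_iff]
    refine exists_congr fun i => and_congr_right fun hi => ?_
    rw [hT _ (add_lt_mul (by omega) hi), h.ne_ne_zero]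
  obtain ⟨J, hJ, hJ0⟩ := h0
  have hlt : find M f < M := find_lt (i := M - 1 - J) (by omega) (by
    rw [hf0 _ (by omega), show M - 1 - (M - 1 - J) = J by omega]; exact hJ0)
  obtain ⟨-, s1, s2⟩ := find_spec M f
  refine ⟨by omega, (hf0 _ hlt).1 (s2 hlt), fun J' hJ' hd => ?_⟩
  by_contra hne
  refine (hf0 (M - 1 - J') (by omega)).2 ?_ (s1 _ (by omega))
  rwa [show M - 1 - (M - 1 - J') = J' by omega]

theorem Encodes.roots_spec (h : Encodes x enc γ) (hk : IsKummer F γ ξ) (hq : q x = Fintype.card F)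
    (hkx : k x + 1 ≤ Fintype.card F - 1) {T : List ℕ} {τ : ℕ → F}
    (hT : Rep enc (Fintype.card F * Fintype.card F * (Fintype.card F - 1)) T τ)
    (h0 : ∃ J < Fintype.card F * Fintype.card F, coeffK ξ τ J ≠ 0) :
    ∃ LL : List (List ℕ), roots x T (deg x T) = LL.flatten ∧ LL.Nodup ∧ ∀ p, p ∈ LL ↔
      ∃ w : ℕ → F, (polyK ξ τ (Fintype.card F * Fintype.card F)).eval
        (ofCoords ξ (Fintype.card F - 1) w) = 0 ∧ p = tab (k x + 1) fun j => enc (w j) := by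
  classical
  obtain ⟨hd1, hd2, hd3⟩ := h.deg_spec hk hq hT h0
  set d := deg x T
  obtain ⟨μ, hμ, hμ'⟩ := h.monic_spec hk hq hT (Nat.mul_le_mul_right _ hd1) hd2
  obtain ⟨a, ha, ha'⟩ := h.companion_spec hk hq hμ
  have hpoly : polyK ξ τ (Fintype.card F * Fintype.card F) = C (coeffK ξ τ d) * monicK ξ μ d := by
    refine Polynomial.ext fun J => ?_
    rw [coeff_C_mul, monicK, coeff_add, coeff_X_pow, coeff_polyK, coeff_polyK]
    rcases lt_trichotomy J d with c | c | c
    · rw [if_pos (c.trans hd1), if_neg c.ne, if_pos c, hμ' J c, zero_add, mul_inv_cancel_left₀ hd2]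
    · rw [if_pos (by omega), if_pos c, if_neg (by omega), c, add_zero, mul_one]
    · rw [if_neg c.ne', if_neg c.not_gt, add_zero, mul_zero]
      split_ifs with hJ
      exacts [hd3 J hJ c, rfl]
  have hroot : ∀ w : ℕ → F, (polyK ξ τ (Fintype.card F * Fintype.card F)).eval
      (ofCoords ξ (Fintype.card F - 1) w) = 0 ↔
      (monicK ξ μ d).eval (ofCoords ξ (Fintype.card F - 1) w) = 0 := by
    intro w
    rw [hpoly, eval_C_mul, mul_eq_zero, or_iff_right hd2]
  rw [roots, hq]
  obtain ⟨LL, h1, h2, h3⟩ := h.level_spec (n := d * (Fintype.card F - 1))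
    (A := companion x (monic x T d) d) (i := k x + 1)
    (Z := fun w => (monicK ξ μ d).eval (ofCoords ξ (Fintype.card F - 1) w) = 0)
    (fun c w r hr hrk hc => h.viable_iff hk hq ha ha' hc (hrk.trans hkx) hr)
    -- Each list is determined by the root it comes from, so their number is at most the degree `d`,
    -- which is below q².
    (fun LL f hnd hf hLL => by
      choose c hc using hk.exists_repr
      have hsub : LL.toFinset ⊆ (monicK ξ μ d).roots.toFinset.image fun φ => f (c φ) := by
        intro p hp
        obtain ⟨w, hw, rfl⟩ := hLL p (List.mem_toFinset.1 hp)
        refine Finset.mem_image.2 ⟨ofCoords ξ (Fintype.card F - 1) w, ?_, ?_⟩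
        · rw [Multiset.mem_toFinset, mem_roots (monicK_monic μ d).ne_zero]
          exact hw
        · exact hf _ _ fun j hj => hk.ofCoords_inj (hc (ofCoords ξ _ w)).symm j (by omega)
      rw [← List.toFinset_card_of_nodup hnd, hq]
      calc _ ≤ _ := Finset.card_le_card hsub
        _ ≤ _ := Finset.card_image_le
        _ ≤ _ := Multiset.toFinset_card_le _
        _ ≤ (monicK ξ μ d).natDegree := card_roots' _
        _ = d := natDegree_eq_of_degree_eq_some (degree_monicK μ d)
        _ ≤ _ := hd1.le) le_rfl
  refine ⟨LL, h1, h2, fun p => ?_⟩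
  rw [h3]
  refine exists_congr fun w => ?_
  rw [hroot, prefixList, tab_congr fun j hj => if_pos hj]
  simp

end Degree

end Decoder

end RAM

namespace RAM

namespace Decoder

/-! ## Correctness of the reduction to a polynomial over the extension field -/

theorem sum_range_residues {M : Type} [AddCommMonoid M] {D N : ℕ} (hN : 0 < N) (φ : ℕ → M) :
    ∑ a ∈ Finset.range D, φ a =
      ∑ i ∈ Finset.range N, ∑ j ∈ Finset.range D, if i + N * j < D then φ (i + N * j) else 0 := by
  rw [Finset.sum_comm]
  have := sum_range_mul D N fun t => if t < D then φ t else 0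
  have e : ∀ j i : ℕ, j * N + i = i + N * j := fun j i => by ring
  simp only [e] at this
  rw [← this, ← Finset.sum_filter]
  refine Finset.sum_congr ?_ fun _ _ => rfl
  ext t
  simp only [Finset.mem_filter, Finset.mem_range]
  exact ⟨fun h => ⟨h.trans_le (Nat.le_mul_of_pos_right D hN), h⟩, fun h => h.2⟩

section Digits

variable {F : Type} [Field F] [Fintype F] {K : Type} [Field K] [Algebra F K] {γ : F} {ξ : K}
  {x : List ℕ} {enc : F → ℕ}

/-- The position of the coefficient of `Y ^ J` in the interpolation polynomial. -/
def slot (F : Type) [Fintype F] (J : ℕ) : ℕ :=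
  J % Fintype.card F * Fintype.card F + J / Fintype.card F

/-- The part of the interpolation polynomial with the exponents of `X` that are congruent to `i`. -/
noncomputable def part (D : ℕ) (Q : ℕ → F) (J i : ℕ) : F[X] :=
  ∑ j ∈ Finset.range D, if i + (Fintype.card F - 1) * j < D then
    C (Q ((i + (Fintype.card F - 1) * j) * (Fintype.card F * Fintype.card F) + slot F J)) * X ^ j
    else 0

/-- The digits of the interpolation polynomial. -/
noncomputable def digitF (γ : F) (D : ℕ) (Q : ℕ → F) (h t : ℕ) : F :=
  (taylor γ (part D Q (t / (Fintype.card F - 1)) (t % (Fintype.card F - 1)))).coeff h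

theorem degree_part_lt (D : ℕ) (Q : ℕ → F) (J i : ℕ) : (part D Q J i).degree < D := by
  refine (degree_sum_le _ _).trans_lt ((Finset.sup_lt_iff (WithBot.bot_lt_coe _)).2 fun j hj => ?_)
  split_ifs
  · exact (degree_C_mul_X_pow_le _ _).trans_lt (WithBot.coe_lt_coe.2 (Finset.mem_range.1 hj))
  · rw [degree_zero]; exact WithBot.bot_lt_coe _

theorem Encodes.digit_rep (h : Encodes x enc γ) (hq : q x = Fintype.card F) {L : List ℕ}
    {Q : ℕ → F} (hL : Rep enc (D x * (Fintype.card F * Fintype.card F)) L Q) (u : ℕ) :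
    Rep enc (Fintype.card F * Fintype.card F * (Fintype.card F - 1)) (digit x L u)
      (digitF γ (D x) Q u) := by
  rw [digit, hq]
  refine rep_tab fun t ht => ?_
  have hJ : t / (Fintype.card F - 1) < Fintype.card F * Fintype.card F :=
    Nat.div_lt_of_lt_mul (by rwa [mul_comm])
  rw [h.sum_eq (v := fun j => if t % (Fintype.card F - 1) + (Fintype.card F - 1) * j < D x then
    ((X + C γ) ^ j).coeff u * Q ((t % (Fintype.card F - 1) + (Fintype.card F - 1) * j) *
      (Fintype.card F * Fintype.card F) + slot F (t / (Fintype.card F - 1))) else 0)]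
  · rw [digitF, part, map_sum, finsetSum_coeff]
    congr 1
    refine Finset.sum_congr rfl fun j _ => ?_
    split_ifs
    · rw [taylor_apply, mul_comp, C_comp, X_pow_comp, coeff_C_mul, mul_comm]
    · rw [map_zero, coeff_zero]
  · intro j _
    rw [sel_ltn]
    split_ifs with hlt
    · rw [h.g_eq, h.bin_eq, hL, h.mul_eq, slot]
      exact add_lt_mul hlt (add_lt_mul (Nat.mod_lt _ Fintype.card_pos) (Nat.div_lt_of_lt_mul hJ))
    · exact h.zero_eq

/-- As b, c < q, the substitution Z = Y^q sends distinct monomials Y^b Z^c to distinct powers J = b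
+ q c, so nothing cancels: Q(X, Y, Y^q) keeps every coefficient of Q. The passage to digits is a
Taylor expansion, which is injective. -/
theorem exists_digitF_ne_zero {D : ℕ} {Q : ℕ → F} {t : ℕ}
    (ht : t < D * (Fintype.card F * Fintype.card F)) (hQ : Q t ≠ 0) :
    ∃ u < D, ∃ s < Fintype.card F * Fintype.card F * (Fintype.card F - 1),
      digitF γ D Q u s ≠ 0 := by
  have hc : 1 < Fintype.card F := Fintype.one_lt_card
  set N := Fintype.card F - 1 with hN
  set M := Fintype.card F
  set a := t / (M * M) with ha
  have haD : a < D := Nat.div_lt_of_lt_mul (by rwa [mul_comm])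
  set J := t % (M * M) % M * M + t % (M * M) / M with hJ
  have hb : t % (M * M) % M < M := Nat.mod_lt _ (by omega)
  have hb' : t % (M * M) / M < M := Nat.div_lt_of_lt_mul (Nat.mod_lt _ (by positivity))
  have hJM : J < M * M := add_lt_mul hb hb'
  have hiN : a % N < N := Nat.mod_lt _ (by omega)
  have hs : slot F J = t % (M * M) := by
    rw [slot, hJ, div_of_lt _ hb', mod_of_lt _ hb', Nat.div_add_mod']
  have hp : (part D Q J (a % N)).coeff (a / N) = Q t := by
    rw [part, finsetSum_coeff, Finset.sum_eq_single (a / N)]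
    · rw [← hN, Nat.mod_add_div, if_pos haD, coeff_C_mul_X_pow, if_pos rfl, hs, Nat.div_add_mod']
    · intro j _ hj
      split_ifs
      · rw [coeff_C_mul_X_pow, if_neg hj.symm]
      · simp
    · intro hn
      exact absurd (Finset.mem_range.2 ((Nat.div_le_self a N).trans_lt haD)) hn
  have hp0 : taylor γ (part D Q J (a % N)) ≠ 0 := by
    intro h0
    rw [← map_zero (taylor γ)] at h0
    rw [taylor_injective γ h0, coeff_zero] at hp
    exact hQ hp.symm
  obtain ⟨u, hu⟩ : ∃ u, (taylor γ (part D Q J (a % N))).coeff u ≠ 0 := by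
    by_contra! h0
    exact hp0 (Polynomial.ext fun n => by rw [h0 n, coeff_zero])
  refine ⟨u, ?_, J * N + a % N, add_lt_mul hJM hiN, ?_⟩
  · by_contra! hle
    refine hu (coeff_eq_zero_of_degree_lt ?_)
    rw [degree_taylor]
    exact (degree_part_lt _ _ _ _).trans_le (by exact_mod_cast hle)
  · rwa [digitF, ← hN, div_of_lt _ hiN, mod_of_lt _ hiN]

/-- The expansion of the interpolation polynomial in powers of `X ^ (q - 1) - γ`. -/
theorem sum_digitF (D : ℕ) (Q : ℕ → F) (J : ℕ) :
    ∑ a ∈ Finset.range D, C (Q (a * (Fintype.card F * Fintype.card F) + slot F J)) * X ^ a =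
      ∑ u ∈ Finset.range D, (X ^ (Fintype.card F - 1) - C γ) ^ u *
        ∑ i ∈ Finset.range (Fintype.card F - 1),
          C (digitF γ D Q u (J * (Fintype.card F - 1) + i)) * X ^ i := by
  have hc : 1 < Fintype.card F := Fintype.one_lt_card
  rcases Nat.eq_zero_or_pos D with rfl | hD
  · simp
  rw [sum_range_residues (N := Fintype.card F - 1) (by omega)]
  simp only [Finset.mul_sum]
  rw [Finset.sum_comm (s := Finset.range D)]
  refine Finset.sum_congr rfl fun i hi => ?_
  have hi := Finset.mem_range.1 hi
  have h1 : ∑ j ∈ Finset.range D, (if i + (Fintype.card F - 1) * j < D then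
      C (Q ((i + (Fintype.card F - 1) * j) * (Fintype.card F * Fintype.card F) + slot F J)) *
        X ^ (i + (Fintype.card F - 1) * j) else 0) =
      (part D Q J i).comp (X ^ (Fintype.card F - 1)) * X ^ i := by
    rw [part, comp, eval₂_finsetSum, Finset.sum_mul]
    refine Finset.sum_congr rfl fun j _ => ?_
    split_ifs
    · rw [← comp, mul_comp, C_comp, X_pow_comp, ← pow_mul, mul_assoc, ← pow_add, add_comm i]
    · simp
  -- Taylor expansion at γ, followed by substitution of E = X^(q-1) - γ, is substitution of X^(q-1).
  have h2 : (part D Q J i).comp (X ^ (Fintype.card F - 1)) =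
      (taylor γ (part D Q J i)).comp (X ^ (Fintype.card F - 1) - C γ) := by
    rw [taylor_apply, comp_assoc]
    simp
  rw [h1, h2, comp, eval₂_eq_sum_range' C (n := D), Finset.sum_mul]
  · refine Finset.sum_congr rfl fun u _ => ?_
    rw [digitF, div_of_lt _ hi, mod_of_lt _ hi]
    ring
  · rw [natDegree_taylor]
    rcases eq_or_ne (part D Q J i) 0 with h0 | h0
    · rwa [h0, natDegree_zero]
    · exact (natDegree_lt_iff_degree_lt h0).2 (degree_part_lt _ _ _ _)

theorem sum_range_sq {M : Type} [AddCommMonoid M] (D n : ℕ) (φ : ℕ → ℕ → ℕ → ℕ → M) :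
    ∑ t ∈ Finset.range (D * (n * n)), φ t (t / (n * n)) (t / n % n) (t % n) =
      ∑ J ∈ Finset.range (n * n), ∑ a ∈ Finset.range D,
        φ (a * (n * n) + (J % n * n + J / n)) a (J % n) (J / n) := by
  rw [sum_range_mul, Finset.sum_comm]
  rw [sum_range_mul, sum_range_mul, Finset.sum_comm]
  refine Finset.sum_congr rfl fun c hc => Finset.sum_congr rfl fun b hb =>
    Finset.sum_congr rfl fun a _ => ?_
  have hc := Finset.mem_range.1 hc
  have hb := Finset.mem_range.1 hb
  have e : a * (n * n) + (b * n + c) = (a * n + b) * n + c := by ring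
  rw [div_of_lt _ hb, mod_of_lt _ hb, div_of_lt _ (add_lt_mul hb hc), e, div_of_lt _ hc,
    mod_of_lt _ hc, mod_of_lt _ hb]

/-- Write Q(X, f(X), f(γX)) = ∑ E^u W_u, where W_u is formed from the digits number u. If v is the
first nonzero digit, then W_u = 0 for u < v; if the sum is zero, E divides W_v. At ξ, where E
vanishes and f(γX) becomes f(ξ)^q, this says that f(ξ) is a root of the polynomial formed from digit
v. -/
theorem Encodes.poly_spec (h : Encodes x enc γ) (hk : IsKummer F γ ξ) (hq : q x = Fintype.card F)
    {L : List ℕ} {Q : ℕ → F} (hL : Rep enc (U x) L Q) (h0 : ∃ t < U x, Q t ≠ 0) :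
    ∃ τ, Rep enc (Fintype.card F * Fintype.card F * (Fintype.card F - 1)) (poly x L) τ ∧
      (∃ J < Fintype.card F * Fintype.card F, coeffK ξ τ J ≠ 0) ∧
      ∀ f : F[X], (∑ t ∈ Finset.range (U x), C (Q t) * X ^ (t / (Fintype.card F * Fintype.card F)) *
          f ^ (t / Fintype.card F % Fintype.card F) *
          (f.comp (C γ * X)) ^ (t % Fintype.card F) = 0) →
        (polyK ξ τ (Fintype.card F * Fintype.card F)).eval (aeval ξ f) = 0 := by
  have hc : 1 < Fintype.card F := Fintype.one_lt_card
  rw [U, hq] at hL h0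
  have hrep := h.digit_rep hq hL
  rw [poly, hq]
  set N := Fintype.card F - 1 with hN
  set M := Fintype.card F with hM
  set c : ℕ → ℕ := fun u => ltn (find (M * M * N) fun t => ne x ((digit x L u).getD t 0)) (M * M * N)
    with hcdef
  have hc0 : ∀ u, c u ≠ 0 ↔ ∃ s < M * M * N, digitF γ (D x) Q u s ≠ 0 := by
    intro u
    rw [hcdef, ltn_ne_zero, find_lt_iff]
    refine exists_congr fun s => and_congr_right fun hs => ?_
    rw [hrep u s hs, h.ne_ne_zero]
  obtain ⟨t, ht, hQt⟩ := h0
  obtain ⟨u, hu, hu'⟩ := exists_digitF_ne_zero (γ := γ) ht hQt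
  have hlt : find (D x) c < D x := find_lt hu ((hc0 u).2 hu')
  obtain ⟨-, s1, s2⟩ := find_spec (D x) c
  set v := find (D x) c with hv
  refine ⟨digitF γ (D x) Q v, hrep v, ?_, fun f hf => ?_⟩
  · obtain ⟨s, hs, hne⟩ := (hc0 v).1 (s2 hlt)
    refine ⟨s / N, Nat.div_lt_of_lt_mul (by rwa [mul_comm]), hk.coeffK_ne_zero_iff.2
      ⟨s % N, Nat.mod_lt _ (by omega), ?_⟩⟩
    rwa [← hN, Nat.div_add_mod']
  · set E : F[X] := X ^ N - C γ with hE
    set W : ℕ → F[X] := fun u => ∑ J ∈ Finset.range (M * M),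
      (∑ i ∈ Finset.range N, C (digitF γ (D x) Q u (J * N + i)) * X ^ i) *
        (f ^ (J % M) * f.comp (C γ * X) ^ (J / M)) with hW
    have hsum : ∑ u ∈ Finset.range (D x), E ^ u * W u = 0 := by
      rw [U, hq, sum_range_sq (D x) M fun t a b c => C (Q t) * X ^ a * f ^ b *
        f.comp (C γ * X) ^ c] at hf
      rw [← hf, hW]
      simp only [Finset.mul_sum (s := Finset.range (M * M))]
      rw [Finset.sum_comm]
      refine Finset.sum_congr rfl fun J _ => ?_
      simp only [← mul_assoc]
      rw [← Finset.sum_mul, ← Finset.sum_mul, ← Finset.sum_mul, ← Finset.sum_mul]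
      congr 2
      simpa only [slot, ← mul_assoc] using (sum_digitF (γ := γ) (D x) Q J).symm
    have hW0 : ∀ u < v, W u = 0 := by
      intro u hu
      have hz : ∀ s < M * M * N, digitF γ (D x) Q u s = 0 := by
        by_contra! hne
        exact (hc0 u).2 hne (s1 u hu)
      rw [hW]
      refine Finset.sum_eq_zero fun J hJ => ?_
      rw [Finset.sum_eq_zero, zero_mul]
      intro i hi
      rw [hz _ (add_lt_mul (Finset.mem_range.1 hJ) (Finset.mem_range.1 hi)), C_0, zero_mul]
    have hE0 : E ≠ 0 := X_pow_sub_C_ne_zero (by omega) γ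
    have hdvd : E ∣ W v := by
      have h1 : E ^ v * E ∣ E ^ v * W v := by
        rw [← Finset.add_sum_erase _ _ (Finset.mem_range.2 hlt), add_eq_zero_iff_eq_neg] at hsum
        rw [hsum, dvd_neg]
        refine Finset.dvd_sum fun u hu => ?_
        rcases lt_or_gt_of_ne (Finset.ne_of_mem_erase hu) with hlt | hgt
        · rw [hW0 u hlt, mul_zero]; exact dvd_zero _
        · rw [← pow_succ]
          exact (pow_dvd_pow E hgt).mul_right _
      exact (mul_dvd_mul_iff_left (pow_ne_zero v hE0)).1 h1
    obtain ⟨S, hS⟩ := hdvd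
    have hz : aeval ξ (W v) = 0 := by
      rw [hS, map_mul, hE, map_sub, map_pow, aeval_X, aeval_C, hk.pow_eq, sub_self, zero_mul]
    have hfrob : aeval ξ (f.comp (C γ * X)) = aeval ξ f ^ M := by
      have h1 := aeval_pow_card_pow ξ f 1
      have h2 := pow_card_pow_of_pow_eq hk.pow_eq 1
      rw [pow_one, pow_one] at h2
      rw [pow_one, h2] at h1
      rw [h1, aeval_comp]
      simp
    rw [← hz, hW, polyK, eval_finsetSum, map_sum]
    refine Finset.sum_congr rfl fun J _ => ?_
    rw [map_mul, map_mul, map_pow, map_pow, hfrob, ← pow_mul, ← pow_add, Nat.mod_add_div, eval_mul,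
      eval_C, eval_pow, eval_X, coeffK, ofCoords_eq_aeval]

end Digits

end Decoder

end RAM

namespace RAM

namespace Decoder

/-! ## Correctness of the interpolation -/

/-! ### Numbers of monomials and of conditions -/

section Counting

theorem sum_triangle (n : ℕ) (g : ℕ → ℕ) :
    ∑ b ∈ Finset.range n, ∑ c ∈ Finset.range (n - b), g (b + c) =
      ∑ s ∈ Finset.range n, (s + 1) * g s := by
  induction n with
  | zero => rfl
  | succ n ih =>
    rw [Finset.sum_range_succ, Finset.sum_range_succ _ n, ← ih, Nat.add_sub_cancel_left,
      Finset.sum_range_one]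
    have : ∀ b ∈ Finset.range n, ∑ c ∈ Finset.range (n + 1 - b), g (b + c) =
        ∑ c ∈ Finset.range (n - b), g (b + c) + g n := by
      intro b hb
      have hb := Finset.mem_range.1 hb
      rw [show n + 1 - b = n - b + 1 by omega, Finset.sum_range_succ,
        show b + (n - b) = n by omega]
    rw [Finset.sum_congr rfl this, Finset.sum_add_distrib]
    simp
    ring

theorem sum_triangle_le (n : ℕ) (g : ℕ → ℕ) :
    ∑ s ∈ Finset.range n, (s + 1) * g s ≤
      ∑ b ∈ Finset.range n, ∑ c ∈ Finset.range n, g (b + c) := by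
  rw [← sum_triangle]
  exact Finset.sum_le_sum fun b _ => Finset.sum_le_sum_of_subset
    (Finset.range_subset_range.2 (Nat.sub_le n b))

theorem sum_triangle_eq {n : ℕ} {g : ℕ → ℕ} (hg : ∀ s, n ≤ s → g s = 0) :
    ∑ b ∈ Finset.range n, ∑ c ∈ Finset.range n, g (b + c) =
      ∑ s ∈ Finset.range n, (s + 1) * g s := by
  rw [← sum_triangle]
  refine Finset.sum_congr rfl fun b hb => (Finset.sum_subset
    (Finset.range_subset_range.2 (Nat.sub_le n b)) fun c _ hc => hg _ ?_).symm
  rw [Finset.mem_range] at hb hc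
  omega

theorem sum_mul_sub (n : ℕ) (D k : ℤ) :
    6 * ∑ s ∈ Finset.range n, ((s : ℤ) + 1) * (D - k * s) = n * (n + 1) * (3 * D - 2 * k * (n - 1)) := by
  induction n with
  | zero => simp
  | succ n ih => rw [Finset.sum_range_succ, mul_add, ih]; push_cast; ring

theorem sum_range_ite_lt (n r D : ℕ) (h : D ≤ n + r) :
    (∑ a ∈ Finset.range n, if a + r < D then 1 else 0) = D - r := by
  rw [← Finset.card_filter]
  have : (Finset.range n).filter (fun a => a + r < D) = Finset.range (D - r) := by
    ext a; simp; omega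
  rw [this, Finset.card_range]

/-- The binomial coefficient m + 2 over 3: the number of conditions for vanishing to order `m` at a
point with three coordinates. -/
theorem card_triples (m : ℕ) :
    6 * (∑ a ∈ Finset.range m, ∑ b ∈ Finset.range m, ∑ c ∈ Finset.range m,
      if a + b + c < m then 1 else 0) = m * (m + 1) * (m + 2) := by
  have h1 : ∀ a ∈ Finset.range m, ∀ b ∈ Finset.range m, (∑ c ∈ Finset.range m,
      if a + b + c < m then 1 else 0) = m - (a + b) := by
    intro a _ b _
    rw [← sum_range_ite_lt m (a + b) m (by omega)]
    simp only [add_comm]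
  rw [Finset.sum_congr rfl fun a ha => Finset.sum_congr rfl fun b hb => h1 a ha b hb,
    sum_triangle_eq (g := fun s => m - s) fun s hs => by omega]
  have h2 := sum_mul_sub m m 1
  have h3 : ((∑ s ∈ Finset.range m, (s + 1) * (m - s) : ℕ) : ℤ) =
      ∑ s ∈ Finset.range m, ((s : ℤ) + 1) * (m - 1 * s) := by
    rw [Nat.cast_sum]
    refine Finset.sum_congr rfl fun s hs => ?_
    rw [Nat.cast_mul, Nat.cast_sub (Finset.mem_range.1 hs).le]
    push_cast; ring
  refine Nat.cast_injective (R := ℤ) ?_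
  rw [Nat.cast_mul, h3]
  push_cast
  rw [h2]; ring

/-- Only the pairs with s = b + c ≤ S = ⌊D/k⌋ count; they satisfy b, c < q because D < k q, so the
box loses none of them. There are s + 1 pairs for each s, each with D - k s exponents a. With D = k
S + r, six times the sum is (S + 1)(S + 2)(k S + 3 r), and k² times this is at least D³ since r < k.
-/
theorem card_monomials {D k q : ℕ} (hk : 0 < k) (hD : D < k * q) :
    D ^ 3 ≤ 6 * k ^ 2 * ∑ a ∈ Finset.range D, ∑ b ∈ Finset.range q, ∑ c ∈ Finset.range q,
      if a + k * (b + c) < D then 1 else 0 := by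
  have h1 : (∑ a ∈ Finset.range D, ∑ b ∈ Finset.range q, ∑ c ∈ Finset.range q,
      if a + k * (b + c) < D then 1 else 0) =
      ∑ b ∈ Finset.range q, ∑ c ∈ Finset.range q, (D - k * (b + c)) := by
    rw [Finset.sum_comm]
    refine Finset.sum_congr rfl fun b _ => ?_
    rw [Finset.sum_comm]
    exact Finset.sum_congr rfl fun c _ => sum_range_ite_lt _ _ _ (by omega)
  rw [h1]
  set S := D / k
  have hS : S + 1 ≤ q := Nat.div_lt_of_lt_mul hD
  have h2 : ∑ s ∈ Finset.range (S + 1), (s + 1) * (D - k * s) ≤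
      ∑ b ∈ Finset.range q, ∑ c ∈ Finset.range q, (D - k * (b + c)) :=
    (Finset.sum_le_sum_of_subset (Finset.range_subset_range.2 hS)).trans
      (sum_triangle_le q fun s => D - k * s)
  refine le_trans ?_ (Nat.mul_le_mul_left _ h2)
  have hr : k * S + D % k = D := Nat.div_add_mod D k
  have hrk := Nat.mod_lt D hk
  set r := D % k
  have h3 := sum_mul_sub (S + 1) D k
  have h4 : ((∑ s ∈ Finset.range (S + 1), (s + 1) * (D - k * s) : ℕ) : ℤ) =
      ∑ s ∈ Finset.range (S + 1), ((s : ℤ) + 1) * (D - k * s) := by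
    rw [Nat.cast_sum]
    refine Finset.sum_congr rfl fun s hs => ?_
    have hs := Finset.mem_range.1 hs
    rw [Nat.cast_mul, Nat.cast_sub]
    · push_cast; ring
    · calc k * s ≤ k * S := Nat.mul_le_mul_left _ (by omega)
        _ ≤ D := by omega
  have h5 : 6 * ∑ s ∈ Finset.range (S + 1), (s + 1) * (D - k * s) =
      (S + 1) * (S + 2) * (k * S + 3 * r) := by
    refine Nat.cast_injective (R := ℤ) ?_
    rw [Nat.cast_mul, h4]
    push_cast at h3 ⊢
    rw [h3, ← hr]
    push_cast; ring
  rw [mul_right_comm, h5, ← hr]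
  calc (k * S + r) ^ 3 ≤ (k * S + k) * (k * S + 2 * k) * (k * S + 3 * r) := by
        rw [pow_succ, pow_two]
        gcongr <;> omega
    _ = _ := by ring

end Counting

/-! ### Vanishing to high order after substitution -/

section Divisibility

variable {F : Type} [Field F]

theorem pow_eq_sum_coeff (y : F[X]) (a : F) {b L : ℕ} (hb : b < L) :
    y ^ b = ∑ i ∈ Finset.range L, C (((X + C a) ^ b).coeff i) * (y - C a) ^ i := by
  have h : ((X + C a) ^ b).comp (y - C a) = y ^ b := by simp
  rw [← h, comp, eval₂_eq_sum_range' C (n := L)]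
  rwa [natDegree_pow, natDegree_X_add_C, mul_one]

/-- A polynomial that satisfies the interpolation constraints vanishes to order `r`. -/
theorem pow_dvd_of_constraints {n r L : ℕ} {Q : ℕ → F} {a b c : ℕ → ℕ} {α β δ : F} {y z : F[X]}
    (hy : X - C α ∣ y - C β) (hz : X - C α ∣ z - C δ)
    (hL : ∀ t < n, a t < L ∧ b t < L ∧ c t < L)
    (h0 : ∀ i₁ i₂ i₃, i₁ + i₂ + i₃ < r → ∑ t ∈ Finset.range n, ((X + C α) ^ a t).coeff i₁ *
      ((X + C β) ^ b t).coeff i₂ * ((X + C δ) ^ c t).coeff i₃ * Q t = 0) :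
    (X - C α) ^ r ∣ ∑ t ∈ Finset.range n, C (Q t) * X ^ a t * y ^ b t * z ^ c t := by
  -- Expand about the point (α, β, δ). The constraints remove the terms of order below `r`, and in
  -- the others each of the factors X - α, y - β and z - δ is divisible by X - α.
  have e : ∑ t ∈ Finset.range n, C (Q t) * X ^ a t * y ^ b t * z ^ c t =
      ∑ i₁ ∈ Finset.range L, ∑ i₂ ∈ Finset.range L, ∑ i₃ ∈ Finset.range L,
        C (∑ t ∈ Finset.range n, ((X + C α) ^ a t).coeff i₁ * ((X + C β) ^ b t).coeff i₂ *
          ((X + C δ) ^ c t).coeff i₃ * Q t) *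
          ((X - C α) ^ i₁ * (y - C β) ^ i₂ * (z - C δ) ^ i₃) := by
    simp only [map_sum, Finset.sum_mul]
    rw [Finset.sum_congr rfl fun i₁ _ => Finset.sum_congr rfl fun i₂ _ => Finset.sum_comm,
      Finset.sum_congr rfl fun i₁ _ => Finset.sum_comm, Finset.sum_comm]
    refine Finset.sum_congr rfl fun t ht => ?_
    obtain ⟨ha, hb, hc⟩ := hL t (Finset.mem_range.1 ht)
    rw [pow_eq_sum_coeff X α ha, pow_eq_sum_coeff y β hb, pow_eq_sum_coeff z δ hc]
    rw [Finset.sum_congr rfl fun i₁ _ => Finset.sum_congr rfl fun i₂ _ => Finset.sum_congr rfl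
      fun i₃ _ => show _ = C (Q t) * (C (((X + C α) ^ a t).coeff i₁) * (X - C α) ^ i₁) *
        (C (((X + C β) ^ b t).coeff i₂) * (y - C β) ^ i₂) *
        (C (((X + C δ) ^ c t).coeff i₃) * (z - C δ) ^ i₃) by simp only [C_mul]; ring]
    simp only [← Finset.mul_sum, ← Finset.sum_mul]
  rw [e]
  refine Finset.dvd_sum fun i₁ _ => Finset.dvd_sum fun i₂ _ => Finset.dvd_sum fun i₃ _ => ?_
  by_cases hi : i₁ + i₂ + i₃ < r
  · rw [h0 _ _ _ hi, C_0, zero_mul]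
    exact dvd_zero _
  · refine Dvd.dvd.mul_left ((pow_dvd_pow _ (not_lt.1 hi)).trans ?_) _
    rw [pow_add, pow_add]
    exact mul_dvd_mul (mul_dvd_mul dvd_rfl (pow_dvd_pow_of_dvd hy _)) (pow_dvd_pow_of_dvd hz _)

theorem eq_zero_of_pow_dvd {ι : Type} {s : Finset ι} {α : ι → F} (hα : Set.InjOn α s) {r : ℕ}
    {R : F[X]} (h : ∀ i ∈ s, (X - C (α i)) ^ r ∣ R) (hR : R.degree < (r * s.card : ℕ)) : R = 0 := by
  have h1 : ∏ i ∈ s, (X - C (α i)) ^ r ∣ R := by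
    refine Finset.prod_dvd_of_coprime (fun i hi j hj hij => ?_) h
    exact (isCoprime_X_sub_C_of_isUnit_sub
      (sub_ne_zero.2 fun hα' => hij (hα hi hj hα')).isUnit).pow
  refine eq_zero_of_dvd_of_degree_lt h1 ?_
  rw [degree_prod]
  simpa [mul_comm] using hR

end Divisibility

end Decoder

end RAM

namespace RAM

namespace Decoder

theorem digits_cube {m i₁ i₂ i₃ : ℕ} (P : ℕ) (h₁ : i₁ < m) (h₂ : i₂ < m) (h₃ : i₃ < m) :
    (P * (m * m * m) + ((i₁ * m + i₂) * m + i₃)) / (m * m * m) = P ∧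
    (P * (m * m * m) + ((i₁ * m + i₂) * m + i₃)) / (m * m) % m = i₁ ∧
    (P * (m * m * m) + ((i₁ * m + i₂) * m + i₃)) / m % m = i₂ ∧
    (P * (m * m * m) + ((i₁ * m + i₂) * m + i₃)) % m = i₃ := by
  have e1 : P * (m * m * m) + ((i₁ * m + i₂) * m + i₃) =
      (P * m + i₁) * (m * m) + (i₂ * m + i₃) := by ring
  have e2 : P * (m * m * m) + ((i₁ * m + i₂) * m + i₃) =
      ((P * m + i₁) * m + i₂) * m + i₃ := by ring
  refine ⟨div_of_lt _ (add_lt_mul (add_lt_mul h₁ h₂) h₃), ?_, ?_, ?_⟩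
  · rw [e1, div_of_lt _ (add_lt_mul h₂ h₃), mod_of_lt _ h₁]
  · rw [e2, div_of_lt _ h₃, mod_of_lt _ h₂]
  · rw [e2, mod_of_lt _ h₃]

theorem sum_range_cube {M : Type} [AddCommMonoid M] (d m : ℕ) (φ : ℕ → ℕ → ℕ → ℕ → M) :
    ∑ i ∈ Finset.range (d * (m * m * m)), φ (i / (m * m * m)) (i / (m * m) % m) (i / m % m) (i % m) =
      ∑ P ∈ Finset.range d, ∑ i₁ ∈ Finset.range m, ∑ i₂ ∈ Finset.range m, ∑ i₃ ∈ Finset.range m,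
        φ P i₁ i₂ i₃ := by
  rw [sum_range_mul]
  refine Finset.sum_congr rfl fun P _ => ?_
  rw [sum_range_mul, sum_range_mul]
  refine Finset.sum_congr rfl fun i₁ h₁ => Finset.sum_congr rfl fun i₂ h₂ =>
    Finset.sum_congr rfl fun i₃ h₃ => ?_
  obtain ⟨e1, e2, e3, e4⟩ := digits_cube P (Finset.mem_range.1 h₁) (Finset.mem_range.1 h₂)
    (Finset.mem_range.1 h₃)
  rw [e1, e2, e3, e4]

theorem sum_range_box {M : Type} [AddCommMonoid M] (D n : ℕ) (φ : ℕ → ℕ → ℕ → M) :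
    ∑ t ∈ Finset.range (D * (n * n)), φ (t / (n * n)) (t / n % n) (t % n) =
      ∑ a ∈ Finset.range D, ∑ b ∈ Finset.range n, ∑ c ∈ Finset.range n, φ a b c := by
  rw [sum_range_mul]
  refine Finset.sum_congr rfl fun a _ => ?_
  rw [sum_range_mul]
  refine Finset.sum_congr rfl fun b hb => Finset.sum_congr rfl fun c hc => ?_
  have hc := Finset.mem_range.1 hc
  have hb := Finset.mem_range.1 hb
  have e : a * (n * n) + (b * n + c) = (a * n + b) * n + c := by ring
  rw [div_of_lt _ (add_lt_mul hb hc), e, div_of_lt _ hc, mod_of_lt _ hc, mod_of_lt _ hb]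

/-! ### Existence and effect of the interpolation polynomial -/

section Interpolation

variable {F : Type} [Field F] {γ : F} {x : List ℕ} {enc : F → ℕ}

/-- A linear map to a space of smaller dimension has a kernel. The predicate `p` keeps the zero
rows, which number the unused constraints, out of the count. -/
theorem exists_isSol {n R : ℕ} {w : List ℕ} {ρ : ℕ → ℕ → F} {p : ℕ → Prop} [DecidablePred p]
    (hp : ∀ i < R, ¬ p i → ∀ j < n, ρ i j = 0)
    (h : ((Finset.range R).filter p).card <
      ((Finset.range n).filter fun j => w.getD j 0 ≠ 0).card) :
    ∃ u, IsSol n w R ρ u := by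
  set A := (Finset.range n).filter fun j => w.getD j 0 ≠ 0 with hA
  set B := (Finset.range R).filter p with hB
  let f : (A → F) →ₗ[F] (B → F) :=
    { toFun := fun v i => ∑ j : A, ρ i j * v j
      map_add' := fun v w => by ext i; simp [mul_add, Finset.sum_add_distrib]
      map_smul' := fun c v => by
        ext i
        simp only [Pi.smul_apply, smul_eq_mul, RingHom.id_apply, Finset.mul_sum]
        exact Finset.sum_congr rfl fun j _ => by ring }
  have hker : LinearMap.ker f ≠ ⊥ := LinearMap.ker_ne_bot_of_finrank_lt (by simpa using h)
  obtain ⟨v, hv, hv0⟩ := (Submodule.ne_bot_iff _).1 hker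
  have hsum : ∀ ρ' : ℕ → F, ∑ j ∈ Finset.range n,
      ρ' j * (if hj : j ∈ A then v ⟨j, hj⟩ else 0) = ∑ j : A, ρ' j * v j := by
    intro ρ'
    rw [← Finset.sum_subset (Finset.filter_subset _ _ : A ⊆ _), ← Finset.sum_attach]
    · exact Finset.sum_congr rfl fun j _ => by rw [dif_pos j.2]
    · intro j _ hj
      rw [dif_neg hj, mul_zero]
  refine ⟨fun j => if hj : j ∈ A then v ⟨j, hj⟩ else 0, ?_, fun i _ hi => ?_, fun i hi => ?_⟩
  · by_contra! hz
    refine hv0 (funext fun j => ?_)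
    have := hz j (Finset.mem_range.1 (Finset.mem_filter.1 j.2).1)
    rwa [dif_pos j.2] at this
  · refine dif_neg ?_
    simp only [hA, Finset.mem_filter, not_and, not_not]
    exact fun _ => hi
  · by_cases hpi : p i
    · rw [hsum]
      exact congrFun (LinearMap.mem_ker.1 hv) ⟨i, Finset.mem_filter.2 ⟨Finset.mem_range.2 hi, hpi⟩⟩
    · exact Finset.sum_eq_zero fun j hj => by
        rw [hp i hi hpi j (Finset.mem_range.1 hj), zero_mul]

/-- Whether the constraint number `i` is used. -/
def Active (m i : ℕ) : Prop :=
  i / (m * m * m) % m + 1 < m ∧ i / (m * m) % m + i / m % m + i % m < m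

instance (m : ℕ) : DecidablePred (Active m) := fun _ => inferInstanceAs (Decidable (_ ∧ _))

theorem card_active (N m : ℕ) : 6 * ((Finset.range (N * m * (m * m * m))).filter (Active m)).card =
    N * (m - 1) * (m * (m + 1) * (m + 2)) := by
  rw [Finset.card_filter]
  have h1 : ∀ i ∈ Finset.range (N * m * (m * m * m)), (if Active m i then 1 else 0) =
      (if i / (m * m * m) % m + 1 < m then 1 else 0) *
        if i / (m * m) % m + i / m % m + i % m < m then 1 else 0 := by
    intro i _
    by_cases c1 : i / (m * m * m) % m + 1 < m
    · by_cases c2 : i / (m * m) % m + i / m % m + i % m < m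
      · rw [if_pos c1, if_pos c2, if_pos ⟨c1, c2⟩]
      · rw [if_neg c2, if_neg fun c => c2 c.2, mul_zero]
    · rw [if_neg c1, if_neg fun c => c1 c.1, zero_mul]
  rw [Finset.sum_congr rfl h1, sum_range_cube (N * m) m fun P i₁ i₂ i₃ =>
    (if P % m + 1 < m then 1 else 0) * if i₁ + i₂ + i₃ < m then 1 else 0]
  simp only [← Finset.mul_sum]
  rw [← Finset.sum_mul, mul_left_comm, card_triples]
  congr 1
  rw [sum_range_mul]
  have h2 : ∀ j ∈ Finset.range N, (∑ l ∈ Finset.range m, if (j * m + l) % m + 1 < m then 1 else 0) =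
      m - 1 := by
    intro j _
    rw [← sum_range_ite_lt m 1 m (by omega)]
    exact Finset.sum_congr rfl fun l hl => by rw [mod_of_lt _ (Finset.mem_range.1 hl)]
  rw [Finset.sum_congr rfl h2]
  simp

theorem card_allowed (x : List ℕ) : ((Finset.range (U x)).filter fun j =>
    (allowed x).getD j 0 ≠ 0).card = ∑ a ∈ Finset.range (D x), ∑ b ∈ Finset.range (q x),
      ∑ c ∈ Finset.range (q x), if a + k x * (b + c) < D x then 1 else 0 := by
  rw [Finset.card_filter, ← sum_range_box (D x) (q x) fun a b c =>
    if a + k x * (b + c) < D x then 1 else 0]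
  refine Finset.sum_congr rfl fun t ht => ?_
  rw [allowed, getD_tab, if_pos (show t < U x from Finset.mem_range.1 ht)]
  simp only [ltn_ne_zero]

variable [Fintype F]

/-- At a position P in an agreeing block that is not the last one there, z_P = f(γ^P) and z_(P+1) =
f(γ γ^P), so Q(X, f(X), f(γX)) vanishes to order m at γ^P. These points are distinct, and `D` is m
times m - 1 times the least number of agreeing blocks, so the zeros outnumber the degree. -/
theorem Encodes.interp_spec (h : Encodes x enc γ) (hq : q x = Fintype.card F)
    (hγ : orderOf γ = Fintype.card F - 1) {z : ℕ → F} (hz : ∀ P < len x, rcv x P = enc (z P))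
    (hm : 0 < m x) (hk : 0 < k x) (hD : D x < k x * q x)
    (hc : k x ^ 2 * (bl x * (m x - 1) * (m x * (m x + 1) * (m x + 2))) < D x ^ 3) :
    ∃ Q : ℕ → F, Rep enc (U x) (interp x) Q ∧ (∃ t < U x, Q t ≠ 0) ∧
      ∀ f : F[X], f.natDegree ≤ k x → ∀ s ⊆ Finset.range (bl x), bl x - e x ≤ s.card →
        (∀ j ∈ s, ∀ l < m x, f.eval (γ ^ (j * m x + l)) = z (j * m x + l)) →
        ∑ t ∈ Finset.range (U x), C (Q t) * X ^ (t / (q x * q x)) * f ^ (t / q x % q x) *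
          (f.comp (C γ * X)) ^ (t % q x) = 0 := by
  set M := m x with hM
  let ρ : ℕ → ℕ → F := fun i t => if Active M i then
    ((X + C (γ ^ (i / (M * M * M)))) ^ (t / (q x * q x))).coeff (i / (M * M) % M) *
      ((X + C (z (i / (M * M * M)))) ^ (t / q x % q x)).coeff (i / M % M) *
      ((X + C (z (i / (M * M * M) + 1))) ^ (t % q x)).coeff (i % M) else 0
  have hrow : ∀ i < len x * (M * M * M), Rep enc (U x) (constraint x i) (ρ i) := by
    intro i hi
    refine rep_tab fun t _ => ?_
    have hP : i / (M * M * M) < len x := Nat.div_lt_of_lt_mul (by rwa [mul_comm])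
    rw [← hM]
    by_cases ha : Active M i
    · have hP1 : i / (M * M * M) + 1 < len x := by
        have h1 : i / (M * M * M) / M < bl x :=
          Nat.div_lt_of_lt_mul (by rw [mul_comm M (bl x)]; exact hP)
        have h2 := add_lt_mul h1 ha.1
        rwa [← add_assoc, Nat.div_add_mod'] at h2
      have : ltn (i / (M * M * M) % M + 1) M * ltn (i / (M * M) % M + i / M % M + i % M) M ≠ 0 :=
        mul_ne_zero (ltn_ne_zero.2 ha.1) (ltn_ne_zero.2 ha.2)
      simp only [ρ, if_pos ha]
      rw [sel, if_neg this, hz _ hP, hz _ hP1, h.g_eq, h.pow_eq, h.bin_eq, h.bin_eq, h.bin_eq,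
        h.mul_eq, h.mul_eq]
    · have : ltn (i / (M * M * M) % M + 1) M * ltn (i / (M * M) % M + i / M % M + i % M) M = 0 := by
        by_contra hne
        exact ha ⟨ltn_ne_zero.1 (left_ne_zero_of_mul hne), ltn_ne_zero.1 (right_ne_zero_of_mul hne)⟩
      simp only [ρ, if_neg ha]
      rw [this, sel_zero, h.zero_eq]
  have hcard : ((Finset.range (len x * (M * M * M))).filter (Active M)).card <
      ((Finset.range (U x)).filter fun j => (allowed x).getD j 0 ≠ 0).card := by
    have h1 := card_active (bl x) M
    have h2 := card_monomials hk hD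
    rw [← card_allowed] at h2
    rw [len, ← hM]
    refine lt_of_mul_lt_mul_left (a := 6 * k x ^ 2) ?_ (Nat.zero_le _)
    calc _ = k x ^ 2 * (6 * ((Finset.range (bl x * M * (M * M * M))).filter (Active M)).card) := by
          ring
      _ < D x ^ 3 := by rwa [h1]
      _ ≤ _ := h2
  obtain ⟨Q, ⟨h1, h2, h3⟩, hQ⟩ := (h.npos_kern (w := allowed x) hrow).2
    (exists_isSol (p := Active M) (fun i _ hi j _ => if_neg hi) hcard)
  refine ⟨Q, hQ, h1, fun f hf s hs hsc hfs => ?_⟩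
  have hq0 : 0 < q x := by rw [hq]; exact Fintype.card_pos
  have hlen : len x ≤ orderOf γ := by
    rw [hγ, ← hq, len, bl]
    exact Nat.div_mul_le_self _ _
  -- The last position of a block is left out because its successor lies in another block, where
  -- agreement is not known.
  refine eq_zero_of_pow_dvd (s := s ×ˢ Finset.range (M - 1)) (α := fun p => γ ^ (p.1 * M + p.2))
    (r := M) ?_ ?_ ?_
  · rintro ⟨j, l⟩ hp ⟨j', l'⟩ hp' hpp
    simp only [Finset.coe_product, Set.mem_prod, Finset.mem_coe, Finset.mem_range] at hp hp'
    have hl : l < M := by omega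
    have hl' : l' < M := by omega
    have := pow_injOn_Iio_orderOf
      (show j * M + l ∈ Set.Iio (orderOf γ) from
        (add_lt_mul (Finset.mem_range.1 (hs hp.1)) hl).trans_le hlen)
      (show j' * M + l' ∈ Set.Iio (orderOf γ) from
        (add_lt_mul (Finset.mem_range.1 (hs hp'.1)) hl').trans_le hlen) hpp
    rw [Prod.mk.injEq, ← div_of_lt j hl, this, div_of_lt j' hl', ← mod_of_lt j hl, this,
      mod_of_lt j' hl']
    exact ⟨rfl, rfl⟩
  · rintro ⟨j, l⟩ hp
    simp only [Finset.mem_product, Finset.mem_range] at hp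
    obtain ⟨hj, hl⟩ := hp
    have hjb := Finset.mem_range.1 (hs hj)
    have hP : j * M + l < len x := add_lt_mul hjb (by omega)
    refine pow_dvd_of_constraints (L := D x + q x) (β := z (j * M + l)) (δ := z (j * M + l + 1))
      ?_ ?_ ?_ ?_
    · rw [dvd_iff_isRoot, IsRoot, eval_sub, eval_C, hfs j hj l (by omega), sub_self]
    · rw [dvd_iff_isRoot, IsRoot, eval_sub, eval_C, eval_comp, eval_mul, eval_C, eval_X,
        ← pow_succ', add_assoc, hfs j hj (l + 1) (by omega), ← add_assoc, sub_self]
    · intro t ht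
      refine ⟨?_, ?_, ?_⟩
      · have : t / (q x * q x) < D x := Nat.div_lt_of_lt_mul (by rwa [mul_comm])
        omega
      · have := Nat.mod_lt (t / q x) hq0; omega
      · have := Nat.mod_lt t hq0; omega
    · intro i₁ i₂ i₃ hi
      have b1 : i₁ < M := by omega
      have b2 : i₂ < M := by omega
      have b3 : i₃ < M := by omega
      obtain ⟨e1, e2, e3, e4⟩ := digits_cube (j * M + l) b1 b2 b3
      have := h3 ((j * M + l) * (M * M * M) + ((i₁ * M + i₂) * M + i₃))
        (add_lt_mul hP (add_lt_mul (add_lt_mul b1 b2) b3))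
      have ha : Active M ((j * M + l) * (M * M * M) + ((i₁ * M + i₂) * M + i₃)) := by
        rw [Active, e1, e2, e3, e4, mod_of_lt _ (show l < M by omega)]
        exact ⟨by omega, hi⟩
      simp only [ρ, if_pos ha, e1, e2, e3, e4] at this
      exact this
  · refine lt_of_lt_of_le (b := ((D x : ℕ) : WithBot ℕ)) ?_ ?_
    · refine (degree_sum_le _ _).trans_lt
        ((Finset.sup_lt_iff (WithBot.bot_lt_coe _)).2 fun t ht => ?_)
      have ht := Finset.mem_range.1 ht
      by_cases hQt : Q t = 0
      · rw [hQt]; simp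
      have hall : (allowed x).getD t 0 ≠ 0 := fun h0 => hQt (h2 t ht h0)
      rw [allowed, getD_tab, if_pos ht, ltn_ne_zero] at hall
      have hg : (f.comp (C γ * X)).natDegree ≤ k x := by
        refine natDegree_comp_le.trans ?_
        calc _ ≤ k x * 1 := Nat.mul_le_mul hf (natDegree_C_mul_le γ X |>.trans natDegree_X_le)
          _ = _ := mul_one _
      refine degree_le_natDegree.trans_lt (WithBot.coe_lt_coe.2 (lt_of_le_of_lt ?_ hall))
      refine (natDegree_mul_le_of_le (natDegree_mul_le_of_le (natDegree_C_mul_X_pow_le _ _)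
        (natDegree_pow_le_of_le _ hf)) (natDegree_pow_le_of_le _ hg)).trans (le_of_eq ?_)
      ring
    · rw [Finset.card_product, Finset.card_range, D, ← hM]
      refine WithBot.coe_le_coe.2 ?_
      rw [mul_assoc]
      exact Nat.mul_le_mul_left _ (Nat.mul_le_mul_right _ hsc)

end Interpolation

end Decoder

end RAM

namespace RAM

namespace Decoder

/-! ## Correctness of the decoder -/

section Decode

variable {F : Type} [Field F] {γ : F} {x : List ℕ} {enc : F → ℕ}

/-- The encoding of a polynomial, as a list of numbers. -/
def codeList (x : List ℕ) (enc : F → ℕ) (γ : F) (f : F[X]) : List ℕ :=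
  tab (len x) fun i => enc (f.eval (γ ^ i))

open Classical in
/-- The positions in which the encoding of `f` differs from the received word `z`. -/
noncomputable def errorSet (x : List ℕ) (γ : F) (z : ℕ → F) (f : F[X]) : Finset ℕ :=
  (Finset.range (bl x)).filter fun j => ∃ l < m x, f.eval (γ ^ (j * m x + l)) ≠ z (j * m x + l)

theorem Encodes.errors_eq (h : Encodes x enc γ) {z : ℕ → F}
    (hz : ∀ P < len x, rcv x P = enc (z P)) (f : F[X]) :
    errors x (codeList x enc γ f) = (errorSet x γ z f).card := by
  classical
  rw [errors, nsum_eq, errorSet, Finset.card_filter]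
  refine Finset.sum_congr rfl fun j hj => ?_
  have hiff : (find (m x) fun l => 1 - eqn ((codeList x enc γ f).getD (j * m x + l) 0)
      (rcv x (j * m x + l))) < m x ↔ ∃ l < m x, f.eval (γ ^ (j * m x + l)) ≠ z (j * m x + l) := by
    rw [find_lt_iff]
    refine exists_congr fun l => and_congr_right fun hl => ?_
    have hP : j * m x + l < len x := add_lt_mul (Finset.mem_range.1 hj) hl
    rw [codeList, getD_tab, if_pos hP, hz _ hP, eqn]
    rw [← h.inj.ne_iff]
    split_ifs with c <;> simp [c]
  rw [ltn]
  by_cases hc : ∃ l < m x, f.eval (γ ^ (j * m x + l)) ≠ z (j * m x + l)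
  · rw [if_pos hc, if_pos (hiff.2 hc)]
  · rw [if_neg hc, if_neg fun h' => hc (hiff.1 h')]

theorem Encodes.word_eq (h : Encodes x enc γ) {LL : List (List ℕ)}
    (hLL : ∀ p ∈ LL, p.length = k x + 1) {t : ℕ} {f : F[X]} (hf : f.natDegree ≤ k x)
    (ht : LL.getD t [] = tab (k x + 1) fun j => enc (f.coeff j)) :
    word x LL.flatten (t * (k x + 1)) = codeList x enc γ f := by
  refine tab_congr fun i _ => ?_
  rw [eval_eq_sum_range' (Nat.lt_succ_of_le hf)]
  refine h.sum_eq fun j hj => ?_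
  rw [getD_flatten hLL t hj, ht, getD_tab, if_pos hj, h.g_eq, h.pow_eq, h.mul_eq, pow_mul]

theorem sel_nil (c : ℕ) (l : List ℕ) : sel c [] l = sel (1 - c) l [] := by
  unfold sel
  split_ifs <;> first | rfl | omega

theorem eq_of_eval_pow_eq {n d : ℕ} (hγ : n ≤ orderOf γ) (hd : d < n) {f g : F[X]}
    (hf : f.natDegree ≤ d) (hg : g.natDegree ≤ d)
    (hfg : ∀ i < n, f.eval (γ ^ i) = g.eval (γ ^ i)) : f = g := by
  classical
  have hinj : Set.InjOn (fun i : ℕ => γ ^ i) (Finset.range n : Set ℕ) := fun i hi j hj hij =>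
    pow_injOn_Iio_orderOf
      (show i ∈ Set.Iio (orderOf γ) from (by simpa using hi : i < n).trans_le hγ)
      (show j ∈ Set.Iio (orderOf γ) from (by simpa using hj : j < n).trans_le hγ) hij
  refine eq_of_natDegree_lt_card_of_eval_eq' f g ((Finset.range n).image fun i => γ ^ i) ?_ ?_
  · intro y hy
    obtain ⟨i, hi, rfl⟩ := Finset.mem_image.1 hy
    exact hfg i (Finset.mem_range.1 hi)
  · rw [Finset.card_image_of_injOn hinj, Finset.card_range]
    omega

theorem Encodes.codeList_inj (h : Encodes x enc γ) (hγ : len x ≤ orderOf γ) (hk : k x < len x)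
    {f g : F[X]} (hf : f.natDegree ≤ k x) (hg : g.natDegree ≤ k x)
    (hfg : codeList x enc γ f = codeList x enc γ g) : f = g := by
  refine eq_of_eval_pow_eq hγ hk hf hg fun i hi => ?_
  have := congrArg (fun l : List ℕ => l.getD i 0) hfg
  simpa only [codeList, getD_tab, if_pos hi, h.inj.eq_iff] using this

/-- The candidates contain all close polynomials, and comparing their encodings with the received
word removes the others. Distinct candidates have distinct encodings, as the degree is below the
number of evaluation points, so no repetitions arise. -/
theorem Encodes.close_spec (h : Encodes x enc γ) (hγ : len x ≤ orderOf γ) (hk : k x < len x)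
    {z : ℕ → F} (hz : ∀ P < len x, rcv x P = enc (z P)) {LL : List (List ℕ)} (hnd : LL.Nodup)
    {Z : F[X] → Prop}
    (hLL : ∀ p, p ∈ LL ↔ ∃ f : F[X], f.natDegree ≤ k x ∧ Z f ∧
      p = tab (k x + 1) fun j => enc (f.coeff j))
    (hZ : ∀ f : F[X], f.natDegree ≤ k x → (errorSet x γ z f).card ≤ e x → Z f) :
    ∃ CC : List (List ℕ), close x LL.flatten = CC.flatten ∧ CC.Nodup ∧ ∀ p, p ∈ CC ↔
      ∃ f : F[X], f.natDegree ≤ k x ∧ (errorSet x γ z f).card ≤ e x ∧ p = codeList x enc γ f := by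
  have hlen : ∀ p ∈ LL, p.length = k x + 1 := by
    intro p hp
    obtain ⟨f, -, -, rfl⟩ := (hLL p).1 hp
    exact length_tab _ _
  set c : ℕ → ℕ := fun t => 1 - ltn (e x) (errors x (word x LL.flatten (t * (k x + 1)))) with hc
  have hc0 : ∀ t f, word x LL.flatten (t * (k x + 1)) = codeList x enc γ f →
      (c t ≠ 0 ↔ (errorSet x γ z f).card ≤ e x) := by
    intro t f ht
    simp only [hc]
    rw [ht, h.errors_eq hz, ltn]
    split_ifs <;> simp <;> omega
  refine ⟨((List.range LL.length).filter fun t => c t ≠ 0).map fun t =>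
    word x LL.flatten (t * (k x + 1)), ?_, ?_, fun p => ?_⟩
  · rw [close, length_flatten_of_forall hlen, Nat.mul_div_cancel _ (Nat.succ_pos _),
      ← flatMap_sel]
    simp only [sel_nil, hc]
  · refine List.Nodup.map_on ?_ (List.nodup_range.filter _)
    intro t ht t' ht' htt
    have hs := List.mem_range.1 (List.mem_filter.1 ht).1
    have hs' := List.mem_range.1 (List.mem_filter.1 ht').1
    obtain ⟨f, hf, -, hft⟩ := (hLL _).1 (List.getElem_mem hs)
    obtain ⟨g, hg, -, hgt⟩ := (hLL _).1 (List.getElem_mem hs')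
    rw [h.word_eq hlen hf (by rw [List.getD_eq_getElem _ _ hs, hft]),
      h.word_eq hlen hg (by rw [List.getD_eq_getElem _ _ hs', hgt])] at htt
    rw [h.codeList_inj hγ hk hf hg htt, ← hgt, hnd.getElem_inj_iff] at hft
    exact hft
  · simp only [List.mem_map, List.mem_filter, List.mem_range, decide_eq_true_eq]
    constructor
    · rintro ⟨t, ⟨ht, hct⟩, rfl⟩
      obtain ⟨f, hf, -, hft⟩ := (hLL _).1 (List.getElem_mem ht)
      have hw := h.word_eq hlen hf (by rw [List.getD_eq_getElem _ _ ht, hft])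
      exact ⟨f, hf, (hc0 t f hw).1 hct, hw⟩
    · rintro ⟨f, hf, hfe, rfl⟩
      obtain ⟨t, ht, hft⟩ := List.mem_iff_getElem.1 ((hLL _).2 ⟨f, hf, hZ f hf hfe, rfl⟩)
      have hw := h.word_eq hlen hf (by rw [List.getD_eq_getElem _ _ ht, hft])
      exact ⟨t, ⟨ht, (hc0 t f hw).2 hfe⟩, hw⟩

variable [Fintype F]

theorem Encodes.decode_spec (h : Encodes x enc γ) (hq : q x = Fintype.card F)
    (hγ : orderOf γ = Fintype.card F - 1) {z : ℕ → F} (hz : ∀ P < len x, rcv x P = enc (z P))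
    (hm : 0 < m x) (hk : 0 < k x) (hkl : k x < len x) (hD : D x < k x * q x)
    (hc : k x ^ 2 * (bl x * (m x - 1) * (m x * (m x + 1) * (m x + 2))) < D x ^ 3) :
    ∃ CC : List (List ℕ), decode x = CC.flatten ∧ CC.Nodup ∧ ∀ p, p ∈ CC ↔
      ∃ f : F[X], f.natDegree ≤ k x ∧ (errorSet x γ z f).card ≤ e x ∧ p = codeList x enc γ f := by
  classical
  obtain ⟨K, _, _, ξ, hkum⟩ := exists_isKummer hγ h.ne_zero
  have hlen : len x ≤ orderOf γ := by
    rw [hγ, ← hq, len, bl]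
    exact Nat.div_mul_le_self _ _
  have hkq : k x + 1 ≤ Fintype.card F - 1 := by rw [← hγ]; omega
  obtain ⟨Q, hQ, hQ0, hQf⟩ := h.interp_spec hq hγ hz hm hk hD hc
  obtain ⟨τ, hτ, hτ0, hτf⟩ := h.poly_spec hkum hq hQ hQ0
  obtain ⟨LL, h1, h2, h3⟩ := h.roots_spec hkum hq hkq hτ hτ0
  rw [decode, h1]
  refine h.close_spec hlen hkl hz h2
    -- A root may have nonzero coordinates beyond number `k`, and then its prefix is a candidate
    -- without being a root itself. So candidates are only required to be prefixes of roots.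
    (Z := fun f => ∃ w : ℕ → F, (polyK ξ τ (Fintype.card F * Fintype.card F)).eval
      (ofCoords ξ (Fintype.card F - 1) w) = 0 ∧ ∀ j < k x + 1, f.coeff j = w j) (fun p => ?_) ?_
  · rw [h3]
    constructor
    · rintro ⟨w, hw, rfl⟩
      have hco : ∀ j < k x + 1, (∑ i ∈ Finset.range (k x + 1), C (w i) * X ^ i).coeff j = w j := by
        intro j hj
        simp [finsetSum_coeff, coeff_C_mul, coeff_X_pow, hj]
      refine ⟨∑ i ∈ Finset.range (k x + 1), C (w i) * X ^ i, ?_, ⟨w, hw, hco⟩,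
        tab_congr fun j hj => by rw [hco j hj]⟩
      refine natDegree_sum_le_of_forall_le _ _ fun i hi => ?_
      exact (natDegree_C_mul_X_pow_le _ _).trans (Nat.lt_succ_iff.1 (Finset.mem_range.1 hi))
    · rintro ⟨f, -, ⟨w, hw, hco⟩, rfl⟩
      exact ⟨w, hw, tab_congr fun j hj => by rw [hco j hj]⟩
  · intro f hf hfe
    refine ⟨f.coeff, ?_, fun _ _ => rfl⟩
    -- Since the degree is below q - 1, no reduction modulo E takes place.
    have hcoord : ofCoords ξ (Fintype.card F - 1) f.coeff = aeval ξ f := by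
      rw [aeval_eq_sum_range' (n := Fintype.card F - 1) (by omega)]
      rfl
    rw [hcoord]
    refine hτf f ?_
    rw [← hq]
    refine hQf f hf ((Finset.range (bl x)).filter fun j => ¬ ∃ l < m x,
      f.eval (γ ^ (j * m x + l)) ≠ z (j * m x + l)) (Finset.filter_subset _ _) ?_ ?_
    · have := Finset.card_filter_add_card_filter_not (s := Finset.range (bl x)) fun j =>
        ∃ l < m x, f.eval (γ ^ (j * m x + l)) ≠ z (j * m x + l)
      rw [Finset.card_range] at this
      rw [errorSet] at hfe
      have h' : ∀ a b c d : ℕ, a + b = c → a ≤ d → c - d ≤ b := by omega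
      exact h' _ _ _ _ this (by convert hfe)
    · intro j hj l hl
      have := (Finset.mem_filter.1 hj).2
      push Not at this
      exact this l hl

end Decode

end Decoder

end RAM

namespace FoldedRS

open RAM RAM.Decoder

/-! ## The decoder for folded Reed-Solomon codes -/

/-! ### The input list, words and distances -/

section Input

variable (C : FoldedRS) (num : C.F ≃ Fin C.q)

theorem getD_grid {a b : ℕ} (f : Fin a → Fin b → ℕ) (i : Fin a) (j : Fin b) :
    ((List.finRange a).flatMap fun i => (List.finRange b).map fun j => f i j).getD (i * b + j) 0 =
      f i j := by
  rw [List.flatMap_def, getD_flatten (n := b) _ _ j.2, List.getD_eq_getElem _ _ (by simp)]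
  · simp
  · simp

theorem length_grid {a b : ℕ} (f : Fin a → Fin b → ℕ) :
    ((List.finRange a).flatMap fun i => (List.finRange b).map fun j => f i j).length = a * b := by
  simp

theorem getD_table (op : C.F → C.F → C.F) (a b : C.F) :
    (C.table num op).getD (num a * C.q + num b) 0 = num (op a b) := by
  rw [table, getD_grid fun a b => (num (op (num.symm a) (num.symm b)) : ℕ)]
  simp

theorem length_table (op : C.F → C.F → C.F) : (C.table num op).length = C.q * C.q :=
  length_grid _

theorem length_wordToNat (z : C.Word) : (C.wordToNat num z).length = C.blockLength * C.m :=
  length_grid _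

theorem getD_wordToNat (z : C.Word) (j : Fin C.blockLength) (l : Fin C.m) :
    (C.wordToNat num z).getD (j * C.m + l) 0 = num (z j l) :=
  getD_grid (fun j l => (num (z j l) : ℕ)) j l

theorem wordToNat_injective : Function.Injective (C.wordToNat num) := by
  intro y z h
  funext j l
  have := congrArg (fun L : List ℕ => L.getD (j * C.m + l) 0) h
  simp only [getD_wordToNat] at this
  exact num.injective (Fin.ext this)

variable (e : ℕ) (z : C.Word)

theorem q_decoderInput : RAM.Decoder.q (C.decoderInput num e z) = C.q := rfl
theorem m_decoderInput : RAM.Decoder.m (C.decoderInput num e z) = C.m := rfl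
theorem bl_decoderInput : RAM.Decoder.bl (C.decoderInput num e z) = C.blockLength := rfl

theorem decoderInput_getD (i : ℕ) : (C.decoderInput num e z).getD (5 + i) 0 =
    (C.table num (· + ·) ++ (C.table num (· * ·) ++ C.wordToNat num z)).getD i 0 := by
  rw [decoderInput, List.append_assoc, List.append_assoc,
    List.getD_append_right _ _ _ _ (by simp)]
  congr 1
  simp

theorem encodes_decoderInput :
    Encodes (C.decoderInput num e z) (fun a => (num a : ℕ)) (C.γ : C.F) where
  inj a b h := num.injective (Fin.ext h)
  lt a := (num a).2
  surj n hn := ⟨num.symm ⟨n, hn⟩, by simp⟩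
  g_eq := rfl
  ne_zero := C.γ.ne_zero
  add_eq a b := by
    rw [RAM.Decoder.add, q_decoderInput, decoderInput_getD, List.getD_append, getD_table]
    rw [length_table]
    exact add_lt_mul (num a).2 (num b).2
  mul_eq a b := by
    rw [RAM.Decoder.mul, q_decoderInput, add_assoc, decoderInput_getD, List.getD_append_right,
      length_table, Nat.add_sub_cancel_left, List.getD_append, getD_table]
    · rw [length_table]
      exact add_lt_mul (num a).2 (num b).2
    · rw [length_table]
      exact Nat.le_add_right _ _

/-- The symbols of a word, numbered in the order of the unfolded code. -/
def unfoldWord (z : C.Word) (P : ℕ) : C.F :=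
  if h : P / C.m < C.blockLength then
    z ⟨P / C.m, h⟩ ⟨P % C.m, Nat.mod_lt _ C.one_le_m⟩ else 0

theorem unfoldWord_apply (j : Fin C.blockLength) (l : Fin C.m) :
    C.unfoldWord z (j * C.m + l) = z j l := by
  have h1 := div_of_lt (j : ℕ) l.2
  have h2 := mod_of_lt (j : ℕ) l.2
  simp only [unfoldWord, h1, h2, j.2, dif_pos]

theorem exists_position {P : ℕ} (hP : P < C.blockLength * C.m) :
    ∃ (j : Fin C.blockLength) (l : Fin C.m), P = j * C.m + l :=
  ⟨⟨P / C.m, Nat.div_lt_of_lt_mul (by rwa [mul_comm])⟩, ⟨P % C.m, Nat.mod_lt _ C.one_le_m⟩,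
    (Nat.div_add_mod' P C.m).symm⟩

theorem rcv_decoderInput {P : ℕ} (hP : P < C.blockLength * C.m) :
    RAM.Decoder.rcv (C.decoderInput num e z) P = num (C.unfoldWord z P) := by
  obtain ⟨j, l, rfl⟩ := C.exists_position hP
  rw [RAM.Decoder.rcv, q_decoderInput, add_assoc, decoderInput_getD, List.getD_append_right,
    length_table, List.getD_append_right, length_table, unfoldWord_apply, ← getD_wordToNat]
  · congr 1; omega
  · rw [length_table]; omega
  · rw [length_table]; omega

theorem codeList_decoderInput (f : C.F[X]) :
    codeList (C.decoderInput num e z) (fun a => (num a : ℕ)) (C.γ : C.F) f =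
      C.wordToNat num (C.encode f) := by
  rw [← tab_getD (C.wordToNat num (C.encode f)), length_wordToNat]
  refine tab_congr fun P hP => ?_
  obtain ⟨j, l, rfl⟩ := C.exists_position hP
  rw [getD_wordToNat]
  rfl

theorem card_errorSet (f : C.F[X]) :
    (errorSet (C.decoderInput num e z) (C.γ : C.F) (C.unfoldWord z) f).card =
      C.dist (C.encode f) z := by
  classical
  have : errorSet (C.decoderInput num e z) (C.γ : C.F) (C.unfoldWord z) f =
      (Finset.univ.filter fun j => C.encode f j ≠ z j).map Fin.valEmbedding := by
    ext j
    rw [errorSet, Finset.mem_filter, Finset.mem_range, Finset.mem_map, bl_decoderInput,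
      m_decoderInput]
    simp only [Finset.mem_filter, Finset.mem_univ, true_and, Fin.valEmbedding_apply]
    constructor
    · rintro ⟨hj, l, hl, hne⟩
      refine ⟨⟨j, hj⟩, fun heq => hne ?_, rfl⟩
      rw [C.unfoldWord_apply z ⟨j, hj⟩ ⟨l, hl⟩, ← heq]
      rfl
    · rintro ⟨j, hj, rfl⟩
      obtain ⟨l, hl⟩ := Function.ne_iff.1 hj
      refine ⟨j.2, l, l.2, ?_⟩
      rw [C.unfoldWord_apply z j l]
      exact hl
  rw [this, Finset.card_map, dist, hammingDist]

theorem card_units : Nat.card C.Fˣ = C.q - 1 := by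
  rw [Nat.card_units, Nat.card_eq_fintype_card]
  rfl

theorem orderOf_gamma : orderOf (C.γ : C.F) = Fintype.card C.F - 1 := by
  rw [orderOf_units, orderOf_eq_card_of_forall_mem_zpowers C.γ_generates]
  exact C.card_units

theorem exists_decoded_list (hk : 0 < C.k)
    (hD : C.m * (C.blockLength - e) * (C.m - 1) < C.k * C.q)
    (hc : C.k ^ 2 * (C.blockLength * (C.m - 1) * (C.m * (C.m + 1) * (C.m + 2))) <
      (C.m * (C.blockLength - e) * (C.m - 1)) ^ 3) :
    ∃ L : List C.Word, C.IsDecodedList z e L ∧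
      decode (C.decoderInput num e z) = L.flatMap (C.wordToNat num) := by
  have hkl := C.k_lt
  rw [mul_comm] at hkl
  obtain ⟨CC, h1, h2, h3⟩ := (C.encodes_decoderInput num e z).decode_spec rfl C.orderOf_gamma
    (z := C.unfoldWord z) (fun P hP => C.rcv_decoderInput num e z hP) C.one_le_m hk hkl hD hc
  have h4 : ∀ p, p ∈ CC ↔ ∃ c : C.Word, (c ∈ C.code ∧ C.dist c z ≤ e) ∧ C.wordToNat num c = p := by
    intro p
    rw [h3]
    constructor
    · rintro ⟨f, hf, he, rfl⟩
      rw [card_errorSet] at he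
      exact ⟨C.encode f, ⟨⟨f, hf, rfl⟩, he⟩, (C.codeList_decoderInput num e z f).symm⟩
    · rintro ⟨_, ⟨⟨f, hf, rfl⟩, he⟩, rfl⟩
      exact ⟨f, hf, by rwa [card_errorSet], (C.codeList_decoderInput num e z f).symm⟩
  obtain ⟨L, rfl⟩ : ∃ L : List C.Word, L.map (C.wordToNat num) = CC := by
    choose! w hw using fun p => (h4 p).1
    refine ⟨CC.map w, ?_⟩
    rw [List.map_map]
    exact (List.map_congr_left fun p hp => (hw p hp).2).trans (List.map_id CC)
  refine ⟨L, ⟨h2.of_map _, fun c => ?_⟩, by rw [h1, List.flatMap_def]⟩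
  rw [← List.mem_map_of_injective (C.wordToNat_injective num), h4]
  constructor
  · rintro ⟨c', hc', heq⟩
    rwa [← C.wordToNat_injective num heq]
  · exact fun hc => ⟨c, hc, rfl⟩

end Input

/-! ### Sizes of the input and of the field -/

section Size

variable (C : FoldedRS)

theorem blockLength_mul_m_le : C.blockLength * C.m ≤ C.q - 1 := Nat.div_mul_le_self _ _

theorem blockLength_pos : 0 < C.blockLength := by
  rw [Nat.pos_iff_ne_zero]
  intro h
  have h1 := C.k_lt
  change C.k < C.m * C.blockLength at h1
  rw [h, mul_zero] at h1
  omega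

/-- The list has O(q²) entries, each at most `q`. -/
theorem size_decoderInput (num : C.F ≃ Fin C.q) {e : ℕ} (he : e ≤ C.blockLength) (z : C.Word) :
    Data.size (C.decoderInput num e z) + 2 ≤ (C.q + 2) ^ 4 := by
  have h1 := C.blockLength_mul_m_le
  have h2 : C.blockLength ≤ C.q := (Nat.le_mul_of_pos_right _ C.one_le_m).trans (by omega)
  have h3 : C.m ≤ C.q := (Nat.le_mul_of_pos_left _ C.blockLength_pos).trans (by omega)
  have h4 : C.k ≤ C.q := by
    have := C.k_lt
    rw [mul_comm] at this
    change C.k < C.blockLength * C.m at this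
    omega
  have hlen : (C.decoderInput num e z).length ≤ 5 + 2 * (C.q * C.q) + C.q := by
    simp only [decoderInput, List.length_append, length_table, length_wordToNat, List.length_cons,
      List.length_nil]
    omega
  have hmem : ∀ a ∈ C.decoderInput num e z, a ≤ C.q := by
    intro a ha
    simp only [decoderInput, table, wordToNat, List.mem_append, List.mem_flatMap, List.mem_map,
      List.mem_cons, List.not_mem_nil, or_false] at ha
    rcases ha with (((rfl | rfl | rfl | rfl | rfl) | ⟨_, -, _, -, rfl⟩) | ⟨_, -, _, -, rfl⟩) |
      ⟨_, -, _, -, rfl⟩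
    · exact le_rfl
    · exact (Fin.is_lt _).le
    · exact h3
    · exact h4
    · exact he.trans h2
    all_goals exact (Fin.is_lt _).le
  have hsum := List.sum_le_card_nsmul _ _ hmem
  rw [size_list]
  rw [smul_eq_mul] at hsum
  have := Nat.mul_le_mul_right C.q hlen
  nlinarith [Nat.zero_le C.q, Nat.zero_le (C.q ^ 2), Nat.zero_le (C.q ^ 3), Nat.zero_le (C.q ^ 4)]

/-- The block length is the integer part of (q - 1) / m. This converts time bounds in the field size
into time bounds in N and 1/ε. -/
theorem q_le : C.q ≤ C.m * (C.blockLength + 1) := by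
  have := Nat.lt_mul_div_succ (C.q - 1) C.one_le_m
  rw [blockLength]
  omega

end Size

/-! ### Dimension and rate -/

section Rate

variable (C : FoldedRS)

theorem encode_injective : Set.InjOn C.encode {f : C.F[X] | f.natDegree ≤ C.k} := by
  intro f hf g hg hfg
  have hk := C.k_lt
  rw [mul_comm] at hk
  refine eq_of_eval_pow_eq (γ := (C.γ : C.F)) (n := C.blockLength * C.m) ?_ hk hf hg fun P hP => ?_
  · rw [orderOf_gamma]
    exact C.blockLength_mul_m_le
  · obtain ⟨j, l, rfl⟩ := C.exists_position hP
    exact congrFun (congrFun hfg j) l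

theorem ncard_code : C.q ^ (C.k + 1) ≤ C.code.ncard := by
  let p : (Fin (C.k + 1) → C.F) → C.F[X] := fun c => ∑ i, Polynomial.C (c i) * X ^ (i : ℕ)
  have hp : ∀ c, p c ∈ {f : C.F[X] | f.natDegree ≤ C.k} := fun c =>
    natDegree_sum_le_of_forall_le _ _ fun i _ =>
      (natDegree_C_mul_X_pow_le _ _).trans (Nat.lt_succ_iff.1 i.2)
  have hinj : Function.Injective p := by
    intro c d hcd
    funext i
    have := congrArg (fun f => coeff f (i : ℕ)) hcd
    simpa [p, finsetSum_coeff, coeff_C_mul, coeff_X_pow, Fin.val_inj] using this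
  have hfin : C.code.Finite := Set.toFinite _
  have hinj' : Function.Injective fun c => C.encode (p c) := fun c d hcd =>
    hinj (C.encode_injective (hp c) (hp d) hcd)
  calc C.q ^ (C.k + 1) = (Set.univ : Set (Fin (C.k + 1) → C.F)).ncard := by
        rw [Set.ncard_univ, Nat.card_eq_fintype_card]
        simp [q]
    _ = ((fun c => C.encode (p c)) '' Set.univ).ncard := (Set.ncard_image_of_injective _ hinj').symm
    _ ≤ _ := Set.ncard_le_ncard (by rintro _ ⟨c, -, rfl⟩; exact ⟨p c, hp c, rfl⟩) hfin

theorem le_rate {R : ℝ} (h : R * (C.m * C.blockLength) ≤ C.k + 1) : R ≤ C.rate := by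
  have hq : (1 : ℝ) < C.q := by exact_mod_cast Fintype.one_lt_card (α := C.F)
  have hm : (0 : ℝ) < C.m := by exact_mod_cast C.one_le_m
  have hN : (0 : ℝ) < C.blockLength := by exact_mod_cast C.blockLength_pos
  have hlog : 0 < Real.log C.q := Real.log_pos hq
  have hcard : ((Fintype.card (Fin C.m → C.F) : ℕ) : ℝ) = (C.q : ℝ) ^ C.m := by simp [q]
  have h1 : (C.q : ℝ) ^ (C.k + 1) ≤ C.code.ncard := by exact_mod_cast C.ncard_code
  have h2 : ((C.k : ℝ) + 1) * Real.log C.q ≤ Real.log C.code.ncard := by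
    have := Real.log_le_log (by positivity) h1
    rwa [Real.log_pow, Nat.cast_succ] at this
  rw [rate, codeRate, Real.logb, hcard, Real.log_pow, le_div_iff₀ hN, le_div_iff₀ (by positivity)]
  calc R * C.blockLength * (C.m * Real.log C.q) = R * (C.m * C.blockLength) * Real.log C.q := by ring
    _ ≤ (C.k + 1) * Real.log C.q := by gcongr
    _ ≤ _ := h2

end Rate

end FoldedRS

namespace FoldedRS

open RAM RAM.Decoder

/-! ## The parameters -/

/-- Here w = m - 1 and t = N - e. Inserting k < R m N and t³ ≥ (1 + ε)³ R² N³, all factors cancel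
except (w + 2)(w + 3) ≤ (1 + ε)³ w². This holds since ε w ≥ 3 gives w + 3 ≤ (1 + ε) w. The exponent
2/3 comes from the cube of t against the square of k. -/
theorem counting_condition {ε R : ℝ} (hε : 0 < ε) (hR : 0 < R) {w N k t : ℕ} (hw : 0 < w)
    (hN : 0 < N) (hεw : 3 ≤ ε * w) (hk : (k : ℝ) < R * ((w + 1 : ℕ) * N))
    (ht : (1 + ε) * R ^ (2 / 3 : ℝ) * N ≤ t) :
    k ^ 2 * (N * w * ((w + 1) * (w + 1 + 1) * (w + 1 + 2))) < ((w + 1) * t * w) ^ 3 := by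
  have hw' : (0 : ℝ) < w := by exact_mod_cast hw
  have hN' : (0 : ℝ) < N := by exact_mod_cast hN
  have hR3 : (R ^ (2 / 3 : ℝ)) ^ 3 = R ^ 2 := by
    rw [← Real.rpow_natCast, ← Real.rpow_mul hR.le]
    norm_num
  have h1 : (1 + ε) ^ 3 * R ^ 2 * N ^ 3 ≤ (t : ℝ) ^ 3 := by
    rw [← hR3, ← mul_pow, ← mul_pow]
    gcongr
  have h2 : (k : ℝ) ^ 2 < (R * ((w + 1 : ℕ) * N)) ^ 2 := by gcongr
  have h3 : ((w : ℝ) + 1 + 1) * (w + 1 + 2) ≤ (1 + ε) ^ 3 * w ^ 2 := by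
    have h4 : (w : ℝ) + 1 + 2 ≤ (1 + ε) * w := by linarith
    calc ((w : ℝ) + 1 + 1) * (w + 1 + 2) ≤ ((1 + ε) * w) * ((1 + ε) * w) := by
          gcongr; linarith
      _ = (1 + ε) ^ 2 * w ^ 2 := by ring
      _ ≤ (1 + ε) ^ 3 * w ^ 2 := by
          gcongr
          · linarith
          · norm_num
  have h5 : (k : ℝ) ^ 2 * (N * w * ((w + 1) * (w + 1 + 1) * (w + 1 + 2))) <
      (((w : ℝ) + 1) * t * w) ^ 3 := by
    calc (k : ℝ) ^ 2 * (N * w * ((w + 1) * (w + 1 + 1) * (w + 1 + 2)))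
        < (R * ((w + 1 : ℕ) * N)) ^ 2 * (N * w * ((w + 1) * (w + 1 + 1) * (w + 1 + 2))) := by
          gcongr
      _ = R ^ 2 * N ^ 3 * (w + 1) ^ 3 * w * ((w + 1 + 1) * (w + 1 + 2)) := by push_cast; ring
      _ ≤ R ^ 2 * N ^ 3 * (w + 1) ^ 3 * w * ((1 + ε) ^ 3 * w ^ 2) := by gcongr
      _ = ((1 + ε) ^ 3 * R ^ 2 * N ^ 3) * ((w + 1) ^ 3 * w ^ 3) := by ring
      _ ≤ (t : ℝ) ^ 3 * ((w + 1) ^ 3 * w ^ 3) := by gcongr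
      _ = _ := by ring
  exact_mod_cast h5

theorem listDecodesWithin {p : Prog} {c : ℕ}
    (hp : ∀ x, p.OutputsWithin x (decode x) ((Data.size x + 2 : ℕ) ^ c : ℕ)) (C : FoldedRS)
    {ε R : ℝ} (hε : 0 < ε) (hR : 0 < R) (hk : C.m ≤ C.k + 1)
    (hεm : 3 ≤ ε * (C.m - 1 : ℕ)) (hmε : (C.m : ℝ) ≤ 3 / ε + 2)
    (hkR : (C.k : ℝ) < R * (C.m * C.blockLength)) {e : ℕ}
    (he : (e : ℝ) ≤ (1 - (1 + ε) * R ^ (2 / 3 : ℝ)) * C.blockLength) :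
    C.ListDecodesWithin p e (12 ^ (4 * c) * (C.blockLength + 1 / ε) ^ (8 * c)) := by
  intro num z
  have hN := C.blockLength_pos
  have hN1 : (1 : ℝ) ≤ C.blockLength := by exact_mod_cast hN
  have hw : 0 < C.m - 1 := by
    rw [Nat.pos_iff_ne_zero]
    intro h0
    rw [h0, Nat.cast_zero, mul_zero] at hεm
    norm_num at hεm
  have hR' : 0 < R ^ (2 / 3 : ℝ) := Real.rpow_pos_of_pos hR _
  have heN : e ≤ C.blockLength := by
    have : (e : ℝ) ≤ C.blockLength := by
      refine he.trans ?_
      have : 0 ≤ (1 + ε) * R ^ (2 / 3 : ℝ) * C.blockLength := by positivity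
      linarith
    exact_mod_cast this
  have hk0 : 0 < C.k := by omega
  obtain ⟨L, hL, hdec⟩ := C.exists_decoded_list num e z hk0
    (by
      -- The hypothesis `C.m ≤ C.k + 1` serves to bound D by N m k ≤ (q - 1) k, so that the
      -- exponents of Y and Z stay below `q`.
      calc C.m * (C.blockLength - e) * (C.m - 1) ≤ C.blockLength * C.m * C.k := by
            rw [mul_comm C.blockLength]
            exact Nat.mul_le_mul (Nat.mul_le_mul_left _ (Nat.sub_le _ _)) (by omega)
        _ ≤ (C.q - 1) * C.k := Nat.mul_le_mul_right _ C.blockLength_mul_m_le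
        _ < C.k * C.q := by
            rw [mul_comm]
            have : 0 < C.q := Fintype.card_pos
            exact Nat.mul_lt_mul_of_pos_left (by omega) hk0)
    (by
      have := counting_condition hε hR hw hN hεm (k := C.k) (t := C.blockLength - e)
        (by rwa [Nat.sub_add_cancel C.one_le_m]) (by rw [Nat.cast_sub heN]; linarith)
      rwa [Nat.sub_add_cancel C.one_le_m] at this)
  refine ⟨L, hL, ?_⟩
  obtain ⟨t, s, h1, h2, h3⟩ := hp (C.decoderInput num e z)
  refine ⟨t, s, h1, h2.trans ?_, h3.trans hdec⟩
  set Y : ℝ := C.blockLength + 1 / ε with hY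
  have hε' : 0 < 1 / ε := by positivity
  have hY1 : 1 ≤ Y := by linarith
  -- The factors are m ≤ 5 Y and N + 1 ≤ 2 Y, hence q ≤ 10 Y², and 2 ≤ 2 Y².
  have hq : (C.q : ℝ) + 2 ≤ 12 * Y ^ 2 := by
    have h4 : (C.q : ℝ) ≤ C.m * (C.blockLength + 1) := by exact_mod_cast C.q_le
    have h5 : (C.m : ℝ) ≤ 5 * Y := by
      have : 3 / ε = 3 * (1 / ε) := by ring
      linarith
    have h6 : (C.m : ℝ) * (C.blockLength + 1) ≤ (5 * Y) * (2 * Y) := by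
      gcongr
      linarith
    nlinarith
  have hsize := C.size_decoderInput num heN z
  calc (((Data.size (C.decoderInput num e z) + 2 : ℕ) ^ c : ℕ) : ℝ)
      ≤ (((C.q + 2) ^ 4) ^ c : ℕ) := by exact_mod_cast Nat.pow_le_pow_left hsize c
    _ = ((C.q : ℝ) + 2) ^ (4 * c) := by push_cast; rw [← pow_mul]
    _ ≤ (12 * Y ^ 2) ^ (4 * c) := by gcongr
    _ = 12 ^ (4 * c) * Y ^ (8 * c) := by rw [mul_pow, ← pow_mul]; ring_nf

/-- Folded Reed-Solomon codes of rate close to `R` with arbitrarily large block length. -/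
theorem exists_of_rate {R : ℝ} (hR : 0 < R) (hR1 : R < 1) {m : ℕ} (hm : 1 ≤ m) (i : ℕ) :
    ∃ C : FoldedRS, C.m = m ∧ i ≤ C.blockLength ∧ m ≤ C.k + 1 ∧
      (C.k : ℝ) < R * (m * C.blockLength) ∧ R * (m * C.blockLength) ≤ C.k + 1 := by
  -- The summand `i` makes the block length large; ⌈1/R⌉ gives R N ≥ 1, hence m ≤ ⌈R m N⌉ = k + 1.
  -- Prime fields suffice for the family.
  obtain ⟨p, hp, hprime⟩ := Nat.exists_infinite_primes (m * (i + ⌈1 / R⌉₊ + 1) + 1)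
  have := Fact.mk hprime
  obtain ⟨γ, hγ⟩ := IsCyclic.exists_generator (α := (ZMod p)ˣ)
  set N := (p - 1) / m with hN
  have hNi : i + ⌈1 / R⌉₊ + 1 ≤ N := (Nat.le_div_iff_mul_le hm).2 (by rw [mul_comm]; omega)
  have hm0 : (1 : ℝ) ≤ m := by exact_mod_cast hm
  have hNR : 1 ≤ R * N := by
    have h1 : 1 / R ≤ N := (Nat.le_ceil _).trans (by exact_mod_cast (by omega : ⌈1 / R⌉₊ ≤ N))
    rw [div_le_iff₀ hR] at h1
    linarith
  set r : ℝ := R * (m * N) with hr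
  have hmr : (m : ℝ) ≤ r := by
    calc (m : ℝ) = m * 1 := (mul_one _).symm
      _ ≤ m * (R * N) := by gcongr
      _ = r := by rw [hr]; ring
  have hr0 : 0 ≤ r := by linarith
  have hc1 : m ≤ ⌈r⌉₊ := by exact_mod_cast hmr.trans (Nat.le_ceil r)
  have hc2 : (⌈r⌉₊ : ℝ) < r + 1 := Nat.ceil_lt_add_one hr0
  have hc3 : ⌈r⌉₊ ≤ m * N := by
    refine Nat.ceil_le.2 ?_
    rw [hr]
    push_cast
    calc R * ((m : ℝ) * N) ≤ 1 * (m * N) := by gcongr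
      _ = _ := one_mul _
  -- The least number of message symbols for which the rate is at least R.
  obtain ⟨k, hk⟩ : ∃ k, ⌈r⌉₊ = k + 1 := ⟨⌈r⌉₊ - 1, by omega⟩
  have hcard : Fintype.card (ZMod p) = p := ZMod.card p
  let C : FoldedRS :=
    { F := ZMod p, γ := γ, γ_generates := hγ, m := m, one_le_m := hm, k := k,
      k_lt := by rw [hcard, ← hN]; omega }
  have hbl : C.blockLength = N := by
    change (Fintype.card (ZMod p) - 1) / m = N
    rw [hcard]
  refine ⟨C, rfl, ?_, ?_, ?_, ?_⟩
  · rw [hbl]; omega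
  · change m ≤ k + 1
    omega
  · rw [hbl]
    change (k : ℝ) < r
    rw [hk] at hc2
    push_cast at hc2
    linarith
  · rw [hbl]
    change r ≤ (k : ℝ) + 1
    have := Nat.le_ceil r
    rw [hk] at this
    exact_mod_cast this

end FoldedRS

theorem mainTheorem8 :
    ∃ (decoder : RAM.Prog) (A B : ℝ) (d : ℕ), ∀ ε R : ℝ, 0 < ε → 0 < R → R < 1 →
      ∃ (m : ℕ) (C : ℕ → FoldedRS),
        (m : ℝ) ≤ A * max 1 (1 / ε) ∧
        Tendsto (fun i => (C i).blockLength) atTop atTop ∧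
        ∀ i : ℕ, (C i).m = m ∧ R ≤ (C i).rate ∧
          ∀ e : ℕ, (e : ℝ) ≤ (1 - (1 + ε) * R ^ (2 / 3 : ℝ)) * (C i).blockLength →
            (C i).ListDecodesWithin decoder e (B * ((C i).blockLength + 1 / ε) ^ d) := by
  obtain ⟨p, c, hp⟩ := RAM.PT.exists_prog RAM.Decoder.pt_decode
  -- The folding parameter is m = ⌈3/ε⌉ + 1 ≤ 3/ε + 2, which is at most five times the maximum of 1
  -- and 1/ε. The exponent 8 c comes from the input size, at most (q + 2)⁴ with q + 2 = O(Y²) for Y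
  -- = N + 1/ε, raised to the power c.
  refine ⟨p, 5, 12 ^ (4 * c), 8 * c, fun ε R hε hR hR1 => ?_⟩
  have hceil := Nat.le_ceil (3 / ε)
  have hceil' := Nat.ceil_lt_add_one (show 0 ≤ 3 / ε by positivity)
  set w := ⌈3 / ε⌉₊
  have hm : ((w + 1 : ℕ) : ℝ) ≤ 3 / ε + 2 := by push_cast; linarith
  choose C h1 h2 h3 h4 h5 using FoldedRS.exists_of_rate hR hR1 (Nat.le_add_left 1 w)
  refine ⟨w + 1, C, ?_, tendsto_atTop_mono h2 tendsto_id, fun i => ⟨h1 i, ?_, fun e he => ?_⟩⟩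
  · have h6 := le_max_left 1 (1 / ε)
    have h7 := le_max_right 1 (1 / ε)
    have h8 : 3 / ε = 3 * (1 / ε) := by ring
    linarith
  · exact (C i).le_rate (by rw [h1]; exact h5 i)
  · refine (C i).listDecodesWithin hp hε hR (by rw [h1]; exact h3 i) ?_ (by rwa [h1])
      (by rw [h1]; exact h4 i) he
    rw [h1, Nat.add_sub_cancel]
    rwa [div_le_iff₀' hε] at hceil
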